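/- **Setting.** Let $M$ be a closed (compact, boundaryless) smooth Riemannian surface and $f:M\to M$ a $C^\infty$ diffeomorphism. Let $\widehat M$ be the projective tangent bundle of $M$ (pairs $(x,E)$ with $E$ a line in $T_xM$), $\pi:\widehat M\to M$ the projection, $\widehat f(x,E)=(f(x),Df(E))$, $\varphi(x,E)=\log\|Df|_E\|$ and $S_n\varphi=\sum_{i<n}\varphi\circ\widehat f^{\,i}$. Put $\lambda^+(x)=\limsup_n\frac1n\log\|Df^n(x)\|$ and $\lambda^+(\mu)=\int\lambda^+\,d\mu$. Let $\sigma:[0,1]\to M$ be a $C^\infty$ injective curve with nowhere vanishing derivative, with lift $\widehat\sigma(s)=(\sigma(s),\mathbb R\sigma'(s))$, such that $\limsup_n\frac1n\log\|Df^n|_{\mathbb R\sigma'(s)}\|>0$ for a set of $s$ of positive Lebesgue measure. Let $\overline\lambda$ be the essential supremum over $s\in[0,1]$ of this upper limit. Fix a metric $d$, compatible with the weak-$*$ topology, on the space of finite Borel measures on $\widehat M$. *Good sets.* For $0<\lambda^{min}<\overline\lambda<\lambda^{max}$ let $T_n=T_n(\lambda^{min},\lambda^{max})$ be the set of $s\in[0,1]$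 such that $\lambda^{min}\le\frac1n\log\|Df^n|_{\mathbb R\sigma'(s)}\|\le\lambda^{max}$, $\sigma(s)$ is not $f$-periodic, and $\|Df^i|_{E_{n-i}}\|\ge1$ for all $0\le i\le n$, where $(f^{n-i}\sigma(s),E_{n-i})=\widehat f^{\,n-i}(\widehat\sigma(s))$. *Empirical measures.* Given $n\geq 1$ and $\xi\in\widehat M$ let $p_n(\xi)=\frac1n\sum_{i<n}\delta_{\widehat f^{\,i}\xi}$. An orbit segment $(\zeta,\dots,\widehat f^{\,\ell-1}\zeta)$ is $(\alpha,L)$-neutral if $\ell\ge L$ and $S_i\varphi(\zeta)\le\alpha i$ for $0<i\le\ell$. Let $p_n^{\alpha,L}(\xi)=\frac1n\sum_{i<n}1_N(\widehat f^{\,i}\xi)\,\delta_{\widehat f^{\,i}\xi}$, where $N$ is the union of the $(\alpha,L)$-neutral sub-segments of $(\xi,\dots,\widehat f^{\,n-1}\xi)$. *Selections.* Let $\lambda^{min}_k,\lambda^{max}_k\to\overline\lambda$ with $0<\lambda_k^{min}<\overline\lambda<\lambda_k^{max}$, and $\rho_k\to1$ with $0<\rho_k<1$. A *selection* consists of integers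 $n_k\to\infty$, reals $\alpha_k\to0$ with $\alpha_k>0$, integers $L_k\to\infty$ with $L_k\geq 1$, reals $\delta_k\to0$, and sets $T'_{n_k}\subset T_{n_k}=T_{n_k}(\lambda^{min}_k,\lambda^{max}_k)$ with $|T_{n_k}|>\rho_k^{n_k}$ and $|T'_{n_k}|>\rho_k^{2n_k}$ such that, for all $k$, all $\xi,\xi'\in\widehat\sigma(T'_{n_k})$ and all $j\le k$, $d(p_{n_k}(\xi),p_{n_k}(\xi'))<\delta_k$ and $d(p_{n_k}^{\alpha_j,L_j}(\xi),p_{n_k}^{\alpha_j,L_j}(\xi'))<\delta_k$. *Neutral decompositions.* For integers $n_k$ and points $\xi_k\in\widehat M$, a *neutral decomposition* is a triple $(\beta,\widehat\mu_0,\widehat\mu_1)$ with $\beta\in[0,1]$ and $\widehat\mu_0,\widehat\mu_1$ $\widehat f$-invariant Borel probability measures on $\widehat M$ such that: (a) $p_{n_k}(\xi_k)\to(1-\beta)\widehat\mu_0+\beta\widehat\mu_1$ weak-$*$; (b) for all weak-$*$ neighborhoods $V_0,V_1$ of $(1-\beta)\widehat\mu_0$ and $\beta\widehat\mu_1$, for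 all sufficiently small $\alpha>0$ and sufficiently large $L$, one has $p_{n_k}^{\alpha,L}(\xi_k)\in V_0$ and $p_{n_k}(\xi_k)-p_{n_k}^{\alpha,L}(\xi_k)\in V_1$ for all large $k$; (c) $(1-\beta)\int\varphi\,d\widehat\mu_0=0$; (d) for $\beta\widehat\mu_1$-almost every $\xi$, $\lim_n\frac1nS_n\varphi(\xi)$ exists and is positive. **Statement.** One has $\overline\lambda>0$. For all sequences $\lambda_k^{min},\lambda_k^{max},\rho_k$ as above, selections exist; and for every selection one can choose points $\xi_k\in\widehat\sigma(T'_{n_k})$ such that $(n_k),(\xi_k)$ have a neutral decomposition along some subsequence and such that, for every neutral decomposition $(\beta,\widehat\mu_0,\widehat\mu_1)$ along any subsequence, the measure $\mu_1:=\pi_*\widehat\mu_1$ gives zero mass to every repelling hyperbolic periodic orbit of $f$ (the orbit of a point $p$ with $f^n(p)=p$ for some $n\ge1$ such that all eigenvalues of $D_pf^n$ have modulus $>1$), and $$\beta\,\lambda^+(\mu_1)=\overline\lambda>0;\qquad\text{in particular }\beta\ne0 .$$ -/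

import Mathlib

open MeasureTheory Filter Topology Manifold Bundle
open scoped ContDiff NNReal LinearAlgebra.Projectivization

noncomputable section

namespace SurfaceDynamics

/-- The model plane for surfaces. -/
abbrev Plane : Type := EuclideanSpace ℝ (Fin 2)

/-- The projective tangent bundle of the surface `M`: pairs `(x, E)` with `E` a line in `T_x M`. -/
structure ProjTangent (M : Type*) [TopologicalSpace M] [ChartedSpace Plane M] where
  /-- the base point -/
  pt : M
  /-- the line in the tangent space at the base point -/
  line : ℙ ℝ (TangentSpace (𝓡 2) pt)

section

variable {M : Type*} [TopologicalSpace M] [ChartedSpace Plane M]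

/-- The line spanned by a nonzero tangent vector. -/
def ProjTangent.span [IsManifold (𝓡 2) ∞ M]
    (v : {v : TangentBundle (𝓡 2) M // v.2 ≠ 0}) : ProjTangent M :=
  ⟨v.1.1, Projectivization.mk ℝ v.1.2 v.2⟩

/-- The usual topology of the projective tangent bundle: the quotient topology of
the set of nonzero vectors of the tangent bundle. -/
instance [IsManifold (𝓡 2) ∞ M] : TopologicalSpace (ProjTangent M) :=
  TopologicalSpace.coinduced ProjTangent.span inferInstance

instance [IsManifold (𝓡 2) ∞ M] : MeasurableSpace (ProjTangent M) := borel _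

instance [IsManifold (𝓡 2) ∞ M] : BorelSpace (ProjTangent M) := ⟨rfl⟩

theorem mfderiv_injective (f : Diffeomorph (𝓡 2) (𝓡 2) M M ∞) (x : M) :
    Function.Injective (mfderiv (𝓡 2) (𝓡 2) f x).toLinearMap :=
  (f.mfderivToContinuousLinearEquiv (by simp) (x := x)).injective

variable [IsManifold (𝓡 2) ∞ M]

/-- The projective lift `(x, E) ↦ (f x, Df E)` of a diffeomorphism. -/
def lift (f : Diffeomorph (𝓡 2) (𝓡 2) M M ∞) (ξ : ProjTangent M) : ProjTangent M :=
  ⟨f ξ.pt, Projectivization.map (mfderiv (𝓡 2) (𝓡 2) f ξ.pt).toLinearMap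
    (mfderiv_injective f ξ.pt) ξ.line⟩

/-! ### Regular curves -/

/-- A regular `C^∞` curve `[0,1] → M`: smooth up to the end points, injective, with a nowhere
vanishing derivative. Values outside `[0,1]` are irrelevant. -/
structure RegularCurve (M : Type*) [TopologicalSpace M] [ChartedSpace Plane M] where
  /-- the underlying map -/
  toFun : ℝ → M
  contMDiffOn : ContMDiffOn 𝓘(ℝ, ℝ) (𝓡 2) ∞ toFun (Set.Icc 0 1)
  injOn : Set.InjOn toFun (Set.Icc 0 1)
  deriv_ne_zero : ∀ s ∈ Set.Icc (0 : ℝ) 1,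
    (mfderivWithin 𝓘(ℝ, ℝ) (𝓡 2) toFun (Set.Icc 0 1) s (1 : ℝ) : TangentSpace (𝓡 2) (toFun s)) ≠ 0

/-- The canonical lift `s ↦ (σ s, ℝ σ'(s))` of a regular curve. -/
def RegularCurve.lift (σ : RegularCurve M) (s : unitInterval) : ProjTangent M :=
  ⟨σ.toFun s, Projectivization.mk ℝ _ (σ.deriv_ne_zero s s.2)⟩

/-! ### Expansion and exponents -/

/-- The derivative of `g` at `p`, read in the model plane: by definition each tangent space is a copy
of the model plane, and two equal base points have the same copy. -/
def planeDeriv (g : M → M) (p : M) : Plane →L[ℝ] Plane := mfderiv (𝓡 2) (𝓡 2) g p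

/-- `p` is a periodic point of `f`, and its orbit is hyperbolic and repelling: for `n ≥ 1` with
`f^n p = p`, every complex eigenvalue of `Df^n : T_p M → T_p M` has modulus larger than one. -/
def IsRepellingPeriodic (f : M → M) (p : M) : Prop :=
  ∃ n : ℕ, 0 < n ∧ f^[n] p = p ∧
    ∀ z : ℂ, Polynomial.aeval z (planeDeriv f^[n] p).toLinearMap.charpoly = 0 → 1 < ‖z‖

section Metric

variable [RiemannianBundle (fun x : M ↦ TangentSpace (𝓡 2) x)]

/-- `‖Dg|_E‖` for a line `E` in `T_x M`; by linearity it is the ratio of norms for any nonzero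
vector of `E`. -/
def lineNorm (g : M → M) (ξ : ProjTangent M) : ℝ :=
  ‖mfderiv (𝓡 2) (𝓡 2) g ξ.pt ξ.line.rep‖ / ‖ξ.line.rep‖

/-- The function `φ(x, E) = log ‖Df|_E‖`. -/
def phi (f : M → M) (ξ : ProjTangent M) : ℝ := Real.log (lineNorm f ξ)

/-- The upper Lyapunov exponent `limsup (1/n) log ‖Df^n(x)‖` (a bounded sequence when `f` is a
diffeomorphism of a compact surface). -/
def upperExponent (f : M → M) (x : M) : ℝ :=
  limsup (fun n : ℕ ↦ (1 / (n : ℝ)) * Real.log ‖mfderiv (𝓡 2) (𝓡 2) f^[n] x‖) atTop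

/-- The upper Lyapunov exponent of an invariant measure. -/
def measureExponent [MeasurableSpace M] (f : M → M) (μ : Measure M) : ℝ :=
  ∫ x, upperExponent f x ∂μ

/-- `limsup (1/n) log ‖Df^n|_σ(σ(s))‖` (again a bounded sequence). -/
def curveExponent (f : M → M) (σ : RegularCurve M) (s : unitInterval) : ℝ :=
  limsup (fun n : ℕ ↦ (1 / (n : ℝ)) * Real.log (lineNorm f^[n] (σ.lift s))) atTop

/-- The essential supremum, for Lebesgue measure on `[0,1]`, of the exponent along the curve. -/
def lambdaBar (f : M → M) (σ : RegularCurve M) : ℝ :=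
  essSup (curveExponent f σ) volume

/-- The set `T_n` of parameters with a controlled expansion at time `n`. -/
def goodSet (f : Diffeomorph (𝓡 2) (𝓡 2) M M ∞) (σ : RegularCurve M) (lmin lmax : ℝ) (n : ℕ) :
    Set unitInterval :=
  {s | lmin ≤ (1 / (n : ℝ)) * Real.log (lineNorm f^[n] (σ.lift s)) ∧
    (1 / (n : ℝ)) * Real.log (lineNorm f^[n] (σ.lift s)) ≤ lmax ∧
    σ.toFun s ∉ Function.periodicPts f ∧
    ∀ i ≤ n, 1 ≤ lineNorm f^[i] ((lift f)^[n - i] (σ.lift s))}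

/-! ### Empirical measures and their neutral parts -/

/-- The point mass at `ξ`. -/
def pointMass (ξ : ProjTangent M) : FiniteMeasure (ProjTangent M) :=
  ⟨Measure.dirac ξ, inferInstance⟩

/-- The weak-star topology on the finite Borel measures of the projective tangent bundle. -/
abbrev weakStar (M : Type*) [TopologicalSpace M] [ChartedSpace Plane M] [IsManifold (𝓡 2) ∞ M] :
    TopologicalSpace (FiniteMeasure (ProjTangent M)) := inferInstance

/-- The empirical measure of the orbit segment of length `n` at `ξ`. -/
def empirical (f : Diffeomorph (𝓡 2) (𝓡 2) M M ∞) (n : ℕ) (ξ : ProjTangent M) :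
    FiniteMeasure (ProjTangent M) :=
  (n : ℝ≥0)⁻¹ • ∑ i ∈ Finset.range n, pointMass ((lift f)^[i] ξ)

/-- The orbit segment `(ζ, …, f̂^{ℓ-1} ζ)` is `α`-neutral. -/
def IsNeutral (f : Diffeomorph (𝓡 2) (𝓡 2) M M ∞) (α : ℝ) (ℓ : ℕ) (ζ : ProjTangent M) : Prop :=
  ∀ i, 0 < i → i ≤ ℓ → birkhoffSum (lift f) (phi f) i ζ ≤ α * i

/-- The union of the `(α, L)`-neutral sub-segments of `(ξ, …, f̂^{n-1} ξ)`. -/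
def neutralSet (f : Diffeomorph (𝓡 2) (𝓡 2) M M ∞) (α : ℝ) (L n : ℕ) (ξ : ProjTangent M) :
    Set (ProjTangent M) :=
  {ζ | ∃ a ℓ : ℕ, L ≤ ℓ ∧ a + ℓ ≤ n ∧ IsNeutral f α ℓ ((lift f)^[a] ξ) ∧
    ∃ j < ℓ, ζ = (lift f)^[a + j] ξ}

open Classical in
/-- The neutral part of the empirical measure. -/
def neutralPart (f : Diffeomorph (𝓡 2) (𝓡 2) M M ∞) (α : ℝ) (L n : ℕ) (ξ : ProjTangent M) :
    FiniteMeasure (ProjTangent M) :=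
  (n : ℝ≥0)⁻¹ • ∑ i ∈ Finset.range n with (lift f)^[i] ξ ∈ neutralSet f α L n ξ,
    pointMass ((lift f)^[i] ξ)

open Classical in
/-- The difference of the empirical measure and of its neutral part. -/
def nonNeutralPart (f : Diffeomorph (𝓡 2) (𝓡 2) M M ∞) (α : ℝ) (L n : ℕ) (ξ : ProjTangent M) :
    FiniteMeasure (ProjTangent M) :=
  (n : ℝ≥0)⁻¹ • ∑ i ∈ Finset.range n with (lift f)^[i] ξ ∉ neutralSet f α L n ξ,
    pointMass ((lift f)^[i] ξ)

theorem neutralPart_add_nonNeutralPart (f : Diffeomorph (𝓡 2) (𝓡 2) M M ∞) (α : ℝ) (L n : ℕ)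
    (ξ : ProjTangent M) :
    neutralPart f α L n ξ + nonNeutralPart f α L n ξ = empirical f n ξ := by
  classical
  rw [neutralPart, nonNeutralPart, empirical, ← smul_add]
  congr 1
  exact Finset.sum_filter_add_sum_filter_not _ _ _

/-- Neutral decomposition of the limit of the empirical measures of length `n k` at `ξ k`,
with weight `β ∈ [0,1]` and invariant probability measures `μ₀`, `μ₁`. -/
structure IsNeutralDecomposition (f : Diffeomorph (𝓡 2) (𝓡 2) M M ∞) (n : ℕ → ℕ)
    (ξ : ℕ → ProjTangent M) (β : ℝ≥0) (μ₀ μ₁ : ProbabilityMeasure (ProjTangent M)) : Prop where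
  le_one : β ≤ 1
  invariant₀ : MeasurePreserving (lift f) (μ₀ : Measure (ProjTangent M)) μ₀
  invariant₁ : MeasurePreserving (lift f) (μ₁ : Measure (ProjTangent M)) μ₁
  tendsto : Tendsto (fun k ↦ empirical f (n k) (ξ k)) atTop
    (𝓝 ((1 - β) • μ₀.toFiniteMeasure + β • μ₁.toFiniteMeasure))
  neutral : ∀ V₀ ∈ 𝓝 ((1 - β) • μ₀.toFiniteMeasure), ∀ V₁ ∈ 𝓝 (β • μ₁.toFiniteMeasure),
    ∃ α₀ > (0 : ℝ), ∃ L₀ : ℕ, ∀ α, 0 < α → α ≤ α₀ → ∀ L ≥ L₀, ∀ᶠ k in atTop,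
      neutralPart f α L (n k) (ξ k) ∈ V₀ ∧ nonNeutralPart f α L (n k) (ξ k) ∈ V₁
  integral_eq_zero : (1 - (β : ℝ)) * ∫ ζ, phi f ζ ∂(μ₀ : Measure (ProjTangent M)) = 0
  pos : ∀ᵐ ζ ∂(β • (μ₁ : Measure (ProjTangent M))), ∃ l > (0 : ℝ),
    Tendsto (fun m : ℕ ↦ (1 / (m : ℝ)) * birkhoffSum (lift f) (phi f) m ζ) atTop (𝓝 l)

/-! ### The sequences of parameters and of sets of parameters -/

/-- `lmin` and `lmax` are bounds converging to `lbar` from both sides, and `ρ_k → 1`. -/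
structure IsRateSequence (lbar : ℝ) (lmin lmax ρ : ℕ → ℝ) : Prop where
  lmin_pos : ∀ k, 0 < lmin k
  lmin_lt : ∀ k, lmin k < lbar
  lt_lmax : ∀ k, lbar < lmax k
  ρ_pos : ∀ k, 0 < ρ k
  ρ_lt : ∀ k, ρ k < 1
  tendsto_lmin : Tendsto lmin atTop (𝓝 lbar)
  tendsto_lmax : Tendsto lmax atTop (𝓝 lbar)
  tendsto_ρ : Tendsto ρ atTop (𝓝 1)

/-- `n k → ∞` are times for which the sets `T_{n_k}` are large, and `T' k ⊆ T_{n_k}` are subsets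
that are still large and on which the empirical measures and their neutral parts are almost
constant, in the distance `d` on measures. -/
structure IsSelection (f : Diffeomorph (𝓡 2) (𝓡 2) M M ∞) (σ : RegularCurve M)
    (d : MetricSpace (FiniteMeasure (ProjTangent M))) (lmin lmax ρ : ℕ → ℝ) (n : ℕ → ℕ)
    (α : ℕ → ℝ) (L : ℕ → ℕ) (δ : ℕ → ℝ) (T' : ℕ → Set unitInterval) : Prop where
  tendsto_n : Tendsto n atTop atTop
  large : ∀ k, ρ k ^ n k < (volume : Measure unitInterval).real
    (goodSet f σ (lmin k) (lmax k) (n k))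
  α_pos : ∀ k, 0 < α k
  tendsto_α : Tendsto α atTop (𝓝 0)
  one_le_L : ∀ k, 1 ≤ L k
  tendsto_L : Tendsto L atTop atTop
  tendsto_δ : Tendsto δ atTop (𝓝 0)
  subset : ∀ k, T' k ⊆ goodSet f σ (lmin k) (lmax k) (n k)
  large' : ∀ k, ρ k ^ (2 * n k) < (volume : Measure unitInterval).real (T' k)
  dist_empirical : ∀ k, ∀ ξ ∈ σ.lift '' T' k, ∀ ξ' ∈ σ.lift '' T' k,
    d.dist (empirical f (n k) ξ) (empirical f (n k) ξ') < δ k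
  dist_neutral : ∀ k, ∀ ξ ∈ σ.lift '' T' k, ∀ ξ' ∈ σ.lift '' T' k, ∀ j ≤ k,
    d.dist (neutralPart f (α j) (L j) (n k) ξ) (neutralPart f (α j) (L j) (n k) ξ') < δ k

end Metric

end

end SurfaceDynamics

end

set_option linter.unusedSectionVars false

noncomputable section

namespace SurfaceDynamics

/-! ### Topology of the projective tangent bundle -/

section ProjTangentTopology

variable {M : Type*} [TopologicalSpace M] [ChartedSpace Plane M] [IsManifold (𝓡 2) ∞ M]

/-! Write S_n for the Birkhoff sums of φ. The conditions ‖Df^i|_{E_{n-i}}‖ ≥ 1 in the definition of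
T_n say that n is a record time: S_j ≤ S_n for all j ≤ n (`mem_goodSet_iff`).

Selections exist by Borel–Cantelli. A point of the curve with exponent in (λmin, λ̄] has infinitely
many record times with average in [λmin, λmax] (`frequently_record`), and only countably many
periodic points of the curve have positive exponent. If |T_n| ≤ ρ^n for all large n, almost every
such point would lie in finitely many T_n, against the definition of λ̄
(`frequently_measure_goodSet_gt`). Measures of mass at most one form a weak-* compact set, so a
finite net and the pigeonhole principle yield T'_n, at the price of a bounded number of pieces.

Neutral decompositions come from compactness: first n_k → ∞ for countably many thresholds (α, L),
then the thresholds are refined; monotonicity in (α, L) makes the limit independent of the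
refinement. Connected components of the set of neutral times have length at least L, so the neutral
part is invariant up to O(1/L). Along a component the sum of φ is at most α times its length. It is
at least -C, since otherwise the component could be prolonged by one step, or since n is a record if
the component ends at n. So the neutral limit has zero integral of φ. A point with nonpositive
exponent is, almost surely, in the forward orbit of a point that starts arbitrarily long neutral
segments, hence is not charged by the non-neutral part
(`measure_image_forall_birkhoffSum_le_eq_zero`).

Passing to the limit in λmin ≤ S_n/n ≤ λmax gives β ∫ φ dμ̂₁ = λ̄, so β ≠ 0. It remains to see that
repelling orbits have zero mass and that ∫ φ dμ̂₁ = λ⁺(μ₁).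

If μ₁ charged a repelling point p, all points of T'_{n_k} would spend a fixed proportion of time
near p, hence visit a neighborhood of p at a time of order n_k. Pulling back by the contracting
inverse, and using that a regular curve meets a ball of radius ε in a parameter set of measure O(ε),
such parameters form a set of exponentially small measure (`exists_nhds_volume_visit_le`). This
contradicts |T'_{n_k}| > ρ_k^{2n_k} with ρ_k → 1.

For μ̂₁-almost every (x, E) let λ > 0 be the limit of S_n/n and D the limit of the averaged
logarithmic Jacobian. In a frame adapted to the orbit of E the derivative is triangular, so the
upper exponent is at most max(λ, D - λ) (`norm_mfderiv_iterate_le`). If D - λ > λ on a set of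
positive measure, both exponents are positive there. A measure expanding in all directions has an
atom on a repelling periodic orbit (`exists_isRepellingPeriodic_of_integral_logConorm_pos`), which
was just excluded. So the upper exponent equals λ, and Birkhoff's theorem gives the integral. -/

theorem ProjTangent.isQuotientMap_span : IsQuotientMap (ProjTangent.span (M := M)) := by
  refine ⟨⟨rfl⟩, ?_⟩
  rintro ⟨x, l⟩
  induction l using Projectivization.ind with
  | h v hv => exact ⟨⟨⟨x, v⟩, hv⟩, rfl⟩

theorem ProjTangent.continuous_span : Continuous (ProjTangent.span (M := M)) :=
  ProjTangent.isQuotientMap_span.continuous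

theorem ProjTangent.span_eq_iff {x : M} {v w : TangentSpace (𝓡 2) x} (hv : v ≠ 0) (hw : w ≠ 0) :
    ProjTangent.span ⟨⟨x, v⟩, hv⟩ = ProjTangent.span ⟨⟨x, w⟩, hw⟩ ↔ ∃ a : ℝ, a • w = v := by
  simp [ProjTangent.span, Projectivization.mk_eq_mk_iff']

theorem ProjTangent.continuous_pt : Continuous (ProjTangent.pt (M := M)) := by
  rw [ProjTangent.isQuotientMap_span.continuous_iff]
  exact (FiberBundle.continuous_proj Plane (TangentSpace (𝓡 2) (M := M))).comp continuous_subtype_val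

theorem ProjTangent.measurable_pt [MeasurableSpace M] [BorelSpace M] :
    Measurable (ProjTangent.pt (M := M)) :=
  ProjTangent.continuous_pt.measurable

theorem isOpen_ne_zero : IsOpen {v : TangentBundle (𝓡 2) M | v.2 ≠ 0} := by
  rw [isOpen_iff_mem_nhds]
  rintro ⟨x, v⟩ hv
  let e := trivializationAt Plane (TangentSpace (𝓡 2) (M := M)) x
  have hx : x ∈ e.baseSet := FiberBundle.mem_baseSet_trivializationAt' x
  have h2 : ContinuousAt (fun w : TangentBundle (𝓡 2) M ↦ (e w).2) ⟨x, v⟩ :=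
    continuous_snd.continuousAt.comp
      (e.continuousOn.continuousAt (e.open_source.mem_nhds (by simpa [e.mem_source] using hx)))
  have hne : (e ⟨x, v⟩).2 ≠ 0 := by
    have : e.continuousLinearEquivAt ℝ x hx v ≠ 0 :=
      (e.continuousLinearEquivAt ℝ x hx).map_ne_zero_iff.2 hv
    rwa [Bundle.Trivialization.continuousLinearEquivAt_apply] at this
  have hs : e.source ∈ 𝓝 (⟨x, v⟩ : TangentBundle (𝓡 2) M) :=
    e.open_source.mem_nhds (by simpa [e.mem_source] using hx)
  filter_upwards [h2.eventually_ne hne, hs] with w hw hws h0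
  apply hw
  obtain ⟨y, w⟩ := w
  have hy : y ∈ e.baseSet := by simpa [e.mem_source] using hws
  change w = 0 at h0
  subst h0
  have := (e.continuousLinearEquivAt ℝ y hy).map_zero
  rwa [Bundle.Trivialization.continuousLinearEquivAt_apply] at this

/-- An open set of lines corresponds to an open set of nonzero vectors, and bundle projections are
open. This gives half of the continuity of the operator norm in `continuous_norm_mfderiv`. -/
theorem ProjTangent.isOpenMap_pt : IsOpenMap (ProjTangent.pt (M := M)) := by
  intro O hO
  have h1 : ProjTangent.pt '' O =
      TotalSpace.proj '' (Subtype.val '' (ProjTangent.span (M := M) ⁻¹' O)) := by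
    rw [Set.image_image]
    conv_lhs => rw [← Set.image_preimage_eq O ProjTangent.isQuotientMap_span.surjective,
      Set.image_image]
    rfl
  rw [h1]
  exact FiberBundle.isOpenMap_proj Plane (TangentSpace (𝓡 2) (M := M)) _
    (isOpen_ne_zero.isOpenMap_subtype_val _ (hO.preimage ProjTangent.continuous_span))

/-- The lines spanned by the vectors of norm one of a trivialization. -/
theorem ProjTangent.exists_continuousOn_section (x : M) :
    ∃ g : M × Metric.sphere (0 : Plane) 1 → ProjTangent M,
      ContinuousOn g ((trivializationAt Plane (TangentSpace (𝓡 2) (M := M)) x).baseSet ×ˢ Set.univ) ∧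
      ∀ ξ : ProjTangent M, ξ.pt ∈ (trivializationAt Plane (TangentSpace (𝓡 2) (M := M)) x).baseSet →
        ∃ u, g (ξ.pt, u) = ξ := by
  classical
  let e := trivializationAt Plane (TangentSpace (𝓡 2) (M := M)) x
  have hne : ∀ y (u : Metric.sphere (0 : Plane) 1), y ∈ e.baseSet → e.symm y u ≠ 0 := by
    intro y u hy h0
    have h1 : (u : Plane) ≠ 0 := ne_zero_of_mem_unit_sphere u
    apply h1
    have := (e.continuousLinearEquivAt ℝ y hy).symm.map_eq_zero_iff (x := (u : Plane))
    rw [Bundle.Trivialization.continuousLinearEquivAt_symm_apply] at this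
    exact this.1 h0
  obtain ⟨u₀⟩ : Nonempty (Metric.sphere (0 : Plane) 1) := by
    exact (NormedSpace.sphere_nonempty.2 zero_le_one).to_subtype
  have hxb : x ∈ e.baseSet := FiberBundle.mem_baseSet_trivializationAt' x
  let G : M × Metric.sphere (0 : Plane) 1 → {v : TangentBundle (𝓡 2) M // v.2 ≠ 0} := fun z ↦
    if h : z.1 ∈ e.baseSet then ⟨⟨z.1, e.symm z.1 z.2⟩, hne z.1 z.2 h⟩
    else ⟨⟨x, e.symm x u₀⟩, hne x u₀ hxb⟩
  refine ⟨fun z ↦ ProjTangent.span (G z), ?_, ?_⟩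
  · apply ProjTangent.continuous_span.comp_continuousOn
    refine (Topology.IsInducing.subtypeVal
      (t := {v : TangentBundle (𝓡 2) M | v.2 ≠ 0})).continuousOn_iff.2 ?_
    have h1 : ContinuousOn (fun z : M × Metric.sphere (0 : Plane) 1 ↦
        (⟨z.1, e.symm z.1 z.2⟩ : TangentBundle (𝓡 2) M)) (e.baseSet ×ˢ Set.univ) := by
      have := e.continuousOn_symm
      exact this.comp (f := fun z : M × Metric.sphere (0 : Plane) 1 ↦ (z.1, (z.2 : Plane)))
        (by fun_prop) (fun z hz ↦ ⟨hz.1, trivial⟩)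
    refine h1.congr fun z hz ↦ ?_
    simp [G, hz.1]
  · intro ξ hξ
    obtain ⟨⟨⟨y, v⟩, hv⟩, rfl⟩ := ProjTangent.isQuotientMap_span.surjective ξ
    change y ∈ e.baseSet at hξ
    let E := e.continuousLinearEquivAt ℝ y hξ
    have hEv : E v ≠ 0 := E.map_ne_zero_iff.2 hv
    refine ⟨⟨‖E v‖⁻¹ • E v, by simp [norm_smul, hEv]⟩, ?_⟩
    have h2 : e.symm y (‖E v‖⁻¹ • E v) = ‖E v‖⁻¹ • v := by
      have h3 : E.symm (‖E v‖⁻¹ • E v) = ‖E v‖⁻¹ • v := by simp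
      rw [← h3]
      exact (congrFun (e.continuousLinearEquivAt_symm_apply ℝ y hξ) _).symm
    change ProjTangent.span (G (y, _)) = _
    simp only [G, hξ, dite_true]
    exact (ProjTangent.span_eq_iff _ _).2 ⟨‖E v‖⁻¹, h2.symm⟩

instance ProjTangent.compactSpace [T2Space M] [CompactSpace M] : CompactSpace (ProjTangent M) := by
  choose g hg hg' using ProjTangent.exists_continuousOn_section (M := M)
  have hK : ∀ x : M, ∃ K ∈ 𝓝 x, IsCompact K ∧
      K ⊆ (trivializationAt Plane (TangentSpace (𝓡 2) (M := M)) x).baseSet := by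
    intro x
    obtain ⟨K, h1, h2, h3⟩ := local_compact_nhds
      ((trivializationAt Plane (TangentSpace (𝓡 2) (M := M)) x).open_baseSet.mem_nhds
        (FiberBundle.mem_baseSet_trivializationAt' x))
    exact ⟨K, h1, h3, h2⟩
  choose K hKn hKc hKs using hK
  obtain ⟨t, -, ht⟩ := isCompact_univ.elim_nhds_subcover K (fun x _ ↦ hKn x)
  have h1 : (Set.univ : Set (ProjTangent M)) = ⋃ x ∈ t, g x '' (K x ×ˢ Set.univ) := by
    symm
    rw [Set.eq_univ_iff_forall]
    intro ξ
    obtain ⟨x, hx, hxK⟩ := Set.mem_iUnion₂.1 (ht (Set.mem_univ ξ.pt))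
    obtain ⟨u, hu⟩ := hg' x ξ (hKs x hxK)
    exact Set.mem_iUnion₂.2 ⟨x, hx, _, ⟨hxK, trivial⟩, hu⟩
  refine ⟨?_⟩
  rw [h1]
  exact t.isCompact_biUnion fun x _ ↦ ((hKc x).prod isCompact_univ).image_of_continuousOn
    ((hg x).mono (Set.prod_mono (hKs x) subset_rfl))

/-- Lines over distinct points are separated in the base. Two lines in one fiber, spanned by a and b
in a trivialization, are separated by the sign of z ↦ ⟨a, z⟩² - c‖a‖²‖z‖², where c lies strictly
between the squared cosine of their angle and 1. -/
instance ProjTangent.t2Space [T2Space M] : T2Space (ProjTangent M) := by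
  refine ⟨fun ξ η hne ↦ ?_⟩
  obtain ⟨⟨⟨x, v⟩, hv⟩, rfl⟩ := ProjTangent.isQuotientMap_span.surjective ξ
  obtain ⟨⟨⟨y, w⟩, hw⟩, rfl⟩ := ProjTangent.isQuotientMap_span.surjective η
  by_cases hxy : x = y
  swap
  · obtain ⟨U, V, hU, hV, h1, h2, h3⟩ := t2_separation hxy
    exact ⟨_, _, hU.preimage ProjTangent.continuous_pt, hV.preimage ProjTangent.continuous_pt,
      h1, h2, h3.preimage _⟩
  subst hxy
  let e := trivializationAt Plane (TangentSpace (𝓡 2) (M := M)) x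
  have hx : x ∈ e.baseSet := FiberBundle.mem_baseSet_trivializationAt' x
  let E := e.continuousLinearEquivAt ℝ x hx
  set a := E v with ha
  have ha0 : a ≠ 0 := E.map_ne_zero_iff.2 hv
  have hindep : ∀ z : Plane, inner ℝ a z ^ 2 = ‖a‖ ^ 2 * ‖z‖ ^ 2 → ∃ c : ℝ, c • a = z := by
    intro z hz
    by_cases hz0 : z = 0
    · exact ⟨0, by simp [hz0]⟩
    have h2 : ‖inner ℝ a z‖ = ‖a‖ * ‖z‖ := by
      rw [Real.norm_eq_abs, ← abs_of_nonneg (by positivity : 0 ≤ ‖a‖ * ‖z‖), ← sq_eq_sq_iff_abs_eq_abs,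
        hz, mul_pow]
    have h3 : a = 0 ∨ ∃ r : ℝ, z = r • a := ((norm_inner_eq_norm_tfae ℝ a z).out 0 2).1 h2
    obtain ⟨c, hc⟩ := h3.resolve_left ha0
    exact ⟨c, hc.symm⟩
  set b := E w with hb
  have hb0 : b ≠ 0 := E.map_ne_zero_iff.2 hw
  have hlt : inner ℝ a b ^ 2 / (‖a‖ ^ 2 * ‖b‖ ^ 2) < 1 := by
    have hpos : 0 < ‖a‖ ^ 2 * ‖b‖ ^ 2 := by positivity
    rw [div_lt_one hpos]
    refine lt_of_le_of_ne ?_ ?_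
    · have := abs_real_inner_le_norm a b
      rw [← mul_pow, sq_le_sq]
      simpa [abs_mul] using this
    · intro h
      obtain ⟨c, hc⟩ := hindep b h
      apply hne
      symm
      rw [ProjTangent.span_eq_iff]
      refine ⟨c, E.injective ?_⟩
      rw [map_smul, ← ha, ← hb, hc]
  obtain ⟨c, hc1, hc2⟩ := exists_between hlt
  have hc2' := hc2
  let q : TangentBundle (𝓡 2) M → ℝ := fun z ↦
    inner ℝ a (e z).2 ^ 2 - c * (‖a‖ ^ 2 * ‖(e z).2‖ ^ 2)
  have hq : ContinuousOn q e.source := by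
    have : ContinuousOn (fun z ↦ (e z).2) e.source := continuous_snd.comp_continuousOn e.continuousOn
    fun_prop
  have hqE : ∀ (y : M) (hy : y ∈ e.baseSet) (u : TangentSpace (𝓡 2) y),
      q ⟨y, u⟩ = inner ℝ a (e.continuousLinearEquivAt ℝ y hy u) ^ 2 -
        c * (‖a‖ ^ 2 * ‖e.continuousLinearEquivAt ℝ y hy u‖ ^ 2) := by
    intro y hy u
    rw [Bundle.Trivialization.continuousLinearEquivAt_apply]
  have hqs : ∀ (y : M) (hy : y ∈ e.baseSet) (u : TangentSpace (𝓡 2) y) (r : ℝ),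
      q ⟨y, r • u⟩ = r ^ 2 * q ⟨y, u⟩ := by
    intro y hy u r
    rw [hqE y hy, hqE y hy, map_smul, inner_smul_right, norm_smul, Real.norm_eq_abs]
    rw [show (|r| * ‖(e.continuousLinearEquivAt ℝ y hy) u‖) ^ 2 =
      r ^ 2 * ‖(e.continuousLinearEquivAt ℝ y hy) u‖ ^ 2 by rw [mul_pow, sq_abs]]
    ring
  -- The form `q` is homogeneous of degree two, so a condition `q ∈ S` with `S` a cone depends only
  -- on the line and defines an open set in the quotient.
  have hopen : ∀ S : Set ℝ, IsOpen S → (∀ r : ℝ, 0 < r → ∀ t ∈ S, r * t ∈ S) →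
      ∃ W : Set (ProjTangent M), IsOpen W ∧ ∀ (y : M) (u : TangentSpace (𝓡 2) y) (hu : u ≠ 0),
        ProjTangent.span ⟨⟨y, u⟩, hu⟩ ∈ W ↔ y ∈ e.baseSet ∧ q ⟨y, u⟩ ∈ S := by
    intro S hS hSc
    let V : Set {v : TangentBundle (𝓡 2) M // v.2 ≠ 0} := {z | z.1 ∈ e.source ∩ q ⁻¹' S}
    have hVo : IsOpen V := (hq.isOpen_inter_preimage e.open_source hS).preimage continuous_subtype_val
    have hmem : ∀ (y : M) (u : TangentSpace (𝓡 2) y) (hu : u ≠ 0),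
        ProjTangent.span ⟨⟨y, u⟩, hu⟩ ∈ ProjTangent.span '' V ↔ y ∈ e.baseSet ∧ q ⟨y, u⟩ ∈ S := by
      intro y u hu
      constructor
      · rintro ⟨⟨⟨y', u'⟩, hu'⟩, hz, heq⟩
        have : y' = y := congrArg ProjTangent.pt heq
        subst this
        have hy : y' ∈ e.baseSet := by simpa [e.mem_source] using hz.1
        obtain ⟨r, hr⟩ := (ProjTangent.span_eq_iff _ _).1 heq
        have hr0 : r ≠ 0 := by
          rintro rfl
          rw [zero_smul] at hr
          exact hu' hr.symm
        refine ⟨hy, ?_⟩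
        have h1 : q ⟨y', u'⟩ ∈ S := hz.2
        rw [← hr, hqs y' hy] at h1
        have := hSc (r ^ 2)⁻¹ (by positivity) _ h1
        rwa [inv_mul_cancel_left₀ (by positivity)] at this
      · rintro ⟨hy, hS'⟩
        exact ⟨⟨⟨y, u⟩, hu⟩, ⟨by simpa [e.mem_source] using hy, hS'⟩, rfl⟩
    refine ⟨ProjTangent.span '' V, ?_, hmem⟩
    rw [← ProjTangent.isQuotientMap_span.isOpen_preimage]
    convert hVo using 1
    ext ⟨⟨y, u⟩, hu⟩
    rw [Set.mem_preimage, hmem]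
    simp [V, e.mem_source]
  obtain ⟨W₁, hW₁, hm₁⟩ := hopen (Set.Ioi 0) isOpen_Ioi (fun r hr t ht ↦ mul_pos hr ht)
  obtain ⟨W₂, hW₂, hm₂⟩ := hopen (Set.Iio 0) isOpen_Iio (fun r hr t ht ↦ mul_neg_of_pos_of_neg hr ht)
  refine ⟨W₁, W₂, hW₁, hW₂, (hm₁ x v hv).2 ⟨hx, ?_⟩, (hm₂ x w hw).2 ⟨hx, ?_⟩, ?_⟩
  · change 0 < q _
    rw [hqE x hx, ← show a = e.continuousLinearEquivAt ℝ x hx v from rfl, real_inner_self_eq_norm_sq]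
    have : 0 < ‖a‖ := norm_pos_iff.2 ha0
    nlinarith [pow_pos this 4]
  · change q _ < 0
    rw [hqE x hx, ← show b = e.continuousLinearEquivAt ℝ x hx w from rfl]
    have hpos : 0 < ‖a‖ ^ 2 * ‖b‖ ^ 2 := by positivity
    rw [div_lt_iff₀ hpos] at hc1
    linarith
  · rw [Set.disjoint_left]
    intro ζ h1 h2
    obtain ⟨⟨⟨y, u⟩, hu⟩, rfl⟩ := ProjTangent.isQuotientMap_span.surjective ζ
    have h3 : 0 < q ⟨y, u⟩ := ((hm₁ y u hu).1 h1).2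
    have h4 : q ⟨y, u⟩ < 0 := ((hm₂ y u hu).1 h2).2
    exact lt_asymm h3 h4

/-- Points embed into finite measures as Dirac masses, so the bundle inherits metrizability from the
given metric on measures. -/
theorem ProjTangent.metrizableSpace [T2Space M] [CompactSpace M]
    (d : MetricSpace (FiniteMeasure (ProjTangent M)))
    (hd : d.toPseudoMetricSpace.toUniformSpace.toTopologicalSpace = weakStar M) :
    TopologicalSpace.MetrizableSpace (ProjTangent M) := by
  have h1 : TopologicalSpace.MetrizableSpace (FiniteMeasure (ProjTangent M)) := by
    have h := @EMetricSpace.metrizableSpace _ d.toEMetricSpace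
    rwa [hd] at h
  exact ((ProbabilityMeasure.toFiniteMeasure_isEmbedding _).comp
    (isEmbedding_diracProba (X := ProjTangent M))).metrizableSpace

end ProjTangentTopology

/-! ### The projective lift and the expansion of lines -/

section LiftDynamics

variable {M : Type*} [TopologicalSpace M] [ChartedSpace Plane M] [IsManifold (𝓡 2) ∞ M]

theorem mdifferentiable_iterate (f : Diffeomorph (𝓡 2) (𝓡 2) M M ∞) (n : ℕ) :
    MDifferentiable (𝓡 2) (𝓡 2) f^[n] := by
  induction n with
  | zero => exact mdifferentiable_id
  | succ n ih =>
    rw [Function.iterate_succ']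
    exact (f.contMDiff.mdifferentiable (by simp)).comp ih

theorem contMDiff_iterate (f : Diffeomorph (𝓡 2) (𝓡 2) M M ∞) (n : ℕ) :
    ContMDiff (𝓡 2) (𝓡 2) ∞ f^[n] := by
  induction n with
  | zero => exact contMDiff_id
  | succ n ih =>
    rw [Function.iterate_succ']
    exact f.contMDiff.comp ih

theorem mfderiv_ne_zero (f : Diffeomorph (𝓡 2) (𝓡 2) M M ∞) {x : M} {v : TangentSpace (𝓡 2) x}
    (hv : v ≠ 0) : mfderiv (𝓡 2) (𝓡 2) f x v ≠ 0 := by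
  intro h
  apply hv
  apply mfderiv_injective f x
  simpa using h

theorem lift_span (f : Diffeomorph (𝓡 2) (𝓡 2) M M ∞) (x : M) (v : TangentSpace (𝓡 2) x)
    (hv : v ≠ 0) : lift f (ProjTangent.span ⟨⟨x, v⟩, hv⟩) =
      ProjTangent.span ⟨⟨f x, mfderiv (𝓡 2) (𝓡 2) f x v⟩, mfderiv_ne_zero f hv⟩ := by
  rfl

theorem tangentMap_iterate_succ (f : Diffeomorph (𝓡 2) (𝓡 2) M M ∞) (n : ℕ)
    (z : TangentBundle (𝓡 2) M) :
    tangentMap (𝓡 2) (𝓡 2) f^[n + 1] z =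
      tangentMap (𝓡 2) (𝓡 2) f (tangentMap (𝓡 2) (𝓡 2) f^[n] z) := by
  rw [Function.iterate_succ', tangentMap_comp_at _ (f.contMDiff.mdifferentiable (by simp) _)
    (mdifferentiable_iterate f n _)]

theorem mfderiv_iterate_succ (f : Diffeomorph (𝓡 2) (𝓡 2) M M ∞) (n : ℕ) (x : M)
    (v : TangentSpace (𝓡 2) x) :
    mfderiv (𝓡 2) (𝓡 2) f^[n + 1] x v =
      mfderiv (𝓡 2) (𝓡 2) f (f^[n] x) (mfderiv (𝓡 2) (𝓡 2) f^[n] x v) := by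
  rw [Function.iterate_succ', mfderiv_comp_apply x (f.contMDiff.mdifferentiable (by simp) _)
    (mdifferentiable_iterate f n x)]

theorem mfderiv_iterate_ne_zero (f : Diffeomorph (𝓡 2) (𝓡 2) M M ∞) (n : ℕ) {x : M}
    {v : TangentSpace (𝓡 2) x} (hv : v ≠ 0) : mfderiv (𝓡 2) (𝓡 2) f^[n] x v ≠ 0 := by
  induction n with
  | zero =>
    have : mfderiv (𝓡 2) (𝓡 2) f^[0] x v = v :=
      congrArg (fun A : TangentSpace (𝓡 2) x →L[ℝ] TangentSpace (𝓡 2) x ↦ A v) mfderiv_id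
    exact fun h ↦ hv (this.symm.trans h)
  | succ n ih =>
    rw [mfderiv_iterate_succ]
    exact mfderiv_ne_zero f ih

theorem iterate_lift_span (f : Diffeomorph (𝓡 2) (𝓡 2) M M ∞) (n : ℕ) (x : M)
    (v : TangentSpace (𝓡 2) x) (hv : v ≠ 0) :
    (lift f)^[n] (ProjTangent.span ⟨⟨x, v⟩, hv⟩) =
      ProjTangent.span ⟨⟨f^[n] x, mfderiv (𝓡 2) (𝓡 2) f^[n] x v⟩,
        mfderiv_iterate_ne_zero f n hv⟩ := by
  induction n with
  | zero =>
    simp only [Function.iterate_zero, id]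
    congr 3
    exact (congrArg (fun A : TangentSpace (𝓡 2) x →L[ℝ] TangentSpace (𝓡 2) x ↦ A v)
      mfderiv_id).symm
  | succ n ih =>
    rw [Function.iterate_succ_apply', ih, lift_span]
    exact congrArg ProjTangent.span (Subtype.ext (tangentMap_iterate_succ f n ⟨x, v⟩).symm)

theorem iterate_lift_pt (f : Diffeomorph (𝓡 2) (𝓡 2) M M ∞) (n : ℕ) (ξ : ProjTangent M) :
    ((lift f)^[n] ξ).pt = f^[n] ξ.pt := by
  obtain ⟨⟨⟨x, v⟩, hv⟩, rfl⟩ := ProjTangent.isQuotientMap_span.surjective ξ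
  rw [iterate_lift_span]
  rfl

theorem continuous_lift (f : Diffeomorph (𝓡 2) (𝓡 2) M M ∞) : Continuous (lift f) := by
  rw [ProjTangent.isQuotientMap_span.continuous_iff]
  have h : lift f ∘ ProjTangent.span = fun z ↦ ProjTangent.span
      ⟨tangentMap (𝓡 2) (𝓡 2) f z.1, mfderiv_ne_zero f z.2⟩ := rfl
  rw [h]
  exact ProjTangent.continuous_span.comp
    (((f.contMDiff.continuous_tangentMap (by simp)).comp continuous_subtype_val).subtype_mk _)

theorem lift_symm_lift (f : Diffeomorph (𝓡 2) (𝓡 2) M M ∞) (ξ : ProjTangent M) :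
    lift f.symm (lift f ξ) = ξ := by
  obtain ⟨⟨⟨x, v⟩, hv⟩, rfl⟩ := ProjTangent.isQuotientMap_span.surjective ξ
  rw [lift_span, lift_span]
  have hx : f.symm (f x) = x := f.symm_apply_apply x
  have h1 : mfderiv (𝓡 2) (𝓡 2) f.symm (f x) (mfderiv (𝓡 2) (𝓡 2) f x v) =
      mfderiv (𝓡 2) (𝓡 2) (f.symm ∘ f) x v := by
    rw [mfderiv_comp_apply x (f.symm.contMDiff.mdifferentiable (by simp) _)
      (f.contMDiff.mdifferentiable (by simp) _)]
  have h2 : (f.symm ∘ f : M → M) = id := by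
    ext y
    exact f.symm_apply_apply y
  have h3 : (⟨f.symm (f x), mfderiv (𝓡 2) (𝓡 2) f.symm (f x) (mfderiv (𝓡 2) (𝓡 2) f x v)⟩ :
      TangentBundle (𝓡 2) M) = ⟨x, v⟩ := by
    have h4 : tangentMap (𝓡 2) (𝓡 2) (f.symm ∘ f) (⟨x, v⟩ : TangentBundle (𝓡 2) M) = ⟨x, v⟩ := by
      rw [h2, tangentMap_id]
      rfl
    rw [h1]
    exact h4
  congr 1
  exact Subtype.ext h3

/-- The projective lift of a diffeomorphism, as a homeomorphism. -/
def liftHomeomorph (f : Diffeomorph (𝓡 2) (𝓡 2) M M ∞) : ProjTangent M ≃ₜ ProjTangent M where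
  toFun := lift f
  invFun := lift f.symm
  left_inv := lift_symm_lift f
  right_inv := lift_symm_lift f.symm
  continuous_toFun := continuous_lift f
  continuous_invFun := continuous_lift f.symm

section Metric

variable [RiemannianBundle (fun x : M ↦ TangentSpace (𝓡 2) x)]

theorem lineNorm_span (g : M → M) (x : M) (v : TangentSpace (𝓡 2) x) (hv : v ≠ 0) :
    lineNorm g (ProjTangent.span ⟨⟨x, v⟩, hv⟩) = ‖mfderiv (𝓡 2) (𝓡 2) g x v‖ / ‖v‖ := by
  have h : ∃ a : ℝ, a • v = (Projectivization.mk ℝ v hv).rep := by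
    rw [← Projectivization.mk_eq_mk_iff' ℝ _ _ (Projectivization.rep_nonzero _) hv,
      Projectivization.mk_rep]
  obtain ⟨a, ha⟩ := h
  have ha0 : a ≠ 0 := by
    rintro rfl
    rw [zero_smul] at ha
    exact Projectivization.rep_nonzero _ ha.symm
  change ‖mfderiv (𝓡 2) (𝓡 2) g x (Projectivization.mk ℝ v hv).rep‖ /
    ‖(Projectivization.mk ℝ v hv).rep‖ = _
  rw [← ha, map_smul, norm_smul, norm_smul, mul_div_mul_left _ _ (by simpa using ha0)]

theorem lineNorm_iterate_pos (f : Diffeomorph (𝓡 2) (𝓡 2) M M ∞) (n : ℕ) (ξ : ProjTangent M) :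
    0 < lineNorm f^[n] ξ := by
  obtain ⟨⟨⟨x, v⟩, hv⟩, rfl⟩ := ProjTangent.isQuotientMap_span.surjective ξ
  rw [lineNorm_span]
  exact div_pos (norm_pos_iff.2 (mfderiv_iterate_ne_zero f n hv)) (norm_pos_iff.2 hv)

theorem norm_mfderiv_iterate_succ (f : Diffeomorph (𝓡 2) (𝓡 2) M M ∞) (n : ℕ) (x : M)
    (v : TangentSpace (𝓡 2) x) :
    ‖mfderiv (𝓡 2) (𝓡 2) f^[n + 1] x v‖ =
      ‖mfderiv (𝓡 2) (𝓡 2) f (f^[n] x) (mfderiv (𝓡 2) (𝓡 2) f^[n] x v)‖ :=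
  congrArg (fun z : TangentBundle (𝓡 2) M ↦ ‖(z.2 : TangentSpace (𝓡 2) z.1)‖)
    (tangentMap_iterate_succ f n ⟨x, v⟩)

theorem lineNorm_iterate_succ (f : Diffeomorph (𝓡 2) (𝓡 2) M M ∞) (n : ℕ) (ξ : ProjTangent M) :
    lineNorm f^[n + 1] ξ = lineNorm f ((lift f)^[n] ξ) * lineNorm f^[n] ξ := by
  obtain ⟨⟨⟨x, v⟩, hv⟩, rfl⟩ := ProjTangent.isQuotientMap_span.surjective ξ
  rw [iterate_lift_span, lineNorm_span, lineNorm_span, lineNorm_span, norm_mfderiv_iterate_succ,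
    div_mul_div_cancel₀ (norm_pos_iff.2 (mfderiv_iterate_ne_zero f n hv)).ne']

theorem log_lineNorm_iterate (f : Diffeomorph (𝓡 2) (𝓡 2) M M ∞) (n : ℕ) (ξ : ProjTangent M) :
    Real.log (lineNorm f^[n] ξ) = birkhoffSum (lift f) (phi f) n ξ := by
  induction n with
  | zero =>
    obtain ⟨⟨⟨x, v⟩, hv⟩, rfl⟩ := ProjTangent.isQuotientMap_span.surjective ξ
    rw [lineNorm_span, birkhoffSum_zero]
    have : mfderiv (𝓡 2) (𝓡 2) f^[0] x v = v :=
      congrArg (fun A : TangentSpace (𝓡 2) x →L[ℝ] TangentSpace (𝓡 2) x ↦ A v) mfderiv_id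
    rw [show ‖mfderiv (𝓡 2) (𝓡 2) f^[0] x v‖ = ‖v‖ from congrArg _ this,
      div_self (norm_pos_iff.2 hv).ne', Real.log_one]
  | succ n ih =>
    have h1 : 0 < lineNorm f ((lift f)^[n] ξ) := lineNorm_iterate_pos f 1 _
    rw [lineNorm_iterate_succ, Real.log_mul h1.ne' (lineNorm_iterate_pos f n ξ).ne', ih,
      birkhoffSum_succ, add_comm]
    rfl

theorem lineNorm_iterate (f : Diffeomorph (𝓡 2) (𝓡 2) M M ∞) (n : ℕ) (ξ : ProjTangent M) :
    lineNorm f^[n] ξ = Real.exp (birkhoffSum (lift f) (phi f) n ξ) := by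
  rw [← log_lineNorm_iterate, Real.exp_log (lineNorm_iterate_pos f n ξ)]

variable [IsContinuousRiemannianBundle Plane (fun x : M ↦ TangentSpace (𝓡 2) x)]

theorem continuous_norm_tangentBundle :
    Continuous (fun v : TangentBundle (𝓡 2) M ↦ ‖(v.2 : TangentSpace (𝓡 2) v.1)‖) := by
  have h : Continuous (fun v : TangentBundle (𝓡 2) M ↦
      (inner ℝ (v.2 : TangentSpace (𝓡 2) v.1) v.2 : ℝ)) := by
    refine Continuous.inner_bundle (F := Plane) (E := fun x : M ↦ TangentSpace (𝓡 2) x)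
      (b := fun v : TangentBundle (𝓡 2) M ↦ v.1) (v := fun v ↦ v.2) (w := fun v ↦ v.2) ?_ ?_
    · exact continuous_id
    · exact continuous_id
  have h2 : (fun v : TangentBundle (𝓡 2) M ↦ ‖(v.2 : TangentSpace (𝓡 2) v.1)‖) =
      fun v ↦ √(inner ℝ (v.2 : TangentSpace (𝓡 2) v.1) v.2) := by
    ext v
    rw [real_inner_self_eq_norm_sq, Real.sqrt_sq (norm_nonneg _)]
  rw [h2]
  exact h.sqrt

theorem continuous_lineNorm {g : M → M} (hg : ContMDiff (𝓡 2) (𝓡 2) ∞ g) :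
    Continuous (lineNorm g : ProjTangent M → ℝ) := by
  rw [ProjTangent.isQuotientMap_span.continuous_iff]
  have h : (lineNorm g : ProjTangent M → ℝ) ∘ ProjTangent.span = fun z ↦
      ‖((tangentMap (𝓡 2) (𝓡 2) g z.1).2 : TangentSpace (𝓡 2) (g z.1.1))‖ /
        ‖(z.1.2 : TangentSpace (𝓡 2) z.1.1)‖ := by
    ext ⟨⟨x, v⟩, hv⟩
    exact lineNorm_span g x v hv
  rw [h]
  refine Continuous.div ?_ (continuous_norm_tangentBundle.comp continuous_subtype_val) ?_
  · exact continuous_norm_tangentBundle.comp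
      ((hg.continuous_tangentMap (by simp)).comp continuous_subtype_val)
  · rintro ⟨⟨x, v⟩, hv⟩
    exact (norm_pos_iff.2 hv).ne'

theorem continuous_phi (f : Diffeomorph (𝓡 2) (𝓡 2) M M ∞) :
    Continuous (phi f : ProjTangent M → ℝ) :=
  (continuous_lineNorm f.contMDiff).log fun ξ ↦ (lineNorm_iterate_pos f 1 ξ).ne'

theorem continuous_birkhoffSum_phi (f : Diffeomorph (𝓡 2) (𝓡 2) M M ∞) (n : ℕ) :
    Continuous (birkhoffSum (lift f) (phi f) n) := by
  change Continuous fun ξ ↦ ∑ i ∈ Finset.range n, phi f ((lift f)^[i] ξ)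
  exact continuous_finsetSum _ fun i _ ↦ (continuous_phi f).comp ((continuous_lift f).iterate i)

theorem exists_abs_phi_le [T2Space M] [CompactSpace M] (f : Diffeomorph (𝓡 2) (𝓡 2) M M ∞) :
    ∃ C > 0, ∀ ξ : ProjTangent M, |phi f ξ| ≤ C := by
  obtain ⟨C, hC⟩ := isCompact_univ.exists_bound_of_continuousOn (continuous_phi f).continuousOn
  exact ⟨max C 1, by positivity, fun ξ ↦ (hC ξ trivial).trans (le_max_left _ _)⟩

end Metric

end LiftDynamics

/-! ### The pointwise ergodic theorem for bounded functions -/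

section Birkhoff

variable {X : Type*} {T : X → X} {g : X → ℝ} {C : ℝ}

theorem abs_birkhoffSum_le (hC : ∀ x, |g x| ≤ C) (n : ℕ) (x : X) :
    |birkhoffSum T g n x| ≤ n * C := by
  calc |birkhoffSum T g n x| ≤ ∑ i ∈ Finset.range n, |g (T^[i] x)| := Finset.abs_sum_le_sum_abs _ _
    _ ≤ ∑ _i ∈ Finset.range n, C := Finset.sum_le_sum fun i _ ↦ hC _
    _ = n * C := by simp

theorem abs_average_le (hC : ∀ x, |g x| ≤ C) (n : ℕ) (x : X) :
    |1 / (n : ℝ) * birkhoffSum T g n x| ≤ C := by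
  rcases Nat.eq_zero_or_pos n with rfl | hn
  · simpa using (abs_nonneg _).trans (hC x)
  · have hn' : (0 : ℝ) < n := by exact_mod_cast hn
    rw [abs_mul, abs_of_pos (by positivity : 0 < 1 / (n : ℝ)), one_div, inv_mul_le_iff₀ hn']
    exact abs_birkhoffSum_le hC n x

theorem isBoundedUnder_le_average (hC : ∀ x, |g x| ≤ C) (x : X) :
    IsBoundedUnder (· ≤ ·) atTop fun n : ℕ ↦ 1 / (n : ℝ) * birkhoffSum T g n x :=
  isBoundedUnder_of ⟨C, fun n ↦ (abs_le.1 (abs_average_le hC n x)).2⟩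

theorem isBoundedUnder_ge_average (hC : ∀ x, |g x| ≤ C) (x : X) :
    IsBoundedUnder (· ≥ ·) atTop fun n : ℕ ↦ 1 / (n : ℝ) * birkhoffSum T g n x :=
  isBoundedUnder_of ⟨-C, fun n ↦ (abs_le.1 (abs_average_le hC n x)).1⟩

theorem limsup_le_limsup_of_tendsto_sub {u v : ℕ → ℝ} (hu : ∀ n, |u n| ≤ C) (hv : ∀ n, |v n| ≤ C)
    (h : Tendsto (fun n ↦ v n - u n) atTop (𝓝 0)) : limsup v atTop ≤ limsup u atTop := by
  refine le_of_forall_pos_le_add fun ε hε ↦ ?_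
  refine limsup_le_of_le
    (isBoundedUnder_of ⟨-C, fun n ↦ (abs_le.1 (hv n)).1⟩ : IsBoundedUnder (· ≥ ·) _ _).isCoboundedUnder_flip ?_
  have h1 : ∀ᶠ n in atTop, u n < limsup u atTop + ε / 2 :=
    eventually_lt_of_limsup_lt (by linarith) (isBoundedUnder_of ⟨C, fun n ↦ (abs_le.1 (hu n)).2⟩)
  have h2 := h.eventually (gt_mem_nhds (by linarith : (0 : ℝ) < ε / 2))
  filter_upwards [h1, h2] with n h1 h2
  linarith

theorem tendsto_average_comp_sub (hC : ∀ x, |g x| ≤ C) (x : X) :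
    Tendsto (fun n : ℕ ↦ 1 / (n : ℝ) * birkhoffSum T g n (T x) - 1 / (n : ℝ) * birkhoffSum T g n x)
      atTop (𝓝 0) := by
  have h : Tendsto (fun n : ℕ ↦ 2 * C / (n : ℝ)) atTop (𝓝 0) :=
    tendsto_const_div_atTop_nhds_zero_nat _
  refine squeeze_zero_norm (fun n ↦ ?_) h
  rw [← mul_sub, birkhoffSum_apply_sub_birkhoffSum, Real.norm_eq_abs, abs_mul,
    abs_of_nonneg (by positivity : 0 ≤ 1 / (n : ℝ)), one_div, div_eq_inv_mul]
  refine mul_le_mul_of_nonneg_left ?_ (by positivity)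
  have h1 := abs_le.1 (hC (T^[n] x))
  have h2 := abs_le.1 (hC x)
  exact abs_le.2 ⟨by linarith, by linarith⟩

theorem limsup_average_comp (hC : ∀ x, |g x| ≤ C) (x : X) :
    limsup (fun n : ℕ ↦ 1 / (n : ℝ) * birkhoffSum T g n (T x)) atTop =
      limsup (fun n : ℕ ↦ 1 / (n : ℝ) * birkhoffSum T g n x) atTop := by
  refine le_antisymm (limsup_le_limsup_of_tendsto_sub (fun n ↦ abs_average_le hC n x)
    (fun n ↦ abs_average_le hC n _) (tendsto_average_comp_sub hC x))
    (limsup_le_limsup_of_tendsto_sub (fun n ↦ abs_average_le hC n _)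
    (fun n ↦ abs_average_le hC n _) ?_)
  simpa using (tendsto_average_comp_sub (T := T) hC x).neg

/-- The running maximum `max_{k ≤ n} S_k h` of the Birkhoff sums, including `S_0 h = 0`. -/
def runningMax (T : X → X) (h : X → ℝ) : ℕ → X → ℝ
  | 0, _ => 0
  | n + 1, x => max 0 (h x + runningMax T h n (T x))

theorem runningMax_nonneg (h : X → ℝ) (n : ℕ) (x : X) : 0 ≤ runningMax T h n x := by
  cases n with
  | zero => exact le_rfl
  | succ n => exact le_max_left _ _

theorem runningMax_le_succ (h : X → ℝ) (n : ℕ) (x : X) :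
    runningMax T h n x ≤ runningMax T h (n + 1) x := by
  induction n generalizing x with
  | zero => exact runningMax_nonneg _ _ _
  | succ n ih => exact max_le_max le_rfl (by linarith [ih (T x)])

theorem birkhoffSum_le_runningMax (h : X → ℝ) (n : ℕ) (x : X) :
    birkhoffSum T h n x ≤ runningMax T h n x := by
  induction n generalizing x with
  | zero => simp [runningMax]
  | succ n ih =>
    rw [birkhoffSum_succ']
    exact le_max_of_le_right (by linarith [ih (T x)])

variable [MeasurableSpace X] {μ : Measure X}

theorem measurable_birkhoffSum (hT : Measurable T) (hg : Measurable g) (n : ℕ) :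
    Measurable (birkhoffSum T g n) := by
  change Measurable fun x ↦ ∑ i ∈ Finset.range n, g (T^[i] x)
  exact Finset.measurable_sum _ fun i _ ↦ hg.comp (hT.iterate i)

theorem measurable_runningMax (hT : Measurable T) (hg : Measurable g) (n : ℕ) :
    Measurable (runningMax T g n) := by
  induction n with
  | zero => exact measurable_const
  | succ n ih => exact measurable_const.max (hg.add (ih.comp hT))

theorem abs_runningMax_le (hC : ∀ x, |g x| ≤ C) (n : ℕ) (x : X) :
    |runningMax T g n x| ≤ n * C := by
  have hC0 : 0 ≤ C := (abs_nonneg _).trans (hC x)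
  rw [abs_of_nonneg (runningMax_nonneg _ _ _)]
  induction n generalizing x with
  | zero => simp [runningMax]
  | succ n ih =>
    refine max_le (by positivity) ?_
    push_cast
    linarith [ih (T x), (abs_le.1 (hC x)).2]

theorem integrable_of_abs_le [IsFiniteMeasure μ] (hg : Measurable g) (hC : ∀ x, |g x| ≤ C) :
    Integrable g μ :=
  Integrable.of_bound hg.aestronglyMeasurable C (Eventually.of_forall hC)

/-- The maximal ergodic theorem for bounded functions. -/
theorem integral_nonneg_of_exists_birkhoffSum_pos [IsFiniteMeasure μ] (hT : MeasurePreserving T μ μ)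
    (hg : Measurable g) (hC : ∀ x, |g x| ≤ C)
    (hpos : ∀ᵐ x ∂μ, ∃ n, 0 < birkhoffSum T g n x) : 0 ≤ ∫ x, g x ∂μ := by
  let s : ℕ → Set X := fun n ↦ {x | 0 < runningMax T g n x}
  have hs : ∀ n, MeasurableSet (s n) := fun n ↦
    measurableSet_lt measurable_const (measurable_runningMax hT.measurable hg n)
  have hint : ∀ n, Integrable (runningMax T g n) μ := fun n ↦
    integrable_of_abs_le (measurable_runningMax hT.measurable hg n) (abs_runningMax_le hC n)
  -- With M_n the running maximum, M_n - M_n ∘ T ≤ g on {M_n > 0}, and M_n - M_n ∘ T ≤ 0 elsewhere.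
  -- The left side has integral zero by invariance.
  have h1 : ∀ n, 0 ≤ ∫ x, (s n).indicator g x ∂μ := by
    intro n
    have hcomp : Integrable (fun x ↦ runningMax T g n (T x)) μ :=
      hT.integrable_comp_of_integrable (hint n)
    have h2 : ∫ x, (runningMax T g n x - runningMax T g n (T x)) ∂μ = 0 := by
      rw [integral_sub (hint n) hcomp, sub_eq_zero]
      have := integral_map hT.measurable.aemeasurable (f := runningMax T g n)
        (by rw [hT.map_eq]; exact (hint n).aestronglyMeasurable)
      rw [hT.map_eq] at this
      exact this
    rw [← h2]
    refine integral_mono ((hint n).sub hcomp)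
      ((integrable_of_abs_le hg hC).indicator (hs n)) fun x ↦ ?_
    by_cases hx : x ∈ s n
    · rw [Set.indicator_of_mem hx]
      cases n with
      | zero => exact absurd (show (0 : ℝ) < 0 from hx) (lt_irrefl _)
      | succ n =>
        have h3 : 0 < max 0 (g x + runningMax T g n (T x)) := hx
        have h4 : runningMax T g (n + 1) x = g x + runningMax T g n (T x) :=
          max_eq_right (by
            by_contra hlt
            rw [max_eq_left (by linarith)] at h3
            exact lt_irrefl _ h3)
        have := runningMax_le_succ (T := T) g n (T x)
        simp only
        linarith
    · rw [Set.indicator_of_notMem hx]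
      have h3 : runningMax T g n x ≤ 0 := not_lt.1 hx
      have := runningMax_nonneg (T := T) g n (T x)
      simp only
      linarith
  have h2 : Tendsto (fun n ↦ ∫ x, (s n).indicator g x ∂μ) atTop (𝓝 (∫ x, g x ∂μ)) := by
    refine tendsto_integral_of_dominated_convergence (fun _ ↦ C)
      (fun n ↦ (hg.indicator (hs n)).aestronglyMeasurable) (integrable_const _)
      (fun n ↦ Eventually.of_forall fun x ↦ ?_) ?_
    · exact (norm_indicator_le_norm_self _ _).trans (hC x)
    · filter_upwards [hpos] with x hx
      obtain ⟨m, hm⟩ := hx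
      refine tendsto_const_nhds.congr' ?_
      filter_upwards [eventually_ge_atTop m] with n hn
      rw [Set.indicator_of_mem]
      exact (hm.trans_le (birkhoffSum_le_runningMax _ _ _)).trans_le
        (monotone_nat_of_le_succ (fun k ↦ runningMax_le_succ (T := T) g k x) hn)
  exact ge_of_tendsto' h2 h1

theorem integral_ge_of_frequently_average_gt [IsFiniteMeasure μ] (hT : MeasurePreserving T μ μ)
    (hg : Measurable g) (hC : ∀ x, |g x| ≤ C) (b : ℝ)
    (hpos : ∀ᵐ x ∂μ, ∃ n : ℕ, 0 < n ∧ b < 1 / (n : ℝ) * birkhoffSum T g n x) :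
    b * μ.real Set.univ ≤ ∫ x, g x ∂μ := by
  have h := integral_nonneg_of_exists_birkhoffSum_pos (g := fun x ↦ g x - b) (C := C + |b|) hT
    (hg.sub_const b) (fun x ↦ (abs_sub _ _).trans (by linarith [hC x])) ?_
  · rw [integral_sub (integrable_of_abs_le hg hC) (integrable_const _), integral_const,
      smul_eq_mul] at h
    linarith
  · filter_upwards [hpos] with x hx
    obtain ⟨n, hn, hx⟩ := hx
    refine ⟨n, ?_⟩
    have hn' : (0 : ℝ) < n := by exact_mod_cast hn
    rw [one_div, lt_inv_mul_iff₀ hn'] at hx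
    have : birkhoffSum T (fun x ↦ g x - b) n x = birkhoffSum T g n x - n * b := by
      simp [birkhoffSum, Finset.sum_sub_distrib]
    rw [this]
    linarith

theorem measurable_limsup_average (hT : Measurable T) (hg : Measurable g) :
    Measurable fun x ↦ limsup (fun n : ℕ ↦ 1 / (n : ℝ) * birkhoffSum T g n x) atTop :=
  Measurable.limsup fun n ↦ (measurable_birkhoffSum hT hg n).const_mul _

theorem birkhoffSum_neg_fun (n : ℕ) (x : X) :
    birkhoffSum T (fun y ↦ -g y) n x = -birkhoffSum T g n x := by
  simp [birkhoffSum]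

/-- Oscillation happens inside an invariant set E on which the upper limit of the averages is at
least b and that of the negated averages at least -a. The maximal inequality for g and for -g, both
restricted to E, bounds the integral of g over E in contradictory ways unless E is null. -/
theorem ae_average_no_oscillation [IsFiniteMeasure μ] (hT : MeasurePreserving T μ μ)
    (hg : Measurable g) (hC : ∀ x, |g x| ≤ C) {a b : ℝ} (hab : a < b) :
    ∀ᵐ x ∂μ, ¬ ((∃ᶠ n : ℕ in atTop, 1 / (n : ℝ) * birkhoffSum T g n x < a) ∧
      ∃ᶠ n : ℕ in atTop, b < 1 / (n : ℝ) * birkhoffSum T g n x) := by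
  have hC' : ∀ x, |(fun y ↦ -g y) x| ≤ C := fun x ↦ by simpa using hC x
  let up : X → ℝ := fun x ↦ limsup (fun n : ℕ ↦ 1 / (n : ℝ) * birkhoffSum T g n x) atTop
  let dn : X → ℝ := fun x ↦
    limsup (fun n : ℕ ↦ 1 / (n : ℝ) * birkhoffSum T (fun y ↦ -g y) n x) atTop
  let E : Set X := {x | b ≤ up x} ∩ {x | -a ≤ dn x}
  have hE : MeasurableSet E :=
    (measurableSet_le measurable_const (measurable_limsup_average hT.measurable hg)).inter
      (measurableSet_le measurable_const (measurable_limsup_average hT.measurable hg.neg))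
  have hTE : T ⁻¹' E = E := by
    ext x
    simp only [E, up, dn, Set.mem_preimage, Set.mem_inter_iff, Set.mem_ofPred_eq,
      limsup_average_comp hC, limsup_average_comp hC']
  have hTr : MeasurePreserving T (μ.restrict E) (μ.restrict E) := by
    have := hT.restrict_preimage hE
    rwa [hTE] at this
  -- Two intermediate levels a < c < c' < b are needed: the conditions defining `E` are non-strict,
  -- while the maximal inequality asks for strict ones.
  obtain ⟨c, hac, hcb⟩ := exists_between hab
  obtain ⟨c', hcc', hcb'⟩ := exists_between hcb
  have key : ∀ (h : X → ℝ), (∀ x, |h x| ≤ C) → ∀ (x : X) (r s : ℝ), r < s →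
      s ≤ limsup (fun n : ℕ ↦ 1 / (n : ℝ) * birkhoffSum T h n x) atTop →
      ∃ n : ℕ, 0 < n ∧ r < 1 / (n : ℝ) * birkhoffSum T h n x := by
    intro h hh x r s hrs hs
    have := frequently_lt_of_lt_limsup
      (isBoundedUnder_ge_average hh x).isCoboundedUnder_flip (hrs.trans_le hs)
    obtain ⟨n, h1, h2⟩ := (this.and_eventually (eventually_gt_atTop 0)).exists
    exact ⟨n, h2, h1⟩
  have h1 : c' * (μ.restrict E).real Set.univ ≤ ∫ x, g x ∂(μ.restrict E) := by
    refine integral_ge_of_frequently_average_gt hTr hg hC c' ?_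
    filter_upwards [ae_restrict_mem hE] with x hx
    exact key g hC x c' b hcb' hx.1
  have h2 : -c * (μ.restrict E).real Set.univ ≤ ∫ x, -g x ∂(μ.restrict E) := by
    refine integral_ge_of_frequently_average_gt hTr hg.neg hC' (-c) ?_
    filter_upwards [ae_restrict_mem hE] with x hx
    exact key _ hC' x (-c) (-a) (by linarith) hx.2
  rw [integral_neg] at h2
  have h3 : (μ.restrict E).real Set.univ = 0 := by
    have := measureReal_nonneg (μ := μ.restrict E) (s := Set.univ)
    nlinarith
  have h4 : μ E = 0 := by
    rwa [measureReal_restrict_apply_univ, measureReal_eq_zero_iff] at h3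
  filter_upwards [measure_eq_zero_iff_ae_notMem.1 h4] with x hx hfr
  apply hx
  refine ⟨le_limsup_of_frequently_le (hfr.2.mono fun n hn ↦ hn.le) (isBoundedUnder_le_average hC x),
    le_limsup_of_frequently_le (hfr.1.mono fun n hn ↦ ?_) (isBoundedUnder_le_average hC' x)⟩
  rw [birkhoffSum_neg_fun]
  linarith

/-- Birkhoff's pointwise ergodic theorem for bounded functions. -/
theorem ae_exists_tendsto_average [IsFiniteMeasure μ] (hT : MeasurePreserving T μ μ)
    (hg : Measurable g) (hC : ∀ x, |g x| ≤ C) :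
    ∀ᵐ x ∂μ, ∃ l : ℝ, Tendsto (fun n : ℕ ↦ 1 / (n : ℝ) * birkhoffSum T g n x) atTop (𝓝 l) := by
  have h : ∀ᵐ x ∂μ, ∀ a b : ℚ, (a : ℝ) < b →
      ¬ ((∃ᶠ n : ℕ in atTop, 1 / (n : ℝ) * birkhoffSum T g n x < a) ∧
      ∃ᶠ n : ℕ in atTop, (b : ℝ) < 1 / (n : ℝ) * birkhoffSum T g n x) := by
    rw [ae_all_iff]
    intro a
    rw [ae_all_iff]
    intro b
    by_cases hab : (a : ℝ) < b
    · filter_upwards [ae_average_no_oscillation hT hg hC hab] with x hx _ using hx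
    · exact Eventually.of_forall fun x h ↦ absurd h hab
  filter_upwards [h] with x hx
  refine tendsto_of_no_upcrossings Rat.isDenseEmbedding_coe_real.dense ?_
    (isBoundedUnder_le_average hC x) (isBoundedUnder_ge_average hC x)
  rintro _ ⟨a, rfl⟩ _ ⟨b, rfl⟩ hab
  exact hx a b hab

theorem integral_average [IsFiniteMeasure μ] (hT : MeasurePreserving T μ μ)
    (hg : Measurable g) (hC : ∀ x, |g x| ≤ C) {n : ℕ} (hn : 0 < n) :
    ∫ x, 1 / (n : ℝ) * birkhoffSum T g n x ∂μ = ∫ x, g x ∂μ := by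
  have h1 : ∀ i, ∫ x, g (T^[i] x) ∂μ = ∫ x, g x ∂μ := by
    intro i
    have := integral_map (hT.iterate i).measurable.aemeasurable (f := g)
      (by rw [(hT.iterate i).map_eq]; exact hg.aestronglyMeasurable)
    rw [(hT.iterate i).map_eq] at this
    exact this.symm
  have hn' : (n : ℝ) ≠ 0 := by exact_mod_cast hn.ne'
  simp only [birkhoffSum]
  rw [integral_const_mul, integral_finsetSum _ fun i _ ↦
    (integrable_of_abs_le (hg.comp (hT.measurable.iterate i)) fun x ↦ hC _ :
      Integrable (fun x ↦ g (T^[i] x)) μ)]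
  simp only [h1, Finset.sum_const, Finset.card_range, nsmul_eq_mul]
  field_simp

theorem integral_eq_of_ae_tendsto_average [IsFiniteMeasure μ] (hT : MeasurePreserving T μ μ)
    (hg : Measurable g) (hC : ∀ x, |g x| ≤ C) {l : X → ℝ}
    (hl : ∀ᵐ x ∂μ, Tendsto (fun n : ℕ ↦ 1 / (n : ℝ) * birkhoffSum T g n x) atTop (𝓝 (l x))) :
    ∫ x, g x ∂μ = ∫ x, l x ∂μ := by
  have h := tendsto_integral_of_dominated_convergence (μ := μ) (fun _ ↦ C)
    (fun n ↦ ((measurable_birkhoffSum hT.measurable hg n).const_mul (1 / (n : ℝ))).aestronglyMeasurable)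
    (integrable_const _) (fun n ↦ Eventually.of_forall fun x ↦ abs_average_le hC n x) hl
  refine tendsto_nhds_unique (tendsto_const_nhds.congr' ?_) h
  filter_upwards [eventually_gt_atTop 0] with n hn
  exact (integral_average hT hg hC hn).symm

end Birkhoff

/-! ### Existence of selections -/

section Records

/-- If S_n > l n, let m ≤ n be a time where S is maximal on [0, n]. Then S_m ≥ S_n > l n ≥ l m. For
n large, l n exceeds the maximum of S on [0, N], which forces m > N. -/
theorem frequently_record {S : ℕ → ℝ} {l : ℝ} (hl : 0 < l)
    (h : ∃ᶠ n : ℕ in atTop, l < 1 / (n : ℝ) * S n) :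
    ∃ᶠ n : ℕ in atTop, l < 1 / (n : ℝ) * S n ∧ ∀ j ≤ n, S j ≤ S n := by
  rw [frequently_atTop]
  intro N
  obtain ⟨j₀, -, hj₀⟩ := Finset.exists_max_image (Finset.range (N + 1)) S ⟨0, by simp⟩
  obtain ⟨n₀, hn₀⟩ := exists_nat_gt (S j₀ / l)
  obtain ⟨n, hn, hSn⟩ := (frequently_atTop.1 h) (max n₀ 1)
  have hn1 : 0 < n := lt_of_lt_of_le zero_lt_one ((le_max_right _ _).trans hn)
  have hn' : (0 : ℝ) < n := by exact_mod_cast hn1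
  rw [one_div, lt_inv_mul_iff₀ hn'] at hSn
  obtain ⟨m, hm, hmax⟩ := Finset.exists_max_image (Finset.range (n + 1)) S ⟨0, by simp⟩
  have hmn : m ≤ n := Nat.lt_succ_iff.1 (Finset.mem_range.1 hm)
  have hSm : S n ≤ S m := hmax n (by simp)
  have hbig : S j₀ < S m := by
    have : (n₀ : ℝ) ≤ n := by exact_mod_cast (le_max_left _ _).trans hn
    rw [div_lt_iff₀ hl] at hn₀
    nlinarith
  have hNm : N < m := by
    by_contra hle
    exact absurd (hj₀ m (by simp; omega)) (not_le.2 hbig)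
  refine ⟨m, hNm.le, ?_, fun j hj ↦ hmax j (by simp; omega)⟩
  have hm' : (0 : ℝ) < m := by exact_mod_cast (Nat.zero_le _).trans_lt hNm
  rw [one_div, lt_inv_mul_iff₀ hm']
  have : (m : ℝ) ≤ n := by exact_mod_cast hmn
  nlinarith

end Records

/-! ### Periodic points on the curve, the essential supremum of the exponent and the size of the
good sets -/

section Curve

variable {M : Type*} [TopologicalSpace M] [ChartedSpace Plane M] [IsManifold (𝓡 2) ∞ M]

theorem tangentBundle_ext {x y : M} (h : x = y) {v w : Plane} (hvw : v = w) :
    (⟨x, v⟩ : TangentBundle (𝓡 2) M) = ⟨y, w⟩ := by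
  subst h
  subst hvw
  rfl

/-- At an accumulation point of the parameters of `N`-periodic points of a curve, the tangent vector
of the curve is fixed by the derivative of `f^[N]`. -/
theorem tangentMap_iterate_eq_of_accPt (f : Diffeomorph (𝓡 2) (𝓡 2) M M ∞) (σ : RegularCurve M)
    {N : ℕ} {s : ℝ} (hs : s ∈ Set.Icc (0 : ℝ) 1) (hfix : f^[N] (σ.toFun s) = σ.toFun s)
    (hacc : AccPt s (𝓟 {t | t ∈ Set.Icc (0 : ℝ) 1 ∧ f^[N] (σ.toFun t) = σ.toFun t})) :
    tangentMap (𝓡 2) (𝓡 2) f^[N]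
      (⟨σ.toFun s, mfderivWithin 𝓘(ℝ, ℝ) (𝓡 2) σ.toFun (Set.Icc 0 1) s (1 : ℝ)⟩ :
        TangentBundle (𝓡 2) M) =
      ⟨σ.toFun s, mfderivWithin 𝓘(ℝ, ℝ) (𝓡 2) σ.toFun (Set.Icc 0 1) s (1 : ℝ)⟩ := by
  set A : Set ℝ := {t | t ∈ Set.Icc (0 : ℝ) 1 ∧ f^[N] (σ.toFun t) = σ.toFun t} with hA
  have hD : HasMFDerivWithinAt 𝓘(ℝ, ℝ) (𝓡 2) σ.toFun (Set.Icc 0 1) s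
      (mfderivWithin 𝓘(ℝ, ℝ) (𝓡 2) σ.toFun (Set.Icc 0 1) s) :=
    ((σ.contMDiffOn s hs).mdifferentiableWithinAt (by simp)).hasMFDerivWithinAt
  have hD' := (mdifferentiable_iterate f N (σ.toFun s)).hasMFDerivAt.comp_hasMFDerivWithinAt s hD
  -- On `A` the curves σ and f^N ∘ σ coincide, and one accumulation point suffices for the
  -- uniqueness of a derivative in one variable.
  have hu : UniqueMDiffWithinAt 𝓘(ℝ, ℝ) A s :=
    uniqueMDiffWithinAt_iff_uniqueDiffWithinAt.2 (uniqueDiffWithinAt_iff_accPt.2 hacc)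
  have h1 := hD.mono (fun t ht ↦ ht.1 : A ⊆ Set.Icc 0 1)
  have h2 := (hD'.mono (fun t ht ↦ ht.1 : A ⊆ Set.Icc 0 1)).congr_mono
    (f₁ := σ.toFun) (t := A) (fun t ht ↦ ht.2.symm) hfix.symm subset_rfl
  have h3 := hu.eq h2 h1
  refine tangentBundle_ext hfix ?_
  exact congrArg (fun B : ℝ →L[ℝ] Plane ↦ B 1) h3

section Metric

variable [RiemannianBundle (fun x : M ↦ TangentSpace (𝓡 2) x)]

theorem curveExponent_eq (f : Diffeomorph (𝓡 2) (𝓡 2) M M ∞) (σ : RegularCurve M)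
    (s : unitInterval) : curveExponent f σ s =
      limsup (fun n : ℕ ↦ 1 / (n : ℝ) * birkhoffSum (lift f) (phi f) n (σ.lift s)) atTop := by
  simp only [curveExponent, log_lineNorm_iterate]

/-- By the chain rule, the expansion over the last i steps is exp(S_n - S_{n-i}). Being at least one
for every i means that n is a record time of the Birkhoff sums. -/
theorem mem_goodSet_iff (f : Diffeomorph (𝓡 2) (𝓡 2) M M ∞) (σ : RegularCurve M)
    {lmin lmax : ℝ} {n : ℕ} {s : unitInterval} : s ∈ goodSet f σ lmin lmax n ↔
      lmin ≤ 1 / (n : ℝ) * birkhoffSum (lift f) (phi f) n (σ.lift s) ∧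
      1 / (n : ℝ) * birkhoffSum (lift f) (phi f) n (σ.lift s) ≤ lmax ∧
      σ.toFun s ∉ Function.periodicPts f ∧
      ∀ j ≤ n, birkhoffSum (lift f) (phi f) j (σ.lift s) ≤
        birkhoffSum (lift f) (phi f) n (σ.lift s) := by
  have h : ∀ i ≤ n, birkhoffSum (lift f) (phi f) i ((lift f)^[n - i] (σ.lift s)) =
      birkhoffSum (lift f) (phi f) n (σ.lift s) -
        birkhoffSum (lift f) (phi f) (n - i) (σ.lift s) := by
    intro i hi
    have := birkhoffSum_add (lift f) (phi f) (n - i) i (σ.lift s)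
    rw [Nat.sub_add_cancel hi] at this
    rw [this, add_sub_cancel_left]
  change (_ ∧ _ ∧ _ ∧ _) ↔ _
  simp only [log_lineNorm_iterate]
  refine and_congr_right fun _ ↦ and_congr_right fun _ ↦ and_congr_right fun _ ↦ ?_
  constructor
  · intro h1 j hj
    have := h1 (n - j) (Nat.sub_le _ _)
    rw [lineNorm_iterate, Real.one_le_exp_iff, h _ (Nat.sub_le _ _), Nat.sub_sub_self hj] at this
    linarith
  · intro h1 i hi
    rw [lineNorm_iterate, Real.one_le_exp_iff, h i hi]
    linarith [h1 (n - i) (Nat.sub_le _ _)]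

variable [IsContinuousRiemannianBundle Plane (fun x : M ↦ TangentSpace (𝓡 2) x)]
variable [T2Space M] [CompactSpace M]

theorem limsup_average_eq_zero_of_periodic (f : Diffeomorph (𝓡 2) (𝓡 2) M M ∞) {ξ : ProjTangent M}
    {N : ℕ} (hN : 0 < N) (hξ : (lift f)^[N] ξ = ξ) (hS : birkhoffSum (lift f) (phi f) N ξ = 0) :
    limsup (fun n : ℕ ↦ 1 / (n : ℝ) * birkhoffSum (lift f) (phi f) n ξ) atTop = 0 := by
  obtain ⟨C, hC0, hC⟩ := exists_abs_phi_le f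
  have h1 : ∀ q, (lift f)^[N * q] ξ = ξ := by
    intro q
    rw [Function.iterate_mul]
    exact Function.iterate_fixed hξ q
  have h2 : ∀ q, birkhoffSum (lift f) (phi f) (N * q) ξ = 0 := by
    intro q
    induction q with
    | zero => simp
    | succ q ih => rw [Nat.mul_succ, birkhoffSum_add, ih, h1, hS, add_zero]
  have h3 : ∀ n, |birkhoffSum (lift f) (phi f) n ξ| ≤ N * C := by
    intro n
    rw [← Nat.div_add_mod n N, birkhoffSum_add, h2, h1, zero_add]
    refine (abs_birkhoffSum_le hC _ _).trans ?_
    gcongr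
    exact (Nat.mod_lt n hN).le
  refine Tendsto.limsup_eq ?_
  refine squeeze_zero_norm (fun n ↦ ?_) (tendsto_const_div_atTop_nhds_zero_nat (N * C))
  rw [Real.norm_eq_abs, abs_mul, abs_of_nonneg (by positivity : 0 ≤ 1 / (n : ℝ)), one_div,
    div_eq_inv_mul]
  exact mul_le_mul_of_nonneg_left (h3 n) (by positivity)

theorem curveExponent_eq_zero_of_accPt (f : Diffeomorph (𝓡 2) (𝓡 2) M M ∞) (σ : RegularCurve M)
    {N : ℕ} (hN : 0 < N) (s : unitInterval) (hfix : f^[N] (σ.toFun s) = σ.toFun s)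
    (hacc : AccPt (s : ℝ) (𝓟 {t | t ∈ Set.Icc (0 : ℝ) 1 ∧ f^[N] (σ.toFun t) = σ.toFun t})) :
    curveExponent f σ s = 0 := by
  have h := tangentMap_iterate_eq_of_accPt f σ s.2 hfix hacc
  have hl : σ.lift s = ProjTangent.span ⟨⟨σ.toFun s, _⟩, σ.deriv_ne_zero s s.2⟩ := rfl
  have h1 : (lift f)^[N] (σ.lift s) = σ.lift s := by
    rw [hl, iterate_lift_span]
    exact congrArg ProjTangent.span (Subtype.ext h)
  have h2 : birkhoffSum (lift f) (phi f) N (σ.lift s) = 0 := by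
    rw [← log_lineNorm_iterate, hl, lineNorm_span]
    have h3 := congrArg (fun z : TangentBundle (𝓡 2) M ↦ ‖(z.2 : TangentSpace (𝓡 2) z.1)‖) h
    have h4 : ‖mfderiv (𝓡 2) (𝓡 2) f^[N] (σ.toFun s)
        (mfderivWithin 𝓘(ℝ, ℝ) (𝓡 2) σ.toFun (Set.Icc 0 1) s (1 : ℝ) :
          TangentSpace (𝓡 2) (σ.toFun s))‖ =
        ‖(mfderivWithin 𝓘(ℝ, ℝ) (𝓡 2) σ.toFun (Set.Icc 0 1) s (1 : ℝ) :
          TangentSpace (𝓡 2) (σ.toFun s))‖ := h3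
    rw [h4, div_self (norm_pos_iff.2 (σ.deriv_ne_zero s s.2)).ne', Real.log_one]
  rw [curveExponent_eq]
  exact limsup_average_eq_zero_of_periodic f hN h1 h2

/-- For a fixed period N the set is discrete, since the tangent vector at an accumulation point is
fixed by Df^N and therefore has zero exponent. A discrete subspace of the interval is countable. -/
theorem countable_periodic_of_curveExponent_pos (f : Diffeomorph (𝓡 2) (𝓡 2) M M ∞)
    (σ : RegularCurve M) :
    {s : unitInterval | σ.toFun s ∈ Function.periodicPts f ∧ 0 < curveExponent f σ s}.Countable := by
  have h1 : {s : unitInterval | σ.toFun s ∈ Function.periodicPts f ∧ 0 < curveExponent f σ s} ⊆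
      ⋃ N : ℕ, {s : unitInterval | 0 < N ∧ f^[N] (σ.toFun s) = σ.toFun s ∧
        0 < curveExponent f σ s} := by
    rintro s ⟨⟨N, hN, hp⟩, h⟩
    exact Set.mem_iUnion.2 ⟨N, hN, hp, h⟩
  refine (Set.countable_iUnion fun N ↦ ?_).mono h1
  set A : Set unitInterval := {s | 0 < N ∧ f^[N] (σ.toFun s) = σ.toFun s ∧
    0 < curveExponent f σ s} with hA
  have hdisc : DiscreteTopology A := by
    rw [discreteTopology_subtype_iff]
    rintro s ⟨hN, hfix, hpos⟩
    by_contra hne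
    have hacc : AccPt s (𝓟 A) := ⟨hne⟩
    have hacc' : AccPt (s : ℝ)
        (𝓟 {t | t ∈ Set.Icc (0 : ℝ) 1 ∧ f^[N] (σ.toFun t) = σ.toFun t}) := by
      rw [accPt_iff_frequently] at hacc ⊢
      have h2 : Tendsto (fun t : unitInterval ↦ (t : ℝ)) (𝓝 s) (𝓝 (s : ℝ)) :=
        continuous_subtype_val.continuousAt
      refine h2.frequently (hacc.mono ?_)
      rintro t ⟨hts, htA⟩
      exact ⟨fun h ↦ hts (Subtype.ext h), t.2, htA.2.1⟩
    exact hpos.ne' (curveExponent_eq_zero_of_accPt f σ hN s hfix hacc')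
  exact Set.countable_coe_iff.1 (TopologicalSpace.separableSpace_iff_countable.1 inferInstance)

theorem isBoundedUnder_curveExponent (f : Diffeomorph (𝓡 2) (𝓡 2) M M ∞) (σ : RegularCurve M) :
    ∃ C, ∀ s, |curveExponent f σ s| ≤ C := by
  obtain ⟨C, hC0, hC⟩ := exists_abs_phi_le f
  refine ⟨C, fun s ↦ ?_⟩
  rw [curveExponent_eq, abs_le]
  constructor
  · exact le_limsup_of_frequently_le
      (Frequently.of_forall fun n ↦ (abs_le.1 (abs_average_le hC n _)).1)
      (isBoundedUnder_le_average hC _)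
  · exact limsup_le_of_le (isBoundedUnder_ge_average hC _).isCoboundedUnder_flip
      (Eventually.of_forall fun n ↦ (abs_le.1 (abs_average_le hC n _)).2)

theorem ae_curveExponent_le_lambdaBar (f : Diffeomorph (𝓡 2) (𝓡 2) M M ∞) (σ : RegularCurve M) :
    ∀ᵐ s, curveExponent f σ s ≤ lambdaBar f σ := by
  obtain ⟨C, hC⟩ := isBoundedUnder_curveExponent f σ
  exact ae_le_essSup (hf := isBoundedUnder_of ⟨C, fun s ↦ (abs_le.1 (hC s)).2⟩)

theorem measure_lt_curveExponent_pos (f : Diffeomorph (𝓡 2) (𝓡 2) M M ∞) (σ : RegularCurve M)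
    {l : ℝ} (hl : l < lambdaBar f σ) : 0 < volume {s | l < curveExponent f σ s} := by
  obtain ⟨C, hC⟩ := isBoundedUnder_curveExponent f σ
  rw [pos_iff_ne_zero]
  intro h0
  have h1 : ∀ᵐ s, curveExponent f σ s ≤ l := by
    rw [ae_iff]
    simpa using h0
  have h2 : lambdaBar f σ ≤ l := limsup_le_of_le
    (isBoundedUnder_of ⟨-C, fun s ↦ (abs_le.1 (hC s)).1⟩ :
      IsBoundedUnder (· ≥ ·) _ _).isCoboundedUnder_flip h1
  linarith

theorem lambdaBar_pos (f : Diffeomorph (𝓡 2) (𝓡 2) M M ∞) (σ : RegularCurve M)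
    (hσ : 0 < volume {s : unitInterval | 0 < curveExponent f σ s}) : 0 < lambdaBar f σ := by
  by_contra hle
  have h := ae_curveExponent_le_lambdaBar f σ
  apply hσ.ne'
  refine measure_mono_null (fun s hs ↦ ?_) (ae_iff.1 h)
  have hs' : 0 < curveExponent f σ s := hs
  change ¬ curveExponent f σ s ≤ lambdaBar f σ
  linarith

/-- Otherwise the measures of the good sets are summable, and Borel–Cantelli puts almost every
parameter in finitely many of them. But parameters with exponent above `lmin` belong to infinitely
many, by the record argument, apart from the periodic ones and those with exponent above λ̄, which
are negligible. The set of parameters with exponent above `lmin` has positive measure. -/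
theorem frequently_measure_goodSet_gt (f : Diffeomorph (𝓡 2) (𝓡 2) M M ∞) (σ : RegularCurve M)
    {lmin lmax ρ : ℝ} (h0 : 0 < lmin) (h1 : lmin < lambdaBar f σ) (h2 : lambdaBar f σ < lmax)
    (hρ : 0 < ρ) (hρ1 : ρ < 1) :
    ∃ᶠ n : ℕ in atTop, ρ ^ n < (volume : Measure unitInterval).real (goodSet f σ lmin lmax n) := by
  intro hnot
  obtain ⟨C, hC0, hC⟩ := exists_abs_phi_le f
  obtain ⟨N, hN⟩ := eventually_atTop.1 hnot
  have hsum : ∑' n, (volume : Measure unitInterval) {s | N ≤ n ∧ s ∈ goodSet f σ lmin lmax n} ≠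
      ⊤ := by
    have hle : ∀ n, (volume : Measure unitInterval) {s | N ≤ n ∧ s ∈ goodSet f σ lmin lmax n} ≤
        ENNReal.ofReal (ρ ^ n) := by
      intro n
      by_cases hn : N ≤ n
      · refine (measure_mono (fun s hs ↦ hs.2)).trans ?_
        rw [← ofReal_measureReal]
        exact ENNReal.ofReal_le_ofReal (not_lt.1 (hN n hn))
      · simp [hn]
    refine ne_top_of_le_ne_top ?_ (ENNReal.tsum_le_tsum hle)
    exact (summable_geometric_of_lt_one hρ.le hρ1).tsum_ofReal_ne_top
  have hnull := measure_setOfPred_frequently_eq_zero hsum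
  have hpos := measure_lt_curveExponent_pos f σ h1
  apply hpos.ne'
  have hper := (countable_periodic_of_curveExponent_pos f σ).measure_zero (volume : Measure unitInterval)
  have hle := ae_iff.1 (ae_curveExponent_le_lambdaBar f σ)
  refine measure_mono_null ?_ (measure_union_null hnull (measure_union_null hper hle))
  intro s hs
  have hs' : lmin < curveExponent f σ s := hs
  by_cases hs1 : curveExponent f σ s ≤ lambdaBar f σ
  swap
  · exact Or.inr (Or.inr hs1)
  by_cases hs2 : σ.toFun s ∈ Function.periodicPts f
  · exact Or.inr (Or.inl ⟨hs2, h0.trans hs'⟩)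
  left
  rw [curveExponent_eq] at hs' hs1
  have hfr := frequently_record h0 (frequently_lt_of_lt_limsup
    (isBoundedUnder_ge_average hC _).isCoboundedUnder_flip hs')
  have hev := eventually_lt_of_limsup_lt (hs1.trans_lt h2) (isBoundedUnder_le_average hC (σ.lift s))
  refine ((hfr.and_eventually hev).and_eventually (eventually_ge_atTop N)).mono ?_
  rintro n ⟨⟨⟨a1, a2⟩, a3⟩, a4⟩
  exact ⟨a4, (mem_goodSet_iff f σ).2 ⟨a1.le, a3.le, hs2, a2⟩⟩

end Metric

end Curve

/-! ### Finite nets of measures, the pigeonhole principle and the choice of a selection -/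

section Pigeonhole

theorem exists_lt_measureReal_of_card_mul_lt {X ι : Type*} [MeasurableSpace X] [Fintype ι]
    (μ : Measure X) [IsFiniteMeasure μ] (T : Set X) (c : X → ι) {b : ℝ}
    (h : Fintype.card ι * b < μ.real T) : ∃ i, b < μ.real {s ∈ T | c s = i} := by
  by_contra hnot
  push Not at hnot
  have h1 : T = ⋃ i, {s ∈ T | c s = i} := by
    ext s
    simp
  have h2 : μ.real T ≤ ∑ i, μ.real {s ∈ T | c s = i} := by
    conv_lhs => rw [h1]
    exact measureReal_iUnion_fintype_le _
  have h3 : ∑ i, μ.real {s ∈ T | c s = i} ≤ ∑ _i : ι, b := Finset.sum_le_sum fun i _ ↦ hnot i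
  simp only [Finset.sum_const, Finset.card_univ, nsmul_eq_mul] at h3
  linarith

variable {M : Type*} [TopologicalSpace M] [ChartedSpace Plane M] [IsManifold (𝓡 2) ∞ M]

theorem exists_finite_net [T2Space M] [CompactSpace M]
    (d : MetricSpace (FiniteMeasure (ProjTangent M)))
    (hd : d.toPseudoMetricSpace.toUniformSpace.toTopologicalSpace = weakStar M) {δ : ℝ} (hδ : 0 < δ) :
    ∃ t : Finset (FiniteMeasure (ProjTangent M)), ∀ ν : FiniteMeasure (ProjTangent M), ν.mass ≤ 1 →
      ∃ y ∈ t, d.dist ν y < δ := by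
  have hK : @IsCompact _ d.toPseudoMetricSpace.toUniformSpace.toTopologicalSpace
      {ν : FiniteMeasure (ProjTangent M) | ν.mass ≤ 1} := by
    rw [hd]
    exact isCompact_setOfPred_finiteMeasure_le_of_compactSpace _ 1
  obtain ⟨t, -, htf, ht⟩ := @IsCompact.finite_cover_balls _ d.toPseudoMetricSpace _ hK δ hδ
  refine ⟨htf.toFinset, fun ν hν ↦ ?_⟩
  obtain ⟨y, hy, hνy⟩ := Set.mem_iUnion₂.1 (ht hν)
  exact ⟨y, by simpa using hy, hνy⟩

/-- Among finitely many measure-valued maps, all are almost constant on a piece of controlled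
size of any given set. -/
theorem exists_card_forall_exists_subset [T2Space M] [CompactSpace M]
    (d : MetricSpace (FiniteMeasure (ProjTangent M)))
    (hd : d.toPseudoMetricSpace.toUniformSpace.toTopologicalSpace = weakStar M) {δ : ℝ} (hδ : 0 < δ)
    (ι : Type) [Fintype ι] :
    ∃ N : ℕ, ∀ (Φ : ι → unitInterval → FiniteMeasure (ProjTangent M)),
      (∀ i s, (Φ i s).mass ≤ 1) → ∀ (T : Set unitInterval) (b : ℝ),
      N * b < (volume : Measure unitInterval).real T →
      ∃ T' ⊆ T, b < (volume : Measure unitInterval).real T' ∧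
        ∀ s ∈ T', ∀ s' ∈ T', ∀ i, d.dist (Φ i s) (Φ i s') < δ := by
  classical
  obtain ⟨t, ht⟩ := exists_finite_net d hd (half_pos hδ)
  refine ⟨Fintype.card (ι → t), fun Φ hΦ T b hb ↦ ?_⟩
  have hc : ∀ s, ∃ c : ι → t, ∀ i, d.dist (Φ i s) (c i) < δ / 2 := by
    intro s
    choose y hy1 hy2 using fun i ↦ ht (Φ i s) (hΦ i s)
    exact ⟨fun i ↦ ⟨y i, hy1 i⟩, hy2⟩
  choose c hc using hc
  obtain ⟨a, ha⟩ := exists_lt_measureReal_of_card_mul_lt volume T c hb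
  refine ⟨_, fun s hs ↦ hs.1, ha, ?_⟩
  rintro s ⟨-, hs⟩ s' ⟨-, hs'⟩ i
  have h1 := hc s i
  have h2 := hc s' i
  rw [hs] at h1
  rw [hs'] at h2
  have h3 := @dist_triangle_right _ d.toPseudoMetricSpace (Φ i s) (Φ i s') (a i)
  linarith

theorem pointMass_mass (ξ : ProjTangent M) : (pointMass ξ).mass = 1 := by
  simp [pointMass, FiniteMeasure.mass]

theorem mass_sum {X ι : Type*} [MeasurableSpace X] (s : Finset ι) (ν : ι → FiniteMeasure X) :
    (∑ i ∈ s, ν i).mass = ∑ i ∈ s, (ν i).mass := by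
  classical
  induction s using Finset.induction_on with
  | empty => simp
  | insert a s ha ih =>
    rw [Finset.sum_insert ha, Finset.sum_insert ha, ← ih]
    simp [FiniteMeasure.mass]

theorem mass_smul_sum_pointMass_le (n : ℕ) (s : Finset ℕ) (hs : s ⊆ Finset.range n)
    (ζ : ℕ → ProjTangent M) : ((n : ℝ≥0)⁻¹ • ∑ i ∈ s, pointMass (ζ i)).mass ≤ 1 := by
  have h1 : ((n : ℝ≥0)⁻¹ • ∑ i ∈ s, pointMass (ζ i)).mass = (n : ℝ≥0)⁻¹ * s.card := by
    change ((n : ℝ≥0)⁻¹ • ∑ i ∈ s, pointMass (ζ i)) Set.univ = _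
    rw [FiniteMeasure.smul_apply, smul_eq_mul]
    congr 1
    change (∑ i ∈ s, pointMass (ζ i)).mass = _
    rw [mass_sum]
    simp [pointMass_mass]
  rw [h1]
  have h2 : (s.card : ℝ≥0) ≤ n := by
    exact_mod_cast (Finset.card_le_card hs).trans (by simp)
  rcases Nat.eq_zero_or_pos n with rfl | hn
  · simp
  · rw [inv_mul_le_iff₀ (by exact_mod_cast hn), mul_one]
    exact h2

variable [RiemannianBundle (fun x : M ↦ TangentSpace (𝓡 2) x)]

theorem mass_empirical_le (f : Diffeomorph (𝓡 2) (𝓡 2) M M ∞) (n : ℕ) (ξ : ProjTangent M) :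
    (empirical f n ξ).mass ≤ 1 :=
  mass_smul_sum_pointMass_le n _ subset_rfl _

theorem mass_neutralPart_le (f : Diffeomorph (𝓡 2) (𝓡 2) M M ∞) (α : ℝ) (L n : ℕ)
    (ξ : ProjTangent M) : (neutralPart f α L n ξ).mass ≤ 1 := by
  classical
  exact mass_smul_sum_pointMass_le n _ (Finset.filter_subset _ _) _

theorem mass_nonNeutralPart_le (f : Diffeomorph (𝓡 2) (𝓡 2) M M ∞) (α : ℝ) (L n : ℕ)
    (ξ : ProjTangent M) : (nonNeutralPart f α L n ξ).mass ≤ 1 := by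
  classical
  exact mass_smul_sum_pointMass_le n _ (Finset.filter_subset _ _) _

/-- The number N of pieces depends on k but not on n, so N ρ^n ≤ 1 for large n. Passing from the
good set to one piece then costs at most a further factor ρ^n, whence the exponent 2n. -/
theorem exists_isSelection [T2Space M] [CompactSpace M]
    [IsContinuousRiemannianBundle Plane (fun x : M ↦ TangentSpace (𝓡 2) x)]
    (f : Diffeomorph (𝓡 2) (𝓡 2) M M ∞) (σ : RegularCurve M)
    (d : MetricSpace (FiniteMeasure (ProjTangent M)))
    (hd : d.toPseudoMetricSpace.toUniformSpace.toTopologicalSpace = weakStar M)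
    {lmin lmax ρ : ℕ → ℝ} (hr : IsRateSequence (lambdaBar f σ) lmin lmax ρ) :
    ∃ n α L δ T', IsSelection f σ d lmin lmax ρ n α L δ T' := by
  let α : ℕ → ℝ := fun k ↦ 1 / ((k : ℝ) + 1)
  have hα : ∀ k, 0 < α k := fun k ↦ Nat.one_div_pos_of_nat
  have key : ∀ k : ℕ, ∃ (n : ℕ) (T' : Set unitInterval), k ≤ n ∧
      ρ k ^ n < (volume : Measure unitInterval).real (goodSet f σ (lmin k) (lmax k) n) ∧
      T' ⊆ goodSet f σ (lmin k) (lmax k) n ∧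
      ρ k ^ (2 * n) < (volume : Measure unitInterval).real T' ∧
      ∀ s ∈ T', ∀ s' ∈ T',
        d.dist (empirical f n (σ.lift s)) (empirical f n (σ.lift s')) < α k ∧
        ∀ j ≤ k, d.dist (neutralPart f (α j) (j + 1) n (σ.lift s))
          (neutralPart f (α j) (j + 1) n (σ.lift s')) < α k := by
    intro k
    obtain ⟨N, hN⟩ := exists_card_forall_exists_subset d hd (hα k) (Option (Fin (k + 1)))
    have h1 : ∀ᶠ n : ℕ in atTop, N * ρ k ^ n ≤ 1 := by
      have h := (tendsto_pow_atTop_nhds_zero_of_lt_one (hr.ρ_pos k).le (hr.ρ_lt k)).const_mul (N : ℝ)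
      rw [mul_zero] at h
      exact h.eventually (Iic_mem_nhds zero_lt_one)
    obtain ⟨n, ⟨hn1, hn2⟩, hn3⟩ := ((frequently_measure_goodSet_gt f σ (hr.lmin_pos k) (hr.lmin_lt k)
      (hr.lt_lmax k) (hr.ρ_pos k) (hr.ρ_lt k)).and_eventually h1 |>.and_eventually
      (eventually_ge_atTop k)).exists
    -- The index `none` carries the empirical measure and `some j` the neutral part at the j-th
    -- threshold, so that one application of the pigeonhole principle controls all k + 2 measures.
    let Φ : Option (Fin (k + 1)) → unitInterval → FiniteMeasure (ProjTangent M) := fun o s ↦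
      o.elim (empirical f n (σ.lift s)) fun j ↦ neutralPart f (α j) (j + 1) n (σ.lift s)
    have hΦ : ∀ i s, (Φ i s).mass ≤ 1 := by
      rintro (_ | j) s
      · exact mass_empirical_le f n _
      · exact mass_neutralPart_le f _ _ n _
    obtain ⟨T', hT'1, hT'2, hT'3⟩ := hN Φ hΦ (goodSet f σ (lmin k) (lmax k) n) (ρ k ^ (2 * n)) (by
      refine lt_of_le_of_lt ?_ hn1
      rw [two_mul, pow_add, ← mul_assoc]
      exact mul_le_of_le_one_left (pow_nonneg (hr.ρ_pos k).le _) hn2)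
    refine ⟨n, T', hn3, hn1, hT'1, hT'2, fun s hs s' hs' ↦ ⟨hT'3 s hs s' hs' none, fun j hj ↦ ?_⟩⟩
    exact hT'3 s hs s' hs' (some ⟨j, Nat.lt_succ_iff.2 hj⟩)
  choose n T' h1 h2 h3 h4 h5 using key
  refine ⟨n, α, fun k ↦ k + 1, α, T', ?_⟩
  exact
    { tendsto_n := tendsto_atTop_mono h1 tendsto_id
      large := h2
      α_pos := hα
      tendsto_α := tendsto_one_div_add_atTop_nhds_zero_nat
      one_le_L := fun k ↦ Nat.le_add_left _ _
      tendsto_L := tendsto_add_atTop_nat 1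
      tendsto_δ := tendsto_one_div_add_atTop_nhds_zero_nat
      subset := h3
      large' := h4
      dist_empirical := by
        rintro k _ ⟨s, hs, rfl⟩ _ ⟨s', hs', rfl⟩
        exact (h5 k s hs s' hs').1
      dist_neutral := by
        rintro k _ ⟨s, hs, rfl⟩ _ ⟨s', hs', rfl⟩ j hj
        exact (h5 k s hs s' hs').2 j hj }

end Pigeonhole

/-! ### Combinatorics of neutral segments -/

section NeutralTimes

/-- The times in the union of the segments of `[0, n)` of length at least `L` along which the
increments of `S` grow at most at speed `α`. -/
def neutralTimes (S : ℕ → ℝ) (α : ℝ) (L n : ℕ) : Set ℕ :=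
  {t | ∃ a ℓ : ℕ, L ≤ ℓ ∧ a + ℓ ≤ n ∧ (∀ i, 0 < i → i ≤ ℓ → S (a + i) - S a ≤ α * i) ∧
    a ≤ t ∧ t < a + ℓ}

variable {S : ℕ → ℝ} {α C : ℝ} {L n : ℕ}

/-- `[a, b)` is a connected component of the set `N` of integers in `[0, n)`. -/
structure IsComponent (N : Set ℕ) (n a b : ℕ) : Prop where
  lt : a < b
  le : b ≤ n
  mem : ∀ t, a ≤ t → t < b → t ∈ N
  left : ∀ t, t + 1 = a → t ∉ N
  right : b = n ∨ b ∉ N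

/-- A segment inside `N` that reaches past a and starts before a would contain a - 1, which is not
in `N`. -/
theorem IsComponent.le_start {a b a' ℓ t : ℕ} {N : Set ℕ} (h : IsComponent N n a b)
    (hN : ∀ s, a' ≤ s → s < a' + ℓ → s ∈ N) (hat : a ≤ t) (h2 : t < a' + ℓ) :
    a ≤ a' := by
  by_contra hlt
  push Not at hlt
  obtain ⟨a₀, rfl⟩ : ∃ a₀, a = a₀ + 1 := ⟨a - 1, by omega⟩
  exact h.left a₀ rfl (hN a₀ (by omega) (by omega))

theorem mem_neutralTimes_of_segment {a ℓ : ℕ} (h1 : L ≤ ℓ) (h2 : a + ℓ ≤ n)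
    (h3 : ∀ i, 0 < i → i ≤ ℓ → S (a + i) - S a ≤ α * i) (s : ℕ) (hs : a ≤ s) (hs' : s < a + ℓ) :
    s ∈ neutralTimes S α L n :=
  ⟨a, ℓ, h1, h2, h3, hs, hs'⟩

theorem IsComponent.length_ge {a b : ℕ} (h : IsComponent (neutralTimes S α L n) n a b) :
    L ≤ b - a := by
  obtain ⟨a', ℓ, h1, h2, h3, h4, h5⟩ := h.mem a le_rfl h.lt
  have hseg := mem_neutralTimes_of_segment h1 h2 h3
  have ha : a ≤ a' := h.le_start hseg le_rfl h5
  have hb : a' + ℓ ≤ b := by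
    rcases h.right with rfl | hb
    · exact h2
    · by_contra hlt
      exact hb (hseg b (by have := h.lt; omega) (by omega))
  omega

/-- The time t - 1 belongs to a neutral segment, which starts at some a' in [a, t). The growth from
a' to t is controlled by that segment, and the growth from a to a' by induction. Overlaps of
segments are thus harmless. -/
theorem IsComponent.sub_le {a b : ℕ} (h : IsComponent (neutralTimes S α L n) n a b) (t : ℕ)
    (hat : a ≤ t) (htb : t ≤ b) : S t - S a ≤ α * ((t : ℝ) - a) := by
  induction t using Nat.strong_induction_on with
  | _ t ih =>
    rcases hat.eq_or_lt with rfl | hlt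
    · simp
    · obtain ⟨a', ℓ, h1, h2, h3, h4, h5⟩ := h.mem (t - 1) (by omega) (by omega)
      have hseg := mem_neutralTimes_of_segment h1 h2 h3
      have ha : a ≤ a' := h.le_start (t := t - 1) hseg (by omega) h5
      have h6 := ih a' (by omega) ha (by omega)
      have h7 := h3 (t - a') (by omega) (by omega)
      rw [Nat.add_sub_cancel' (by omega), Nat.cast_sub (by omega)] at h7
      linarith

/-- If b < n and S had dropped by more than C along the component, one more step would keep S below
its value at a. Then [a, b + 1) would be a neutral segment, although b is not a neutral time. If b =
n, the drop is excluded because n is a record time. -/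
theorem IsComponent.le_sub {a b : ℕ} (h : IsComponent (neutralTimes S α L n) n a b) (hα : 0 ≤ α)
    (hC : 0 ≤ C) (hS : ∀ t, S (t + 1) - S t ≤ C) (hmax : ∀ t ≤ n, S t ≤ S n) : -C ≤ S b - S a := by
  rcases h.right with rfl | hb
  · linarith [hmax a h.lt.le]
  · have hbn : b < n ∨ b = n := h.le.lt_or_eq
    rcases hbn with hbn | rfl
    swap
    · linarith [hmax a h.lt.le]
    by_contra hlt
    apply hb
    have hlen := h.length_ge
    have hab := h.lt
    refine ⟨a, b + 1 - a, by omega, by omega, fun i hi hi' ↦ ?_, by omega, by omega⟩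
    by_cases hib : a + i ≤ b
    · have := h.sub_le (a + i) (by omega) hib
      push_cast at this
      linarith
    · have : a + i = b + 1 := by omega
      rw [this]
      have h1 := hS b
      have h2 : 0 ≤ α * i := by positivity
      linarith

open Classical in
/-- A bound on the sums over components gives a bound on the whole sum. -/
theorem sum_filter_le_of_components {N : Set ℕ} {ψ : ℕ → ℝ} {D : ℝ} (hD : 0 ≤ D)
    (h : ∀ a b, IsComponent N n a b → ∑ t ∈ Finset.Ico a b, ψ t ≤ D * ((b : ℝ) - a)) :
    ∑ t ∈ Finset.range n with t ∈ N, ψ t ≤ D * n := by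
  -- The extra condition says that cutting [0, n) at b does not split a component of `N`; this is
  -- what lets the induction remove one component at a time.
  suffices H : ∀ b ≤ n, (b = n ∨ b ∉ N ∨ ∀ t, t + 1 = b → t ∉ N) →
      ∑ t ∈ Finset.range b with t ∈ N, ψ t ≤ D * b from H n le_rfl (Or.inl rfl)
  intro b
  induction b using Nat.strong_induction_on with
  | _ b ih =>
    intro hbn hb
    rcases Nat.eq_zero_or_pos b with rfl | hpos
    · simp
    obtain ⟨c, rfl⟩ : ∃ c, b = c + 1 := ⟨b - 1, by omega⟩
    by_cases hc : c ∈ N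
    swap
    · rw [Finset.range_add_one, Finset.filter_insert, if_neg hc]
      refine (ih c (by omega) (by omega) (Or.inr (Or.inl hc))).trans ?_
      push_cast
      nlinarith
    · have hb' : c + 1 = n ∨ c + 1 ∉ N := by
        rcases hb with hb | hb | hb
        · exact Or.inl hb
        · exact Or.inr hb
        · exact absurd hc (hb c rfl)
      have hex : ∃ a, a ≤ c ∧ ∀ t, a ≤ t → t < c + 1 → t ∈ N :=
        ⟨c, le_rfl, fun t h1 h2 ↦ by rwa [show t = c by omega]⟩
      set a := Nat.find hex with ha
      obtain ⟨hac, hmem⟩ := Nat.find_spec hex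
      have hleft : ∀ t, t + 1 = a → t ∉ N := by
        intro t hta htN
        have := Nat.find_min hex (m := t) (by omega)
        apply this
        refine ⟨by omega, fun s h1 h2 ↦ ?_⟩
        rcases h1.eq_or_lt with rfl | h1
        · exact htN
        · exact hmem s (by omega) h2
      have hcomp : IsComponent N n a (c + 1) := ⟨by omega, hbn, hmem, hleft, hb'⟩
      have h1 := h a (c + 1) hcomp
      have h2 := ih a (by omega) (by omega) (Or.inr (Or.inr hleft))
      have h3 : ∑ t ∈ Finset.range (c + 1) with t ∈ N, ψ t =
          ∑ t ∈ Finset.range a with t ∈ N, ψ t + ∑ t ∈ Finset.Ico a (c + 1), ψ t := by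
        have h4 : ∑ t ∈ Finset.Ico a (c + 1), ψ t = ∑ t ∈ Finset.Ico a (c + 1), if t ∈ N then ψ t else 0 :=
          Finset.sum_congr rfl fun t ht ↦ by
            rw [Finset.mem_Ico] at ht
            rw [if_pos (hmem t ht.1 ht.2)]
        rw [h4, Finset.sum_filter, Finset.sum_filter, Finset.sum_range_add_sum_Ico _ (by omega)]
      rw [h3]
      calc _ ≤ D * a + D * (((c + 1 : ℕ) : ℝ) - a) := add_le_add h2 h1
        _ = _ := by ring

variable {u : ℕ → ℝ}

open Classical in
theorem sum_neutralTimes_le (hα : 0 ≤ α) (hS : ∀ t, S (t + 1) - S t = u t) :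
    ∑ t ∈ Finset.range n with t ∈ neutralTimes S α L n, u t ≤ α * n := by
  refine sum_filter_le_of_components hα fun a b h ↦ ?_
  have h1 : ∑ t ∈ Finset.Ico a b, u t = S b - S a := by
    rw [← Finset.sum_Ico_sub S h.lt.le]
    exact Finset.sum_congr rfl fun t _ ↦ (hS t).symm
  rw [h1]
  exact h.sub_le b h.lt.le le_rfl

open Classical in
-- Each component loses at most C and has length at least L, so the loss per unit of time is at most
-- C / L.
theorem le_sum_neutralTimes (hα : 0 ≤ α) (hL : 0 < L) (hC : 0 ≤ C)
    (hS : ∀ t, S (t + 1) - S t = u t) (hu : ∀ t, u t ≤ C) (hmax : ∀ t ≤ n, S t ≤ S n) :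
    -(C / L * n) ≤ ∑ t ∈ Finset.range n with t ∈ neutralTimes S α L n, u t := by
  have hL' : (0 : ℝ) < L := by exact_mod_cast hL
  have key := sum_filter_le_of_components (ψ := fun t ↦ -u t) (D := C / L) (by positivity)
    (N := neutralTimes S α L n) (n := n) fun a b h ↦ ?_
  · rw [Finset.sum_neg_distrib] at key
    linarith
  have h1 : ∑ t ∈ Finset.Ico a b, -u t = -(S b - S a) := by
    rw [← Finset.sum_Ico_sub S h.lt.le, ← Finset.sum_neg_distrib]
    exact Finset.sum_congr rfl fun t _ ↦ by rw [hS t]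
  rw [h1]
  have h2 := h.le_sub hα hC (fun t ↦ (hS t).le.trans (hu t)) hmax
  have h3 : (L : ℝ) ≤ (b : ℝ) - a := by
    rw [← Nat.cast_sub h.lt.le]
    exact_mod_cast h.length_ge
  have h4 : C / L * L ≤ C / L * ((b : ℝ) - a) := by gcongr
  rw [div_mul_cancel₀ _ hL'.ne'] at h4
  linarith

open Classical in
-- Only the two ends of each component survive the telescoping, and components have length at least
-- L. This is the source of the almost invariance of the neutral part.
theorem sum_neutralTimes_telescope_le (hL : 0 < L) (hC : 0 ≤ C) (hu : ∀ t, |u t| ≤ C) :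
    ∑ t ∈ Finset.range n with t ∈ neutralTimes S α L n, (u (t + 1) - u t) ≤ 2 * C / L * n := by
  have hL' : (0 : ℝ) < L := by exact_mod_cast hL
  refine sum_filter_le_of_components (by positivity) fun a b h ↦ ?_
  rw [Finset.sum_Ico_sub u h.lt.le]
  have h3 : (L : ℝ) ≤ (b : ℝ) - a := by
    rw [← Nat.cast_sub h.lt.le]
    exact_mod_cast h.length_ge
  have h4 : 2 * C / L * L ≤ 2 * C / L * ((b : ℝ) - a) := by gcongr
  rw [div_mul_cancel₀ _ hL'.ne'] at h4
  have := (abs_le.1 (hu a)).1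
  have := (abs_le.1 (hu b)).2
  linarith

end NeutralTimes

/-! ### Empirical measures as finite sums -/

section Empirical

variable {M : Type*} [TopologicalSpace M] [ChartedSpace Plane M] [IsManifold (𝓡 2) ∞ M]

theorem integral_smul_sum_pointMass (c : ℝ≥0) (s : Finset ℕ) (ζ : ℕ → ProjTangent M)
    {g : ProjTangent M → ℝ} (hg : Continuous g) :
    ∫ z, g z ∂((c • ∑ i ∈ s, pointMass (ζ i) : FiniteMeasure (ProjTangent M)) :
      Measure (ProjTangent M)) = c * ∑ i ∈ s, g (ζ i) := by
  rw [FiniteMeasure.toMeasure_smul, FiniteMeasure.toMeasure_sum, integral_smul_nnreal_measure,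
    integral_finsetSum_measure]
  · simp only [pointMass, FiniteMeasure.toMeasure_mk]
    rw [NNReal.smul_def, smul_eq_mul]
    congr 1
    exact Finset.sum_congr rfl fun i _ ↦ integral_dirac' _ _ hg.stronglyMeasurable
  · intro i _
    exact (integrable_dirac' hg.stronglyMeasurable (by simp))

theorem lintegral_smul_sum_pointMass (c : ℝ≥0) (s : Finset ℕ) (ζ : ℕ → ProjTangent M)
    {g : ProjTangent M → ℝ≥0} (hg : Continuous g) :
    ∫⁻ z, g z ∂((c • ∑ i ∈ s, pointMass (ζ i) : FiniteMeasure (ProjTangent M)) :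
      Measure (ProjTangent M)) = c * ∑ i ∈ s, (g (ζ i) : ENNReal) := by
  rw [FiniteMeasure.toMeasure_smul, FiniteMeasure.toMeasure_sum, lintegral_smul_measure,
    lintegral_finsetSum_measure]
  simp only [pointMass, FiniteMeasure.toMeasure_mk]
  rw [ENNReal.smul_def, smul_eq_mul]
  congr 1
  exact Finset.sum_congr rfl fun i _ ↦ lintegral_dirac' _ (by fun_prop)

variable [RiemannianBundle (fun x : M ↦ TangentSpace (𝓡 2) x)]

/-- Monotonicity in the thresholds is what allows countably many of them to control all small α and
large L in a neutral decomposition. -/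
theorem neutralSet_mono (f : Diffeomorph (𝓡 2) (𝓡 2) M M ∞) {α α' : ℝ} {L L' : ℕ} (hα : α ≤ α')
    (hL : L' ≤ L) (n : ℕ) (ξ : ProjTangent M) :
    neutralSet f α L n ξ ⊆ neutralSet f α' L' n ξ := by
  rintro ζ ⟨a, ℓ, h1, h2, h3, h4⟩
  refine ⟨a, ℓ, hL.trans h1, h2, fun i hi hi' ↦ (h3 i hi hi').trans ?_, h4⟩
  gcongr

theorem lintegral_neutralPart_mono (f : Diffeomorph (𝓡 2) (𝓡 2) M M ∞) {α α' : ℝ} {L L' : ℕ}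
    (hα : α ≤ α') (hL : L' ≤ L) (n : ℕ) (ξ : ProjTangent M) {g : ProjTangent M → ℝ≥0}
    (hg : Continuous g) :
    ∫⁻ z, g z ∂(neutralPart f α L n ξ : Measure (ProjTangent M)) ≤
      ∫⁻ z, g z ∂(neutralPart f α' L' n ξ : Measure (ProjTangent M)) := by
  classical
  rw [neutralPart, neutralPart, lintegral_smul_sum_pointMass _ _ _ hg,
    lintegral_smul_sum_pointMass _ _ _ hg]
  gcongr
  exact fun i hi ↦ neutralSet_mono f hα hL n ξ hi

theorem lintegral_nonNeutralPart_mono (f : Diffeomorph (𝓡 2) (𝓡 2) M M ∞) {α α' : ℝ} {L L' : ℕ}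
    (hα : α ≤ α') (hL : L' ≤ L) (n : ℕ) (ξ : ProjTangent M) {g : ProjTangent M → ℝ≥0}
    (hg : Continuous g) :
    ∫⁻ z, g z ∂(nonNeutralPart f α' L' n ξ : Measure (ProjTangent M)) ≤
      ∫⁻ z, g z ∂(nonNeutralPart f α L n ξ : Measure (ProjTangent M)) := by
  classical
  rw [nonNeutralPart, nonNeutralPart, lintegral_smul_sum_pointMass _ _ _ hg,
    lintegral_smul_sum_pointMass _ _ _ hg]
  gcongr
  exact neutralSet_mono f hα hL n ξ

theorem mass_empirical (f : Diffeomorph (𝓡 2) (𝓡 2) M M ∞) {n : ℕ} (hn : 0 < n)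
    (ξ : ProjTangent M) : (empirical f n ξ).mass = 1 := by
  change ((n : ℝ≥0)⁻¹ • ∑ i ∈ Finset.range n, pointMass ((lift f)^[i] ξ)) Set.univ = _
  rw [FiniteMeasure.smul_apply, smul_eq_mul]
  change (n : ℝ≥0)⁻¹ * (∑ i ∈ Finset.range n, pointMass ((lift f)^[i] ξ)).mass = _
  rw [mass_sum]
  have hn' : (n : ℝ≥0) ≠ 0 := by exact_mod_cast hn.ne'
  simp [pointMass_mass, hn']

/-- The Birkhoff sums along the orbit of `ξ` up to time `t`. -/
def orbitSum (f : Diffeomorph (𝓡 2) (𝓡 2) M M ∞) (ξ : ProjTangent M) (t : ℕ) : ℝ :=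
  birkhoffSum (lift f) (phi f) t ξ

theorem orbitSum_succ_sub (f : Diffeomorph (𝓡 2) (𝓡 2) M M ∞) (ξ : ProjTangent M) (t : ℕ) :
    orbitSum f ξ (t + 1) - orbitSum f ξ t = phi f ((lift f)^[t] ξ) := by
  rw [orbitSum, orbitSum, birkhoffSum_succ, add_sub_cancel_left]

theorem orbitSum_add_sub (f : Diffeomorph (𝓡 2) (𝓡 2) M M ∞) (ξ : ProjTangent M) (a i : ℕ) :
    orbitSum f ξ (a + i) - orbitSum f ξ a = birkhoffSum (lift f) (phi f) i ((lift f)^[a] ξ) := by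
  rw [orbitSum, orbitSum, birkhoffSum_add, add_sub_cancel_left]

theorem iterate_lift_injective (f : Diffeomorph (𝓡 2) (𝓡 2) M M ∞) {ξ : ProjTangent M}
    (hξ : ξ.pt ∉ Function.periodicPts f) : Function.Injective fun i ↦ (lift f)^[i] ξ := by
  have key : ∀ i j, i < j → (lift f)^[i] ξ ≠ (lift f)^[j] ξ := by
    intro i j hij h
    have h1 := congrArg ProjTangent.pt h
    rw [iterate_lift_pt, iterate_lift_pt, ← Nat.add_sub_cancel' hij.le, Function.iterate_add_apply] at h1
    apply hξ
    exact ⟨j - i, by omega, (f.injective.iterate i h1).symm⟩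
  intro i j h
  rcases lt_trichotomy i j with hij | hij | hij
  · exact absurd h (key i j hij)
  · exact hij
  · exact absurd h.symm (key j i hij)

/-- The neutral part is defined through points and the combinatorics through times. The two agree
because a non-periodic orbit visits each point once; this is the role of the exclusion of periodic
points from the good sets. -/
theorem iterate_mem_neutralSet_iff (f : Diffeomorph (𝓡 2) (𝓡 2) M M ∞) {ξ : ProjTangent M}
    (hξ : ξ.pt ∉ Function.periodicPts f) {α : ℝ} {L n t : ℕ} :
    (lift f)^[t] ξ ∈ neutralSet f α L n ξ ↔ t ∈ neutralTimes (orbitSum f ξ) α L n := by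
  constructor
  · rintro ⟨a, ℓ, h1, h2, h3, j, hj, h4⟩
    have : t = a + j := iterate_lift_injective f hξ h4
    subst this
    exact ⟨a, ℓ, h1, h2, fun i hi hi' ↦ by rw [orbitSum_add_sub]; exact h3 i hi hi', by omega,
      by omega⟩
  · rintro ⟨a, ℓ, h1, h2, h3, h4, h5⟩
    refine ⟨a, ℓ, h1, h2, fun i hi hi' ↦ by rw [← orbitSum_add_sub]; exact h3 i hi hi', t - a,
      by omega, ?_⟩
    rw [Nat.add_sub_cancel' h4]

theorem integral_neutralPart_le (f : Diffeomorph (𝓡 2) (𝓡 2) M M ∞)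
    [IsContinuousRiemannianBundle Plane (fun x : M ↦ TangentSpace (𝓡 2) x)] {ξ : ProjTangent M}
    (hξ : ξ.pt ∉ Function.periodicPts f) {α : ℝ} (hα : 0 ≤ α) (L n : ℕ) :
    ∫ z, phi f z ∂(neutralPart f α L n ξ : Measure (ProjTangent M)) ≤ α := by
  classical
  rw [neutralPart, integral_smul_sum_pointMass _ _ _ (continuous_phi f)]
  simp only [iterate_mem_neutralSet_iff f hξ]
  have h := sum_neutralTimes_le (n := n) (L := L) hα (orbitSum_succ_sub f ξ)
  rcases Nat.eq_zero_or_pos n with rfl | hn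
  · simpa using hα
  have hn' : (0 : ℝ) < n := by exact_mod_cast hn
  push_cast
  rw [inv_mul_le_iff₀ hn', mul_comm]
  exact h

theorem le_integral_neutralPart (f : Diffeomorph (𝓡 2) (𝓡 2) M M ∞)
    [IsContinuousRiemannianBundle Plane (fun x : M ↦ TangentSpace (𝓡 2) x)] {ξ : ProjTangent M}
    (hξ : ξ.pt ∉ Function.periodicPts f) {α C : ℝ} (hα : 0 ≤ α) (hC0 : 0 ≤ C)
    (hC : ∀ ζ : ProjTangent M, |phi f ζ| ≤ C) {L n : ℕ} (hL : 0 < L)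
    (hmax : ∀ j ≤ n, birkhoffSum (lift f) (phi f) j ξ ≤ birkhoffSum (lift f) (phi f) n ξ) :
    -(C / L) ≤ ∫ z, phi f z ∂(neutralPart f α L n ξ : Measure (ProjTangent M)) := by
  classical
  rw [neutralPart, integral_smul_sum_pointMass _ _ _ (continuous_phi f)]
  simp only [iterate_mem_neutralSet_iff f hξ]
  have h := le_sum_neutralTimes (n := n) hα hL hC0 (orbitSum_succ_sub f ξ)
    (fun t ↦ (abs_le.1 (hC _)).2) hmax
  rcases Nat.eq_zero_or_pos n with rfl | hn
  · simp
    positivity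
  have hn' : (0 : ℝ) < n := by exact_mod_cast hn
  push_cast
  rw [le_inv_mul_iff₀ hn']
  linarith

theorem abs_integral_comp_lift_sub_neutralPart_le (f : Diffeomorph (𝓡 2) (𝓡 2) M M ∞)
    {ξ : ProjTangent M} (hξ : ξ.pt ∉ Function.periodicPts f) {α C : ℝ} (hC0 : 0 ≤ C)
    {g : ProjTangent M → ℝ} (hg : Continuous g) (hC : ∀ ζ, |g ζ| ≤ C) {L n : ℕ} (hL : 0 < L) :
    |∫ z, g (lift f z) ∂(neutralPart f α L n ξ : Measure (ProjTangent M)) -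
      ∫ z, g z ∂(neutralPart f α L n ξ : Measure (ProjTangent M))| ≤ 2 * C / L := by
  classical
  have key : ∀ g : ProjTangent M → ℝ, Continuous g → (∀ ζ, |g ζ| ≤ C) →
      ∫ z, g (lift f z) ∂(neutralPart f α L n ξ : Measure (ProjTangent M)) -
      ∫ z, g z ∂(neutralPart f α L n ξ : Measure (ProjTangent M)) ≤ 2 * C / L := by
    intro g hg hC
    rw [neutralPart, integral_smul_sum_pointMass _ _ _ hg,
      integral_smul_sum_pointMass _ _ _ (g := fun z ↦ g (lift f z)) (hg.comp (continuous_lift f)),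
      ← mul_sub, ← Finset.sum_sub_distrib]
    simp only [iterate_mem_neutralSet_iff f hξ, ← Function.iterate_succ_apply' (lift f)]
    have h := sum_neutralTimes_telescope_le (S := orbitSum f ξ) (α := α) (n := n) hL hC0
      (u := fun t ↦ g ((lift f)^[t] ξ)) fun t ↦ hC _
    rcases Nat.eq_zero_or_pos n with rfl | hn
    · simp
      positivity
    have hn' : (0 : ℝ) < n := by exact_mod_cast hn
    push_cast
    rw [inv_mul_le_iff₀ hn', mul_comm]
    exact h
  rw [abs_le]
  constructor
  · have := key (fun z ↦ -g z) hg.neg (fun ζ ↦ by simpa using hC ζ)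
    rw [integral_neg, integral_neg] at this
    linarith
  · exact key g hg hC

theorem abs_integral_comp_lift_sub_empirical_le (f : Diffeomorph (𝓡 2) (𝓡 2) M M ∞)
    (ξ : ProjTangent M) {C : ℝ} {g : ProjTangent M → ℝ} (hg : Continuous g)
    (hC : ∀ ζ, |g ζ| ≤ C) (n : ℕ) :
    |∫ z, g (lift f z) ∂(empirical f n ξ : Measure (ProjTangent M)) -
      ∫ z, g z ∂(empirical f n ξ : Measure (ProjTangent M))| ≤ 2 * C / n := by
  rw [empirical, integral_smul_sum_pointMass _ _ _ hg,
    integral_smul_sum_pointMass _ _ _ (g := fun z ↦ g (lift f z)) (hg.comp (continuous_lift f)),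
    ← mul_sub, ← Finset.sum_sub_distrib]
  simp only [← Function.iterate_succ_apply' (lift f)]
  rw [Finset.sum_range_sub (fun t ↦ g ((lift f)^[t] ξ)), abs_mul, div_eq_inv_mul]
  push_cast
  rw [abs_of_nonneg (by positivity : (0 : ℝ) ≤ (n : ℝ)⁻¹)]
  gcongr
  have h1 := abs_le.1 (hC ((lift f)^[n] ξ))
  have h2 := abs_le.1 (hC ((lift f)^[0] ξ))
  exact abs_le.2 ⟨by linarith, by linarith⟩

/-- Points of the orbit that start, `j` steps earlier, a long neutral segment are neutral. -/
theorem integral_nonNeutralPart_le (f : Diffeomorph (𝓡 2) (𝓡 2) M M ∞) (ξ : ProjTangent M)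
    {α : ℝ} {L : ℕ} (hL : 0 < L) (n j : ℕ) {g : ProjTangent M → ℝ} (hg : Continuous g)
    (hg0 : ∀ ζ, 0 ≤ g ζ) (hg1 : ∀ ζ, g ζ ≤ 1)
    (hsupp : ∀ ζ, g ((lift f)^[j] ζ) ≠ 0 → IsNeutral f α (L + j) ζ) :
    ∫ z, g z ∂(nonNeutralPart f α L n ξ : Measure (ProjTangent M)) ≤ ((j : ℝ) + L) / n := by
  classical
  rw [nonNeutralPart, integral_smul_sum_pointMass _ _ _ hg, div_eq_inv_mul]
  push_cast
  gcongr
  -- At a time t with j ≤ t < n - L, the segment of length L + j starting at t - j fits into [0, n)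
  -- and contains t. So only the first j and the last L times can contribute.
  calc ∑ i ∈ Finset.range n with (lift f)^[i] ξ ∉ neutralSet f α L n ξ, g ((lift f)^[i] ξ)
      ≤ ∑ i ∈ Finset.range j ∪ Finset.Ico (n - L) n, g ((lift f)^[i] ξ) := by
        rw [← Finset.sum_filter_ne_zero]
        refine Finset.sum_le_sum_of_subset_of_nonneg ?_ fun i _ _ ↦ hg0 _
        intro t ht
        simp only [Finset.mem_filter, Finset.mem_range] at ht
        simp only [Finset.mem_union, Finset.mem_range, Finset.mem_Ico]
        by_contra hnot
        apply ht.1.2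
        refine ⟨t - j, L + j, by omega, by omega, hsupp _ ?_, j, by omega, ?_⟩
        · rw [← Function.iterate_add_apply, Nat.add_sub_cancel' (by omega)]
          exact ht.2
        · rw [Nat.sub_add_cancel (by omega)]
    _ ≤ ∑ _i ∈ Finset.range j ∪ Finset.Ico (n - L) n, (1 : ℝ) :=
        Finset.sum_le_sum fun i _ ↦ hg1 _
    _ ≤ (j : ℝ) + L := by
        rw [Finset.sum_const, nsmul_eq_mul, mul_one]
        have h1 := Finset.card_union_le (Finset.range j) (Finset.Ico (n - L) n)
        rw [Finset.card_range, Nat.card_Ico] at h1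
        exact_mod_cast h1.trans (by omega)

end Empirical

/-! ### Weak limits -/

section WeakLimits

variable {X : Type*} [TopologicalSpace X] [MeasurableSpace X] [BorelSpace X]

theorem tendsto_integral_of_continuous [CompactSpace X] {ι : Type*} {l : Filter ι}
    {μs : ι → FiniteMeasure X} {μ : FiniteMeasure X} (h : Tendsto μs l (𝓝 μ)) {g : X → ℝ}
    (hg : Continuous g) :
    Tendsto (fun i ↦ ∫ x, g x ∂(μs i : Measure X)) l (𝓝 (∫ x, g x ∂(μ : Measure X))) :=
  FiniteMeasure.tendsto_iff_forall_integral_tendsto.1 h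
    (BoundedContinuousFunction.mkOfCompact ⟨g, hg⟩)

variable [TopologicalSpace.PseudoMetrizableSpace X]

/-- Closed sets are approximated from outside by continuous functions, and measurable sets from
inside by closed sets. -/
theorem measure_le_of_forall_lintegral_le {μ ν : Measure X} [IsFiniteMeasure μ] [IsFiniteMeasure ν]
    (h : ∀ g : BoundedContinuousFunction X ℝ≥0, ∫⁻ x, g x ∂μ ≤ ∫⁻ x, g x ∂ν) : μ ≤ ν := by
  have hclosed : ∀ F : Set X, IsClosed F → μ F ≤ ν F := fun F hF ↦
    le_of_tendsto_of_tendsto' (HasOuterApproxClosed.tendsto_lintegral_apprSeq hF μ)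
      (HasOuterApproxClosed.tendsto_lintegral_apprSeq hF ν) fun n ↦ h _
  refine Measure.le_iff.2 fun s hs ↦ ?_
  rw [hs.measure_eq_iSup_isClosed_of_ne_top (measure_ne_top μ s)]
  refine iSup₂_le fun K hK ↦ iSup_le fun hKc ↦ (hclosed K hKc).trans (measure_mono hK)

theorem measurePreserving_of_forall_integral_comp {μ : Measure X} [IsFiniteMeasure μ] {T : X → X}
    (hT : Continuous T)
    (h : ∀ g : BoundedContinuousFunction X ℝ, ∫ x, g (T x) ∂μ = ∫ x, g x ∂μ) :
    MeasurePreserving T μ μ := by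
  refine ⟨hT.measurable, ?_⟩
  refine ext_of_forall_integral_eq_of_IsFiniteMeasure fun g ↦ ?_
  rw [integral_map hT.measurable.aemeasurable g.continuous.measurable.aestronglyMeasurable, h]

end WeakLimits

/-! ### Points with nonpositive exponent and points all of whose Birkhoff sums are small -/

section Covering

variable {X : Type*} [MeasurableSpace X]

/-- The sequence S_n - α n vanishes at 0 and is eventually negative, so it attains its maximum at
some m; from T^m x onwards the sums never exceed α i. -/
theorem exists_iterate_forall_birkhoffSum_le {T : X → X} {g : X → ℝ} {C : ℝ} (hC : ∀ x, |g x| ≤ C)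
    {x : X} (hx : limsup (fun n : ℕ ↦ 1 / (n : ℝ) * birkhoffSum T g n x) atTop ≤ 0)
    {α : ℝ} (hα : 0 < α) : ∃ m, ∀ i, 0 < i → birkhoffSum T g i (T^[m] x) ≤ α * i := by
  have h1 := eventually_lt_of_limsup_lt (hx.trans_lt hα) (isBoundedUnder_le_average hC x)
  obtain ⟨N, hN⟩ := eventually_atTop.1 h1
  obtain ⟨m, hm, hmax⟩ := Finset.exists_max_image (Finset.range (N + 1))
    (fun n ↦ birkhoffSum T g n x - α * n) ⟨0, by simp⟩
  have hglob : ∀ n, birkhoffSum T g n x - α * n ≤ birkhoffSum T g m x - α * m := by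
    intro n
    by_cases hn : n ≤ N
    · exact hmax n (by simp; omega)
    · have h0 := hmax 0 (by simp)
      simp only [birkhoffSum_zero, Nat.cast_zero, mul_zero, sub_zero] at h0
      have h2 := hN n (by omega)
      have hn' : (0 : ℝ) < n := by exact_mod_cast (by omega : 0 < n)
      rw [one_div, inv_mul_lt_iff₀ hn'] at h2
      linarith
  refine ⟨m, fun i _ ↦ ?_⟩
  have h2 := hglob (m + i)
  rw [birkhoffSum_add] at h2
  push_cast at h2
  linarith

/-- Almost every point whose averages are asymptotically nonpositive is in the forward orbit of a
point all of whose Birkhoff sums are small. -/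
theorem ae_exists_preimage_forall_birkhoffSum_le (T : X ≃ᵐ X) {μ : Measure X} [IsFiniteMeasure μ]
    (hT : MeasurePreserving T μ μ) {g : X → ℝ} {C : ℝ} (hg : Measurable g) (hC : ∀ x, |g x| ≤ C)
    {α : ℝ} (hα : 0 < α) :
    ∀ᵐ x ∂μ, limsup (fun n : ℕ ↦ 1 / (n : ℝ) * birkhoffSum T g n x) atTop ≤ 0 →
      ∃ j, ∃ y, T^[j] y = x ∧ ∀ i, 0 < i → birkhoffSum T g i y ≤ α * i := by
  let H : Set X := {y | ∀ i, 0 < i → birkhoffSum T g i y ≤ α * i}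
  have hH : MeasurableSet H := by
    have : H = ⋂ i : ℕ, ⋂ _ : 0 < i, {y | birkhoffSum T g i y ≤ α * i} := by
      ext y
      simp [H]
    rw [this]
    exact MeasurableSet.iInter fun i ↦ MeasurableSet.iInter fun _ ↦
      measurableSet_le (measurable_birkhoffSum T.measurable hg i) measurable_const
  let W : Set X := ⋃ j : ℕ, (T.symm)^[j] ⁻¹' H
  have hW : MeasurableSet W :=
    MeasurableSet.iUnion fun j ↦ (T.symm.measurable.iterate j) hH
  have hsub : ∀ m, W ⊆ T^[m] ⁻¹' W := by
    intro m x hx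
    obtain ⟨j, hj⟩ := Set.mem_iUnion.1 hx
    refine Set.mem_iUnion.2 ⟨j + m, ?_⟩
    change (T.symm)^[j + m] (T^[m] x) ∈ H
    rw [Function.iterate_add_apply,
      (Function.LeftInverse.iterate (f := T) (g := T.symm) T.symm_apply_apply m) x]
    exact hj
  -- `W`, the union of the forward images of `H`, is contained in each of its preimages, which have
  -- the same finite measure. A point with a later iterate in `H` is therefore almost surely already
  -- in `W`.
  have hnull : ∀ m, μ (T^[m] ⁻¹' W \ W) = 0 := by
    intro m
    rw [measure_sdiff (hsub m) hW.nullMeasurableSet (measure_ne_top _ _),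
      (hT.iterate m).measure_preimage hW.nullMeasurableSet, tsub_self]
  filter_upwards [measure_eq_zero_iff_ae_notMem.1 (measure_iUnion_null hnull)] with x hx hlim
  obtain ⟨m, hm⟩ := exists_iterate_forall_birkhoffSum_le hC hlim hα
  have hxW : x ∈ W := by
    by_contra hxW
    apply hx
    exact Set.mem_iUnion.2 ⟨m, Set.mem_iUnion.2 ⟨0, hm⟩, hxW⟩
  obtain ⟨j, hj⟩ := Set.mem_iUnion.1 hxW
  exact ⟨j, (T.symm)^[j] x,
    (Function.LeftInverse.iterate (f := T.symm) (g := T) T.apply_symm_apply j) x, hj⟩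

end Covering

/-! ### Existence of neutral decompositions -/

section NeutralDecomposition

variable {M : Type*} [TopologicalSpace M] [ChartedSpace Plane M] [IsManifold (𝓡 2) ∞ M]
  [T2Space M] [CompactSpace M] [TopologicalSpace.MetrizableSpace (ProjTangent M)]

/-- The auxiliary ν only serves when m = 0: there is nothing to normalize, and any invariant
probability measure will do. -/
theorem exists_probabilityMeasure_eq_mass_smul (f : Diffeomorph (𝓡 2) (𝓡 2) M M ∞)
    (ν : ProbabilityMeasure (ProjTangent M))
    (hν : MeasurePreserving (lift f) (ν : Measure (ProjTangent M)) ν)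
    (m : FiniteMeasure (ProjTangent M))
    (hm : MeasurePreserving (lift f) (m : Measure (ProjTangent M)) m) :
    ∃ μ : ProbabilityMeasure (ProjTangent M),
      MeasurePreserving (lift f) (μ : Measure (ProjTangent M)) μ ∧ m = m.mass • μ.toFiniteMeasure := by
  by_cases h0 : m = 0
  · exact ⟨ν, hν, by simp [h0]⟩
  · have : Nonempty (ProjTangent M) := by
      by_contra hemp
      rw [not_nonempty_iff] at hemp
      apply h0
      rw [← FiniteMeasure.mass_zero_iff]
      simp [FiniteMeasure.mass, Set.univ_eq_empty_iff.2 hemp]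
    refine ⟨m.normalize, ?_, m.self_eq_mass_smul_normalize⟩
    rw [FiniteMeasure.toMeasure_normalize_eq_of_nonzero _ h0]
    exact hm.smul_measure _

variable [RiemannianBundle (fun x : M ↦ TangentSpace (𝓡 2) x)]
  [IsContinuousRiemannianBundle Plane (fun x : M ↦ TangentSpace (𝓡 2) x)]

/-- Because α' < α, the points in question have an open neighborhood on which the first L + j
Birkhoff sums are still α-neutral. A continuous function equal to one on the image set and
supported, up to zeros, in the image of this neighborhood has integral O(1/n) against the
non-neutral parts, hence integral zero in the limit. -/
theorem measure_image_forall_birkhoffSum_le_eq_zero (f : Diffeomorph (𝓡 2) (𝓡 2) M M ∞)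
    {n : ℕ → ℕ} (hn : Tendsto n atTop atTop) {ξ : ℕ → ProjTangent M} {α : ℝ} {L : ℕ}
    (hL : 0 < L) {b : FiniteMeasure (ProjTangent M)}
    (hb : Tendsto (fun k ↦ nonNeutralPart f α L (n k) (ξ k)) atTop (𝓝 b)) {α' : ℝ} (hα' : α' < α)
    (j : ℕ) :
    (b : Measure (ProjTangent M)) ((lift f)^[j] ''
      {η | ∀ i, 0 < i → birkhoffSum (lift f) (phi f) i η ≤ α' * i}) = 0 := by
  let H : Set (ProjTangent M) := {η | ∀ i, 0 < i → birkhoffSum (lift f) (phi f) i η ≤ α' * i}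
  let V : Set (ProjTangent M) := {η | ∀ i ∈ Finset.Icc 1 (L + j),
    birkhoffSum (lift f) (phi f) i η < α * i}
  have hH : IsClosed H := by
    have : H = ⋂ i : ℕ, ⋂ _ : 0 < i, {η | birkhoffSum (lift f) (phi f) i η ≤ α' * i} := by
      ext y
      simp [H]
    rw [this]
    exact isClosed_iInter fun i ↦ isClosed_iInter fun _ ↦
      isClosed_le (continuous_birkhoffSum_phi f i) continuous_const
  have hV : IsOpen V := by
    have : V = ⋂ i ∈ Finset.Icc 1 (L + j), {η | birkhoffSum (lift f) (phi f) i η < α * i} := by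
      ext y
      simp [V]
    rw [this]
    exact isOpen_biInter_finset fun i _ ↦
      isOpen_lt (continuous_birkhoffSum_phi f i) continuous_const
  have hHV : H ⊆ V := by
    intro η hη i hi
    rw [Finset.mem_Icc] at hi
    have hi' : (0 : ℝ) < i := by exact_mod_cast hi.1
    exact (hη i hi.1).trans_lt (mul_lt_mul_of_pos_right hα' hi')
  have hbij : Function.Bijective (lift f)^[j] := (liftHomeomorph f).bijective.iterate j
  have hclosed : IsClosedMap (lift f)^[j] :=
    ((continuous_lift f).iterate j).isClosedMap
  have hdisj : Disjoint ((lift f)^[j] '' Vᶜ) ((lift f)^[j] '' H) := by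
    rw [Set.disjoint_image_iff hbij.injective]
    exact Set.disjoint_left.2 fun η h1 h2 ↦ h1 (hHV h2)
  obtain ⟨g, hg0, hg1, hg01⟩ := exists_continuous_zero_one_of_isClosed
    (hclosed _ hV.isClosed_compl) (hclosed _ hH) hdisj
  have hle : ∀ k, ∫ z, g z ∂(nonNeutralPart f α L (n k) (ξ k) : Measure (ProjTangent M)) ≤
      ((j : ℝ) + L) / (n k : ℝ) := by
    intro k
    refine integral_nonNeutralPart_le f (ξ k) hL (n k) j g.continuous (fun ζ ↦ (hg01 ζ).1)
      (fun ζ ↦ (hg01 ζ).2) fun ζ hζ i hi hi' ↦ ?_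
    have hζV : ζ ∈ V := by
      by_contra hζV
      exact hζ (hg0 ⟨ζ, hζV, rfl⟩)
    exact (hζV i (Finset.mem_Icc.2 ⟨hi, hi'⟩)).le
  have hlim0 : Tendsto (fun k ↦ ((j : ℝ) + L) / (n k : ℝ)) atTop (𝓝 0) :=
    (tendsto_const_div_atTop_nhds_zero_nat _).comp hn
  have hint : ∫ z, g z ∂(b : Measure (ProjTangent M)) ≤ 0 :=
    le_of_tendsto_of_tendsto' (tendsto_integral_of_continuous hb g.continuous) hlim0 hle
  have hintg : Integrable (fun z ↦ g z) (b : Measure (ProjTangent M)) :=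
    integrable_of_abs_le (C := 1) g.continuous.measurable fun z ↦
      abs_le.2 ⟨by linarith [(hg01 z).1], (hg01 z).2⟩
  have hae := (integral_eq_zero_iff_of_nonneg (fun z ↦ (hg01 z).1) hintg).1
    (le_antisymm hint (integral_nonneg fun z ↦ (hg01 z).1))
  refine measure_mono_null ?_ (ae_iff.1 hae)
  intro z hz h0
  have := hg1 hz
  rw [h0] at this
  exact zero_ne_one this

/-- Two successive limits: `a i`, `b i` are the limits in time at the threshold (1/(i+1), i+1), and
`a'`, `b'` their limits as i grows. Since `a i` decreases and `b i` increases with i when tested on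
nonnegative functions, the second limit does not depend on the thresholds used. The decomposition is
obtained by normalizing `a'` and `b'`, with β the mass of `b'`. -/
theorem exists_isNeutralDecomposition [FirstCountableTopology (FiniteMeasure (ProjTangent M))]
    (f : Diffeomorph (𝓡 2) (𝓡 2) M M ∞) {n : ℕ → ℕ} (hn : Tendsto n atTop atTop)
    {ξ : ℕ → ProjTangent M} (hper : ∀ k, (ξ k).pt ∉ Function.periodicPts f)
    (hmax : ∀ k, ∀ j ≤ n k, birkhoffSum (lift f) (phi f) j (ξ k) ≤
      birkhoffSum (lift f) (phi f) (n k) (ξ k)) :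
    ∃ κ : ℕ → ℕ, StrictMono κ ∧ ∃ β μ₀ μ₁,
      IsNeutralDecomposition f (n ∘ κ) (ξ ∘ κ) β μ₀ μ₁ := by
  obtain ⟨C, hC0, hC⟩ := exists_abs_phi_le f
  let α : ℕ → ℝ := fun k ↦ 1 / ((k : ℝ) + 1)
  have hα : ∀ k, 0 < α k := fun k ↦ Nat.one_div_pos_of_nat
  have hαanti : Antitone α := fun i j hij ↦ Nat.one_div_le_one_div hij
  have hαlim : Tendsto α atTop (𝓝 0) := tendsto_one_div_add_atTop_nhds_zero_nat
  let K : Set (FiniteMeasure (ProjTangent M)) := {ν | ν.mass ≤ 1}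
  have hK : IsCompact K := isCompact_setOfPred_finiteMeasure_le_of_compactSpace _ 1
  -- convergence along a subsequence of the times
  obtain ⟨⟨a, b⟩, -, κ, hκ, hlim⟩ := ((isCompact_univ_pi fun _ : ℕ ↦ hK).prod
    (isCompact_univ_pi fun _ : ℕ ↦ hK)).tendsto_subseq
    (x := fun k ↦ ((fun i ↦ neutralPart f (α i) (i + 1) (n k) (ξ k)),
      (fun i ↦ nonNeutralPart f (α i) (i + 1) (n k) (ξ k))))
    (fun k ↦ ⟨fun i _ ↦ mass_neutralPart_le f _ _ _ _, fun i _ ↦ mass_nonNeutralPart_le f _ _ _ _⟩)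
  have hκn : Tendsto (n ∘ κ) atTop atTop := hn.comp hκ.tendsto_atTop
  have ha : ∀ i, Tendsto (fun k ↦ neutralPart f (α i) (i + 1) (n (κ k)) (ξ (κ k))) atTop (𝓝 (a i)) :=
    fun i ↦ tendsto_pi_nhds.1 ((continuous_fst.tendsto _).comp hlim) i
  have hb : ∀ i, Tendsto (fun k ↦ nonNeutralPart f (α i) (i + 1) (n (κ k)) (ξ (κ k))) atTop
      (𝓝 (b i)) := fun i ↦ tendsto_pi_nhds.1 ((continuous_snd.tendsto _).comp hlim) i
  have hsum : ∀ i, Tendsto (fun k ↦ empirical f (n (κ k)) (ξ (κ k))) atTop (𝓝 (a i + b i)) := by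
    intro i
    refine ((ha i).add (hb i)).congr fun k ↦ ?_
    exact neutralPart_add_nonNeutralPart f _ _ _ _
  have hlint : ∀ {u : ℕ → FiniteMeasure (ProjTangent M)} {v : FiniteMeasure (ProjTangent M)},
      Tendsto u atTop (𝓝 v) → ∀ g : BoundedContinuousFunction (ProjTangent M) ℝ≥0,
      Tendsto (fun k ↦ ∫⁻ z, g z ∂(u k : Measure (ProjTangent M))) atTop
        (𝓝 (∫⁻ z, g z ∂(v : Measure (ProjTangent M)))) := fun h ↦
    FiniteMeasure.tendsto_iff_forall_lintegral_tendsto.1 h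
  have ha_mono : ∀ i j, i ≤ j → ∀ g : BoundedContinuousFunction (ProjTangent M) ℝ≥0,
      ∫⁻ z, g z ∂(a j : Measure (ProjTangent M)) ≤ ∫⁻ z, g z ∂(a i : Measure (ProjTangent M)) :=
    fun i j hij g ↦ le_of_tendsto_of_tendsto' (hlint (ha j) g) (hlint (ha i) g) fun k ↦
      lintegral_neutralPart_mono f (hαanti hij) (by omega) _ _ g.continuous
  have hb_mono : ∀ i j, i ≤ j → ∀ g : BoundedContinuousFunction (ProjTangent M) ℝ≥0,
      ∫⁻ z, g z ∂(b i : Measure (ProjTangent M)) ≤ ∫⁻ z, g z ∂(b j : Measure (ProjTangent M)) :=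
    fun i j hij g ↦ le_of_tendsto_of_tendsto' (hlint (hb i) g) (hlint (hb j) g) fun k ↦
      lintegral_nonNeutralPart_mono f (hαanti hij) (by omega) _ _ g.continuous
  have hmassK : ∀ {u : ℕ → FiniteMeasure (ProjTangent M)} {v : FiniteMeasure (ProjTangent M)},
      Tendsto u atTop (𝓝 v) → (∀ k, u k ∈ K) → v ∈ K := fun h hu ↦
    le_of_tendsto' h.mass hu
  -- convergence as the thresholds become more restrictive
  obtain ⟨⟨a', b'⟩, -, τ, hτ, hlim'⟩ := (hK.prod hK).tendsto_subseq (x := fun i ↦ (a i, b i))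
    (fun i ↦ ⟨hmassK (ha i) fun k ↦ mass_neutralPart_le f _ _ _ _,
      hmassK (hb i) fun k ↦ mass_nonNeutralPart_le f _ _ _ _⟩)
  have ha' : Tendsto (fun i ↦ a (τ i)) atTop (𝓝 a') := (continuous_fst.tendsto _).comp hlim'
  have hb' : Tendsto (fun i ↦ b (τ i)) atTop (𝓝 b') := (continuous_snd.tendsto _).comp hlim'
  have ha'_le : ∀ i, ∀ g : BoundedContinuousFunction (ProjTangent M) ℝ≥0,
      ∫⁻ z, g z ∂(a' : Measure (ProjTangent M)) ≤ ∫⁻ z, g z ∂(a i : Measure (ProjTangent M)) := by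
    intro i g
    refine le_of_tendsto (hlint ha' g) ?_
    filter_upwards [eventually_ge_atTop i] with j hj
    exact ha_mono i (τ j) (hj.trans (hτ.id_le j)) g
  have hb'_ge : ∀ i, ∀ g : BoundedContinuousFunction (ProjTangent M) ℝ≥0,
      ∫⁻ z, g z ∂(b i : Measure (ProjTangent M)) ≤ ∫⁻ z, g z ∂(b' : Measure (ProjTangent M)) := by
    intro i g
    refine ge_of_tendsto (hlint hb' g) ?_
    filter_upwards [eventually_ge_atTop i] with j hj
    exact hb_mono i (τ j) (hj.trans (hτ.id_le j)) g
  have hsum' : Tendsto (fun k ↦ empirical f (n (κ k)) (ξ (κ k))) atTop (𝓝 (a' + b')) := by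
    have h1 : ∀ i, a i + b i = a 0 + b 0 := fun i ↦ tendsto_nhds_unique (hsum i) (hsum 0)
    have h2 : a' + b' = a 0 + b 0 :=
      tendsto_nhds_unique (ha'.add hb') (tendsto_const_nhds.congr fun i ↦ (h1 (τ i)).symm)
    rw [h2]
    exact hsum 0
  have hmass : a'.mass + b'.mass = 1 := by
    have h1 : (a' + b').mass = 1 := by
      refine tendsto_nhds_unique hsum'.mass (tendsto_const_nhds.congr' ?_)
      filter_upwards [hκn.eventually_gt_atTop 0] with k hk
      exact (mass_empirical f hk _).symm
    rw [← h1]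
    simp [FiniteMeasure.mass]
  -- invariance
  have hint : ∀ (m : FiniteMeasure (ProjTangent M)) {g : ProjTangent M → ℝ}, Continuous g →
      Integrable g (m : Measure (ProjTangent M)) := by
    intro m g hg
    obtain ⟨D, hD⟩ := isCompact_univ.exists_bound_of_continuousOn hg.continuousOn
    exact integrable_of_abs_le hg.measurable fun x ↦ hD x trivial
  have hLlim : ∀ D : ℝ, Tendsto (fun i ↦ D / ((τ i + 1 : ℕ) : ℝ)) atTop (𝓝 0) := fun D ↦
    (tendsto_const_div_atTop_nhds_zero_nat D).comp
      ((tendsto_add_atTop_nat 1).comp hτ.tendsto_atTop)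
  have hinva : MeasurePreserving (lift f) (a' : Measure (ProjTangent M)) a' := by
    refine measurePreserving_of_forall_integral_comp (continuous_lift f) fun g ↦ ?_
    have hgD : ∀ z, |g z| ≤ ‖g‖ := fun z ↦ g.norm_coe_le_norm z
    have hgl : Continuous fun z ↦ g (lift f z) := g.continuous.comp (continuous_lift f)
    have h1 : ∀ i, |∫ z, g (lift f z) ∂(a i : Measure (ProjTangent M)) -
        ∫ z, g z ∂(a i : Measure (ProjTangent M))| ≤ 2 * ‖g‖ / ((i + 1 : ℕ) : ℝ) := by
      intro i
      refine le_of_tendsto' ((tendsto_integral_of_continuous (ha i) hgl).sub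
        (tendsto_integral_of_continuous (ha i) g.continuous)).abs fun k ↦ ?_
      exact abs_integral_comp_lift_sub_neutralPart_le f (hper _) (norm_nonneg _) g.continuous hgD
        (Nat.succ_pos _)
    have h2 := le_of_tendsto_of_tendsto' ((tendsto_integral_of_continuous ha' hgl).sub
      (tendsto_integral_of_continuous ha' g.continuous)).abs (hLlim (2 * ‖g‖)) fun i ↦ h1 (τ i)
    rw [abs_nonpos_iff] at h2
    linarith
  have hinvab : MeasurePreserving (lift f)
      ((a' + b' : FiniteMeasure (ProjTangent M)) : Measure (ProjTangent M))
      (a' + b' : FiniteMeasure (ProjTangent M)) := by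
    refine measurePreserving_of_forall_integral_comp (continuous_lift f) fun g ↦ ?_
    have hgl : Continuous fun z ↦ g (lift f z) := g.continuous.comp (continuous_lift f)
    have h2 := le_of_tendsto_of_tendsto' ((tendsto_integral_of_continuous hsum' hgl).sub
      (tendsto_integral_of_continuous hsum' g.continuous)).abs
      ((tendsto_const_div_atTop_nhds_zero_nat (2 * ‖g‖)).comp hκn) fun k ↦
      abs_integral_comp_lift_sub_empirical_le f (ξ (κ k)) g.continuous
        (fun z ↦ g.norm_coe_le_norm z) (n (κ k))
    rw [abs_nonpos_iff] at h2
    linarith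
  -- The non-neutral part is handled by difference, as the full empirical measures and the neutral
  -- parts both have invariant limits.
  have hinvb : MeasurePreserving (lift f) (b' : Measure (ProjTangent M)) b' := by
    refine measurePreserving_of_forall_integral_comp (continuous_lift f) fun g ↦ ?_
    have hgl : Continuous fun z ↦ g (lift f z) := g.continuous.comp (continuous_lift f)
    have h1 : ∀ {h : ProjTangent M → ℝ}, Continuous h →
        ∫ z, h z ∂((a' + b' : FiniteMeasure (ProjTangent M)) : Measure (ProjTangent M)) =
        ∫ z, h z ∂(a' : Measure (ProjTangent M)) + ∫ z, h z ∂(b' : Measure (ProjTangent M)) := by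
      intro h hh
      rw [FiniteMeasure.toMeasure_add, integral_add_measure (hint _ hh) (hint _ hh)]
    have h2 : ∀ {m : FiniteMeasure (ProjTangent M)},
        MeasurePreserving (lift f) (m : Measure (ProjTangent M)) m →
        ∫ z, g (lift f z) ∂(m : Measure (ProjTangent M)) =
          ∫ z, g z ∂(m : Measure (ProjTangent M)) := by
      intro m hm
      have := integral_map hm.measurable.aemeasurable (f := g) (μ := (m : Measure (ProjTangent M)))
        g.continuous.measurable.aestronglyMeasurable
      rw [hm.map_eq] at this
      exact this.symm
    have h3 := h2 hinvab
    have h4 := h2 hinva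
    rw [h1 hgl, h1 g.continuous] at h3
    linarith
  -- the neutral part has zero exponent
  have hzero : ∫ z, phi f z ∂(a' : Measure (ProjTangent M)) = 0 := by
    have hφ := continuous_phi f
    refine le_antisymm ?_ ?_
    · refine le_of_tendsto_of_tendsto' (tendsto_integral_of_continuous ha' hφ)
        (hαlim.comp hτ.tendsto_atTop) fun i ↦ ?_
      exact le_of_tendsto' (tendsto_integral_of_continuous (ha (τ i)) hφ) fun k ↦
        integral_neutralPart_le f (hper _) (hα _).le _ _
    · have h1 := (hLlim C).neg
      rw [neg_zero] at h1
      refine le_of_tendsto_of_tendsto' h1 (tendsto_integral_of_continuous ha' hφ) fun i ↦ ?_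
      exact ge_of_tendsto' (tendsto_integral_of_continuous (ha (τ i)) hφ) fun k ↦
        le_integral_neutralPart f (hper _) (hα _).le hC0.le hC (Nat.succ_pos _) (hmax _)
  -- the other part has positive exponents
  let Z : Set (ProjTangent M) :=
    {ζ | limsup (fun m : ℕ ↦ 1 / (m : ℝ) * birkhoffSum (lift f) (phi f) m ζ) atTop ≤ 0}
  have hZ : MeasurableSet Z := measurableSet_le
    (measurable_limsup_average (continuous_lift f).measurable (continuous_phi f).measurable)
    measurable_const
  -- The covering of `Z` by forward images needs an invariant measure, so it is applied to `b'` and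
  -- transferred to `b i` by `b i ≤ b'`. The rate α_i / 2 leaves the slack required to see that `b
  -- i` does not charge these images.
  have hbZ : ∀ i, (b i : Measure (ProjTangent M)) Z = 0 := by
    intro i
    have hle : (b i : Measure (ProjTangent M)) ≤ b' :=
      measure_le_of_forall_lintegral_le (hb'_ge i)
    have hcov : ∀ᵐ ζ ∂(b' : Measure (ProjTangent M)),
        limsup (fun m : ℕ ↦ 1 / (m : ℝ) * birkhoffSum (lift f) (phi f) m ζ) atTop ≤ 0 →
        ∃ j, ∃ η, (lift f)^[j] η = ζ ∧
          ∀ l, 0 < l → birkhoffSum (lift f) (phi f) l η ≤ α i / 2 * l :=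
      ae_exists_preimage_forall_birkhoffSum_le (liftHomeomorph f).toMeasurableEquiv hinvb
        (continuous_phi f).measurable hC (half_pos (hα i))
    have hcov' := ae_mono hle hcov
    have hnull := measure_iUnion_null fun j ↦
      measure_image_forall_birkhoffSum_le_eq_zero f hκn (ξ := ξ ∘ κ) (Nat.succ_pos i) (hb i)
        (half_lt_self (hα i)) j
    refine measure_mono_null ?_ (measure_union_null (ae_iff.1 hcov') hnull)
    intro ζ hζ
    by_cases hex : ∃ j, ∃ η, (lift f)^[j] η = ζ ∧
          ∀ l, 0 < l → birkhoffSum (lift f) (phi f) l η ≤ α i / 2 * l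
    · right
      obtain ⟨j, η, h1, h2⟩ := hex
      exact Set.mem_iUnion.2 ⟨j, η, h2, h1⟩
    · left
      exact fun h ↦ hex (h hζ)
  -- Weak convergence says nothing about the measurable set `Z` directly. But `b i` lives on its
  -- complement and is dominated by `b'`, so the mass of `b i` is at most that of `b'` outside `Z`;
  -- the masses of `b (τ i)` converge to that of `b'`.
  have hb'Z : (b' : Measure (ProjTangent M)) Z = 0 := by
    have h1 : ∀ i, b' Z + (b i).mass ≤ b'.mass := by
      intro i
      have hle : (b i : Measure (ProjTangent M)) ≤ b' :=
        measure_le_of_forall_lintegral_le (hb'_ge i)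
      have h2 : (b i).mass ≤ b' Zᶜ := by
        rw [← ENNReal.coe_le_coe, FiniteMeasure.ennreal_mass,
          FiniteMeasure.ennreal_coeFn_eq_coeFn_toMeasure, ← measure_add_measure_compl hZ, hbZ i,
          zero_add]
        exact hle _
      have h3 : b' Z + b' Zᶜ = b'.mass := by
        rw [← ENNReal.coe_inj, ENNReal.coe_add, FiniteMeasure.ennreal_mass,
          FiniteMeasure.ennreal_coeFn_eq_coeFn_toMeasure,
          FiniteMeasure.ennreal_coeFn_eq_coeFn_toMeasure, measure_add_measure_compl hZ]
      rw [← h3]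
      gcongr
    have h4 : b' Z + b'.mass ≤ b'.mass :=
      le_of_tendsto' (tendsto_const_nhds.add hb'.mass) fun i ↦ h1 (τ i)
    have h5 : b' Z = 0 := by simpa using h4
    rwa [FiniteMeasure.null_iff_toMeasure_null] at h5
  have hpos : ∀ᵐ ζ ∂(b' : Measure (ProjTangent M)), ∃ l > (0 : ℝ),
      Tendsto (fun m : ℕ ↦ (1 / (m : ℝ)) * birkhoffSum (lift f) (phi f) m ζ) atTop (𝓝 l) := by
    filter_upwards [ae_exists_tendsto_average hinvb (continuous_phi f).measurable hC,
      measure_eq_zero_iff_ae_notMem.1 hb'Z] with ζ ⟨l, hl⟩ hζ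
    refine ⟨l, ?_, hl⟩
    by_contra hle
    exact hζ (show limsup (fun m : ℕ ↦ 1 / (m : ℝ) * birkhoffSum (lift f) (phi f) m ζ) atTop ≤ 0 by
      rw [hl.limsup_eq]
      exact not_lt.1 hle)
  -- stability of the decomposition under change of thresholds
  have hthr : ∀ (i : ℕ), ∀ᶠ p : ℝ × ℕ in 𝓝[>] (0 : ℝ) ×ˢ atTop, p.1 ≤ α i ∧ i + 1 ≤ p.2 := by
    intro i
    exact (((tendsto_id.mono_left nhdsWithin_le_nhds).eventually (Iic_mem_nhds (hα i))) :
      ∀ᶠ x in 𝓝[>] (0 : ℝ), x ≤ α i).prod_mk (eventually_ge_atTop (i + 1))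
  have hthr' : ∀ᶠ p : ℝ × ℕ in 𝓝[>] (0 : ℝ) ×ˢ atTop, ∃ i, α i ≤ p.1 ∧ p.2 ≤ i + 1 := by
    filter_upwards [(eventually_mem_nhdsWithin (a := (0 : ℝ)) (s := Set.Ioi 0)).prod_inl _] with p hp
    have h1 := (hαlim.eventually (Iic_mem_nhds hp)).and (eventually_ge_atTop p.2)
    obtain ⟨i, h1, h2⟩ := h1.exists
    exact ⟨i, h1, by omega⟩
  -- The curried filter encodes the order of the limits: thresholds are fixed first, then k tends to
  -- infinity. A given threshold lies between two of the sequence: the finer one bounds the neutral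
  -- integrals from below, the coarser one from above.
  have hA : Tendsto (fun q : (ℝ × ℕ) × ℕ ↦ neutralPart f q.1.1 q.1.2 (n (κ q.2)) (ξ (κ q.2)))
      ((𝓝[>] (0 : ℝ) ×ˢ atTop).curry atTop) (𝓝 a') := by
    rw [FiniteMeasure.tendsto_iff_forall_lintegral_tendsto]
    intro g
    rw [tendsto_order]
    constructor
    · intro c hc
      rw [eventually_curry_iff]
      filter_upwards [hthr'] with p ⟨i, h1, h2⟩
      filter_upwards [(hlint (ha i) g).eventually (lt_mem_nhds (hc.trans_le (ha'_le i g)))] with k hk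
      exact hk.trans_le (lintegral_neutralPart_mono f h1 h2 _ _ g.continuous)
    · intro c hc
      rw [eventually_curry_iff]
      obtain ⟨j, hj⟩ := ((hlint ha' g).eventually (gt_mem_nhds hc)).exists
      filter_upwards [hthr (τ j)] with p ⟨h1, h2⟩
      filter_upwards [(hlint (ha (τ j)) g).eventually (gt_mem_nhds hj)] with k hk
      exact (lintegral_neutralPart_mono f h1 h2 _ _ g.continuous).trans_lt hk
  have hB : Tendsto (fun q : (ℝ × ℕ) × ℕ ↦ nonNeutralPart f q.1.1 q.1.2 (n (κ q.2)) (ξ (κ q.2)))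
      ((𝓝[>] (0 : ℝ) ×ˢ atTop).curry atTop) (𝓝 b') := by
    rw [FiniteMeasure.tendsto_iff_forall_lintegral_tendsto]
    intro g
    rw [tendsto_order]
    constructor
    · intro c hc
      rw [eventually_curry_iff]
      obtain ⟨j, hj⟩ := ((hlint hb' g).eventually (lt_mem_nhds hc)).exists
      filter_upwards [hthr (τ j)] with p ⟨h1, h2⟩
      filter_upwards [(hlint (hb (τ j)) g).eventually (lt_mem_nhds hj)] with k hk
      exact hk.trans_le (lintegral_nonNeutralPart_mono f h1 h2 _ _ g.continuous)
    · intro c hc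
      rw [eventually_curry_iff]
      filter_upwards [hthr'] with p ⟨i, h1, h2⟩
      filter_upwards [(hlint (hb i) g).eventually (gt_mem_nhds ((hb'_ge i g).trans_lt hc))] with k hk
      exact (lintegral_nonNeutralPart_mono f h1 h2 _ _ g.continuous).trans_lt hk
  -- normalization
  let ν : ProbabilityMeasure (ProjTangent M) := ⟨(a' + b' : FiniteMeasure (ProjTangent M)), ⟨by
    have : (a' + b').mass = 1 := by rw [← hmass]; simp [FiniteMeasure.mass]
    rw [← FiniteMeasure.ennreal_mass, this, ENNReal.coe_one]⟩⟩
  obtain ⟨μ₀, hμ₀, ha'eq⟩ := exists_probabilityMeasure_eq_mass_smul f ν hinvab a' hinva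
  obtain ⟨μ₁, hμ₁, hb'eq⟩ := exists_probabilityMeasure_eq_mass_smul f ν hinvab b' hinvb
  have hβ : 1 - b'.mass = a'.mass := by rw [← hmass, add_tsub_cancel_right]
  have hβ1 : b'.mass ≤ 1 := by rw [← hmass]; exact le_add_self
  refine ⟨κ, hκ, b'.mass, μ₀, μ₁, ?_⟩
  exact
    { le_one := hβ1
      invariant₀ := hμ₀
      invariant₁ := hμ₁
      tendsto := by
        rw [hβ, ← ha'eq, ← hb'eq]
        exact hsum'
      neutral := by
        rw [hβ, ← ha'eq, ← hb'eq]
        intro V₀ hV₀ V₁ hV₁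
        have h1 := (hA.eventually hV₀).and (hB.eventually hV₁)
        rw [eventually_curry_iff, eventually_prod_iff] at h1
        obtain ⟨pa, hpa, pb, hpb, h1⟩ := h1
        obtain ⟨r, hr, hr'⟩ := mem_nhdsGT_iff_exists_Ioo_subset.1 hpa
        obtain ⟨L₀, hL₀⟩ := eventually_atTop.1 hpb
        have hr0 : (0 : ℝ) < r := hr
        refine ⟨r / 2, half_pos hr0, L₀, fun x hx hx' L hL ↦ ?_⟩
        exact h1 (hr' ⟨hx, by linarith⟩) (hL₀ L hL)
      integral_eq_zero := by
        have h1 : (1 - (b'.mass : ℝ)) = (a'.mass : ℝ) := by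
          rw [← hβ, NNReal.coe_sub hβ1, NNReal.coe_one]
        rw [h1, ← hzero]
        conv_rhs => rw [ha'eq]
        rw [FiniteMeasure.toMeasure_smul, integral_smul_nnreal_measure, NNReal.smul_def, smul_eq_mul]
        rfl
      pos := by
        have h1 : (b'.mass • (μ₁ : Measure (ProjTangent M))) = (b' : Measure (ProjTangent M)) := by
          conv_rhs => rw [hb'eq]
          rw [FiniteMeasure.toMeasure_smul]
          rfl
        rw [h1]
        exact hpos }

end NeutralDecomposition

/-! ### The Riemannian distance and smooth maps -/

section Distance

variable {E H M : Type*} [NormedAddCommGroup E] [NormedSpace ℝ E] [TopologicalSpace H]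
  {I : ModelWithCorners ℝ E H} [TopologicalSpace M] [ChartedSpace H M]
  [RiemannianBundle (fun x : M ↦ TangentSpace I x)]
  {E' H' M' : Type*} [NormedAddCommGroup E'] [NormedSpace ℝ E'] [TopologicalSpace H']
  {I' : ModelWithCorners ℝ E' H'} [TopologicalSpace M'] [ChartedSpace H' M']
  [RiemannianBundle (fun x : M' ↦ TangentSpace I' x)]
  [IsManifold I 1 M] [IsManifold I' 1 M']

/-- A path from y of length less than r stays in the ball of radius r, so the derivative bound
applies all along it and its image is at most c times as long. -/
theorem riemannianEDist_le_of_enorm_mfderiv_le {G : M → M'} {y : M} {r : ENNReal} {c : ℝ≥0}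
    (hG : ∀ z, riemannianEDist I y z < r → ContMDiffAt I I' 1 G z)
    (hc : ∀ z, riemannianEDist I y z < r → ∀ v : TangentSpace I z,
      ‖mfderiv I I' G z v‖ₑ ≤ c * ‖v‖ₑ) {z : M} (hz : riemannianEDist I y z < r) :
    riemannianEDist I' (G y) (G z) ≤ c * riemannianEDist I y z := by
  have key : ∀ s, riemannianEDist I y z < s → s ≤ r →
      riemannianEDist I' (G y) (G z) ≤ c * s := by
    intro s hs hsr
    obtain ⟨γ, h0, h1, hγ, hlen⟩ := exists_lt_of_riemannianEDist_lt hs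
    have hmem : ∀ t ∈ Set.Icc (0 : ℝ) 1, riemannianEDist I y (γ t) < r := by
      intro t ht
      refine lt_of_le_of_lt ?_ (hlen.trans_le hsr)
      refine (riemannianEDist_le_pathELength (hγ.mono (Set.Icc_subset_Icc le_rfl ht.2)) h0 rfl
        ht.1).trans (pathELength_mono le_rfl ht.2)
    have hcomp : ContMDiffOn 𝓘(ℝ, ℝ) I' 1 (G ∘ γ) (Set.Icc 0 1) := by
      intro t ht
      exact (hG _ (hmem t ht)).comp_contMDiffWithinAt t (hγ t ht)
    refine (riemannianEDist_le_pathELength hcomp (by simp [h0]) (by simp [h1])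
      zero_le_one).trans ?_
    refine le_trans ?_ (mul_le_mul_right hlen.le (c : ENNReal))
    rw [pathELength_eq_lintegral_mfderivWithin_Icc, pathELength_eq_lintegral_mfderivWithin_Icc,
      ← lintegral_const_mul' _ _ ENNReal.coe_ne_top]
    refine setLIntegral_mono' measurableSet_Icc fun t ht ↦ ?_
    have e : mfderivWithin 𝓘(ℝ, ℝ) I' (G ∘ γ) (Set.Icc 0 1) t =
        (mfderiv I I' G (γ t)) ∘L (mfderivWithin 𝓘(ℝ, ℝ) I γ (Set.Icc 0 1) t) := by
      apply mfderiv_comp_mfderivWithin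
      · exact (hG _ (hmem t ht)).mdifferentiableAt one_ne_zero
      · exact hγ.mdifferentiableOn one_ne_zero t ht
      · rw [uniqueMDiffWithinAt_iff_uniqueDiffWithinAt]
        exact uniqueDiffOn_Icc zero_lt_one t ht
    have e1 : mfderivWithin 𝓘(ℝ, ℝ) I' (G ∘ γ) (Set.Icc 0 1) t 1 =
        mfderiv I I' G (γ t) (mfderivWithin 𝓘(ℝ, ℝ) I γ (Set.Icc 0 1) t 1) := congr($e 1)
    rw [e1]
    exact hc _ (hmem t ht) _
  refine ENNReal.le_of_forall_pos_le_add fun ε hε _ ↦ ?_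
  have hfin : riemannianEDist I y z ≠ ⊤ := hz.ne_top
  -- The distance need not be attained by a path, hence an excess; dividing ε by c + 1 rather than c
  -- covers c = 0.
  obtain ⟨s, hs1, hs2⟩ : ∃ s, riemannianEDist I y z < s ∧
      s < min r (riemannianEDist I y z + ε / (c + 1 : ℝ≥0)) := by
    apply exists_between
    refine lt_min hz (ENNReal.lt_add_right hfin ?_)
    exact ENNReal.div_ne_zero.2 ⟨by exact_mod_cast hε.ne', ENNReal.coe_ne_top⟩
  refine (key s hs1 (hs2.le.trans (min_le_left _ _))).trans ?_
  refine (mul_le_mul_right (hs2.le.trans (min_le_right _ _)) (c : ENNReal)).trans ?_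
  rw [mul_add]
  gcongr
  rw [← mul_div_assoc]
  refine ENNReal.div_le_of_le_mul ?_
  rw [mul_comm]
  gcongr
  exact_mod_cast le_add_of_nonneg_right zero_le_one

end Distance

/-! ### Local comparison of a chart with the Riemannian distance -/

section Chart

variable {E H M : Type*} [NormedAddCommGroup E] [InnerProductSpace ℝ E] [TopologicalSpace H]
  {I : ModelWithCorners ℝ E H} [TopologicalSpace M] [RegularSpace M] [ChartedSpace H M]
  [RiemannianBundle (fun x : M ↦ TangentSpace I x)] [IsManifold I 1 M]
  [IsContinuousRiemannianBundle E (fun x : M ↦ TangentSpace I x)]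

theorem exists_edist_extChartAt_le (q : M) : ∃ C : ℝ≥0, ∃ r > (0 : ENNReal), ∀ z,
    riemannianEDist I q z < r → z ∈ (chartAt H q).source ∧
      edist (extChartAt I q q) (extChartAt I q z) ≤ C * riemannianEDist I q z := by
  obtain ⟨C, -, hC⟩ := eventually_enorm_mfderiv_extChartAt_lt I q
  obtain ⟨r, hr, hsub⟩ := setOfPred_riemannianEDist_lt_subset_nhds' I
    (Filter.inter_mem hC (chart_source_mem_nhds H q))
  refine ⟨C, r, hr, fun z hz ↦ ⟨(hsub hz).2, ?_⟩⟩
  rw [IsRiemannianManifold.out (I := 𝓘(ℝ, E)) (extChartAt I q q)]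
  refine riemannianEDist_le_of_enorm_mfderiv_le (I := I) (I' := 𝓘(ℝ, E)) (r := r)
    (fun z hz ↦ contMDiffAt_extChartAt' (hsub hz).2) (fun z hz v ↦ ?_) hz
  have h := (hsub hz).1
  let := fun x : E ↦ normedAddCommGroupTangentSpaceVectorSpace x
  let := fun x : E ↦ normedSpaceTangentSpaceVectorSpace x
  rw [enorm_tangentSpace_vectorSpace]
  refine le_trans ?_ (mul_le_mul_left (le_of_lt h) _)
  exact ContinuousLinearMap.le_opENorm (mfderiv I 𝓘(ℝ, E) (extChartAt I q) z) v

end Chart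

/-! ### The norm of the derivative -/

section OperatorNorm

variable {M : Type*} [TopologicalSpace M] [ChartedSpace Plane M] [IsManifold (𝓡 2) ∞ M]
  [RiemannianBundle (fun x : M ↦ TangentSpace (𝓡 2) x)]

theorem lineNorm_le_norm_mfderiv (g : M → M) (ξ : ProjTangent M) :
    lineNorm g ξ ≤ ‖mfderiv (𝓡 2) (𝓡 2) g ξ.pt‖ := by
  refine div_le_of_le_mul₀ (norm_nonneg _) (ContinuousLinearMap.opNorm_nonneg _) ?_
  exact (mfderiv (𝓡 2) (𝓡 2) g ξ.pt).le_opNorm _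

theorem ProjTangent.exists_pt_eq (x : M) : ∃ ξ : ProjTangent M, ξ.pt = x :=
  ⟨ProjTangent.span ⟨⟨x, (EuclideanSpace.single 0 1 : Plane)⟩, by
    change (EuclideanSpace.single 0 1 : Plane) ≠ 0
    simp⟩, rfl⟩

theorem norm_mfderiv_le_of_lineNorm_le {g : M → M} {x : M} {c : ℝ}
    (h : ∀ ξ : ProjTangent M, ξ.pt = x → lineNorm g ξ ≤ c) :
    ‖mfderiv (𝓡 2) (𝓡 2) g x‖ ≤ c := by
  have hc : 0 ≤ c := by
    obtain ⟨ξ, hξ⟩ := ProjTangent.exists_pt_eq x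
    exact le_trans (div_nonneg (norm_nonneg _) (norm_nonneg _)) (h ξ hξ)
  refine ContinuousLinearMap.opNorm_le_bound _ hc fun v ↦ ?_
  by_cases hv : v = 0
  · subst hv
    simp
  · have := h (ProjTangent.span ⟨⟨x, v⟩, hv⟩) rfl
    rw [lineNorm_span] at this
    exact (div_le_iff₀ (norm_pos_iff.2 hv)).1 this

variable [IsContinuousRiemannianBundle Plane (fun x : M ↦ TangentSpace (𝓡 2) x)]
  [T2Space M] [CompactSpace M]

theorem exists_lineNorm_eq_norm_mfderiv {g : M → M} (hg : ContMDiff (𝓡 2) (𝓡 2) ∞ g) (x : M) :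
    ∃ ξ : ProjTangent M, ξ.pt = x ∧ lineNorm g ξ = ‖mfderiv (𝓡 2) (𝓡 2) g x‖ := by
  have hK : IsCompact {ξ : ProjTangent M | ξ.pt = x} :=
    (isClosed_singleton.preimage ProjTangent.continuous_pt).isCompact
  obtain ⟨ξ, hξ, hmax⟩ := hK.exists_isMaxOn (ProjTangent.exists_pt_eq x)
    (continuous_lineNorm hg).continuousOn
  have hξ' : ξ.pt = x := hξ
  refine ⟨ξ, hξ, le_antisymm ?_ (norm_mfderiv_le_of_lineNorm_le fun ζ hζ ↦ hmax hζ)⟩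
  subst hξ'
  exact lineNorm_le_norm_mfderiv g ξ

/-- The operator norm is the maximum of the continuous function `lineNorm g` over a fiber. Its
strict superlevel sets are open because the projection to M is open, and its superlevel sets {≥ c}
are closed because the projection of a compact set is compact. -/
theorem continuous_norm_mfderiv {g : M → M} (hg : ContMDiff (𝓡 2) (𝓡 2) ∞ g) :
    Continuous fun x : M ↦ ‖mfderiv (𝓡 2) (𝓡 2) g x‖ := by
  have H : ∀ F : M → ℝ, (∀ c, IsOpen (F ⁻¹' Set.Ioi c)) → (∀ c, IsOpen (F ⁻¹' Set.Iio c)) →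
      Continuous F := by
    intro F h1 h2
    rw [OrderTopology.topology_eq_generate_intervals (α := ℝ), continuous_generateFrom_iff]
    rintro _ ⟨c, rfl | rfl⟩
    exacts [h1 c, h2 c]
  refine H _ (fun c ↦ ?_) fun c ↦ ?_
  · have : (fun x : M ↦ ‖mfderiv (𝓡 2) (𝓡 2) g x‖) ⁻¹' Set.Ioi c =
        ProjTangent.pt '' (lineNorm g ⁻¹' Set.Ioi c) := by
      ext x
      constructor
      · intro hx
        obtain ⟨ξ, h1, h2⟩ := exists_lineNorm_eq_norm_mfderiv hg x
        exact ⟨ξ, by simpa [h2] using hx, h1⟩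
      · rintro ⟨ξ, h1, rfl⟩
        exact lt_of_lt_of_le h1 (lineNorm_le_norm_mfderiv g ξ)
    rw [this]
    exact ProjTangent.isOpenMap_pt _ (isOpen_Ioi.preimage (continuous_lineNorm hg))
  · have : (fun x : M ↦ ‖mfderiv (𝓡 2) (𝓡 2) g x‖) ⁻¹' Set.Iio c =
        (ProjTangent.pt '' (lineNorm g ⁻¹' Set.Ici c))ᶜ := by
      ext x
      simp only [Set.mem_preimage, Set.mem_Iio, Set.mem_compl_iff, Set.mem_image, Set.mem_Ici,
        not_exists, not_and]
      constructor
      · rintro hx ξ h1 rfl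
        exact absurd (lineNorm_le_norm_mfderiv g ξ) (not_le.2 (hx.trans_le h1))
      · intro h
        obtain ⟨ξ, h1, h2⟩ := exists_lineNorm_eq_norm_mfderiv hg x
        by_contra hx
        exact h ξ (h2 ▸ not_lt.1 hx) h1
    rw [this, isOpen_compl_iff]
    exact ((isClosed_Ici.preimage (continuous_lineNorm hg)).isCompact.image
      ProjTangent.continuous_pt).isClosed

theorem exists_forall_riemannianEDist_lt {w : M → ℝ} (hw : Continuous w) {ε : ℝ} (hε : 0 < ε) :
    ∃ r > (0 : ℝ≥0), ∀ x y : M, riemannianEDist (𝓡 2) x y < r → |w x - w y| < ε := by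
  have : IsManifold (𝓡 2) 1 M := .of_le (n := ∞) (by simp)
  let : PseudoEMetricSpace M := .ofRiemannianMetric (𝓡 2) M
  have hu := CompactSpace.uniformContinuous_of_continuous hw
  obtain ⟨δ, hδ, h⟩ := EMetric.uniformContinuous_iff.1 hu (ENNReal.ofReal ε) (by simpa)
  obtain ⟨r, hr, hrδ⟩ := ENNReal.lt_iff_exists_nnreal_btwn.1 hδ
  refine ⟨r, by exact_mod_cast hr, fun x y hxy ↦ ?_⟩
  have := h (a := x) (b := y) (lt_trans hxy hrδ)
  rw [edist_dist, ENNReal.ofReal_lt_ofReal_iff hε, Real.dist_eq] at this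
  exact this

end OperatorNorm

/-! ### Regular curves meet small balls in small sets -/

section Curve

variable {M : Type*} [TopologicalSpace M] [ChartedSpace Plane M] [IsManifold (𝓡 2) ∞ M]
  [RiemannianBundle (fun x : M ↦ TangentSpace (𝓡 2) x)]
  [IsContinuousRiemannianBundle Plane (fun x : M ↦ TangentSpace (𝓡 2) x)]
  [T2Space M] [CompactSpace M]

theorem RegularCurve.exists_le_riemannianEDist_of_mem_compact (σ : RegularCurve M) {q : M}
    {K : Set ℝ} (hK : IsCompact K) (hK1 : K ⊆ Set.Icc 0 1) (hq : q ∉ σ.toFun '' K) :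
    ∃ r > (0 : ℝ≥0), ∀ s ∈ K, r ≤ riemannianEDist (𝓡 2) q (σ.toFun s) := by
  have : IsManifold (𝓡 2) 1 M := .of_le (n := ∞) (by simp)
  have hc : IsClosed (σ.toFun '' K) :=
    (hK.image_of_continuousOn (σ.contMDiffOn.continuousOn.mono hK1)).isClosed
  obtain ⟨r, hr, h⟩ := setOfPred_riemannianEDist_lt_subset_nhds (𝓡 2) (hc.isOpen_compl.mem_nhds hq)
  refine ⟨r, hr, fun s hs ↦ not_lt.1 fun hlt ↦ h hlt ⟨s, hs, rfl⟩⟩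

theorem RegularCurve.exists_hasDerivWithinAt_extChartAt (σ : RegularCurve M) {s₀ : ℝ}
    (hs₀ : s₀ ∈ Set.Icc (0 : ℝ) 1) : ∃ w : Plane, w ≠ 0 ∧
    HasDerivWithinAt (extChartAt (𝓡 2) (σ.toFun s₀) ∘ σ.toFun) w (Set.Icc 0 1) s₀ := by
  have : IsManifold (𝓡 2) 1 M := .of_le (n := ∞) (by simp)
  have h1 := (σ.contMDiffOn.mdifferentiableOn (by simp) s₀ hs₀).hasMFDerivWithinAt
  have h2 := (mdifferentiableAt_extChartAt (I := 𝓡 2)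
    (mem_chart_source Plane (σ.toFun s₀))).hasMFDerivAt
  let A : ℝ →L[ℝ] Plane := (mfderiv (𝓡 2) 𝓘(ℝ, Plane) (extChartAt (𝓡 2) (σ.toFun s₀))
    (σ.toFun s₀)).comp (mfderivWithin 𝓘(ℝ, ℝ) (𝓡 2) σ.toFun (Set.Icc 0 1) s₀)
  have h3 : HasFDerivWithinAt (extChartAt (𝓡 2) (σ.toFun s₀) ∘ σ.toFun) A (Set.Icc 0 1) s₀ :=
    (h2.comp_hasMFDerivWithinAt s₀ h1).hasFDerivWithinAt
  refine ⟨A 1, ?_, h3.hasDerivWithinAt⟩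
  have hinj := (isInvertible_mfderiv_extChartAt (I := 𝓡 2)
    (mem_extChartAt_source (I := 𝓡 2) (σ.toFun s₀))).injective
  intro h0
  exact σ.deriv_ne_zero s₀ hs₀ (hinj (h0.trans (map_zero _).symm))

/-- If q = σ(s₀), the nonzero derivative read in a chart gives a linear lower bound near s₀, and
injectivity with compactness a positive lower bound away from s₀. If q is not on the curve, the
distance is bounded below everywhere. In all cases the preimage of an ε-ball lies in an interval of
length O(ε). -/
theorem RegularCurve.exists_abs_sub_le_riemannianEDist (σ : RegularCurve M) (q : M) :
    ∃ C : ℝ≥0, ∃ s₀ : ℝ, ∀ s ∈ Set.Icc (0 : ℝ) 1,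
      ENNReal.ofReal |s - s₀| ≤ C * riemannianEDist (𝓡 2) q (σ.toFun s) := by
  have : IsManifold (𝓡 2) 1 M := .of_le (n := ∞) (by simp)
  have hfar : ∀ {r : ℝ≥0}, 0 < r → ∀ {s s₀ : ℝ}, s ∈ Set.Icc (0 : ℝ) 1 →
      s₀ ∈ Set.Icc (0 : ℝ) 1 → r ≤ riemannianEDist (𝓡 2) q (σ.toFun s) →
      ENNReal.ofReal |s - s₀| ≤ (r⁻¹ : ℝ≥0) * riemannianEDist (𝓡 2) q (σ.toFun s) := by
    intro r hr s s₀ hs hs₀ h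
    calc ENNReal.ofReal |s - s₀| ≤ 1 := by
          rw [ENNReal.ofReal_le_one, abs_le]
          constructor <;> linarith [hs.1, hs.2, hs₀.1, hs₀.2]
      _ = (r⁻¹ : ℝ≥0) * (r : ENNReal) := by
          rw [← ENNReal.coe_mul, inv_mul_cancel₀ hr.ne', ENNReal.coe_one]
      _ ≤ _ := by gcongr
  by_cases hq : q ∈ σ.toFun '' Set.Icc 0 1
  · obtain ⟨s₀, hs₀, rfl⟩ := hq
    obtain ⟨w, hw, hder⟩ := σ.exists_hasDerivWithinAt_extChartAt hs₀
    obtain ⟨C, r, hr, hC⟩ := exists_edist_extChartAt_le (I := 𝓡 2) (σ.toFun s₀)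
    set h := extChartAt (𝓡 2) (σ.toFun s₀) ∘ σ.toFun with hh
    have hw' : 0 < ‖w‖ := norm_pos_iff.2 hw
    have hnear : ∀ᶠ s in 𝓝[Set.Icc 0 1] s₀, ‖w‖ / 2 * |s - s₀| ≤ ‖h s - h s₀‖ := by
      have := hder.isLittleO.def (half_pos hw')
      filter_upwards [this] with s hs
      have e : ‖(s - s₀) • w‖ = |s - s₀| * ‖w‖ := by rw [norm_smul, Real.norm_eq_abs]
      have t : ‖(s - s₀) • w‖ ≤ ‖h s - h s₀ - (s - s₀) • w‖ + ‖h s - h s₀‖ := by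
        have := norm_sub_le (h s - h s₀) (h s - h s₀ - (s - s₀) • w)
        simp only [sub_sub_cancel] at this
        linarith
      have hs' : ‖h s - h s₀ - (s - s₀) • w‖ ≤ ‖w‖ / 2 * |s - s₀| := by
        simpa [Real.norm_eq_abs] using hs
      nlinarith
    obtain ⟨η, hη, hball⟩ := Metric.mem_nhdsWithin_iff.1 hnear
    obtain ⟨r', hr', hr'K⟩ := σ.exists_le_riemannianEDist_of_mem_compact (q := σ.toFun s₀)
      (K := Set.Icc 0 1 \ Metric.ball s₀ η) (isCompact_Icc.diff Metric.isOpen_ball)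
      Set.sdiff_subset (by
        rintro ⟨s, hs, he⟩
        have := σ.injOn hs.1 hs₀ he
        exact hs.2 (this ▸ Metric.mem_ball_self hη))
    obtain ⟨r₁, hr₁, hr₁r⟩ := ENNReal.lt_iff_exists_nnreal_btwn.1 hr
    have hr₁' : 0 < r₁ := by exact_mod_cast hr₁
    refine ⟨max (max r'⁻¹ r₁⁻¹) ((2 / ‖w‖₊) * C), s₀, fun s hs ↦ ?_⟩
    by_cases h1 : (r₁ : ENNReal) ≤ riemannianEDist (𝓡 2) (σ.toFun s₀) (σ.toFun s)
    · refine (hfar hr₁' hs hs₀ h1).trans ?_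
      gcongr
      exact (le_max_right _ _).trans (le_max_left _ _)
    by_cases h2 : s ∈ Metric.ball s₀ η
    · have h3 := (hC (σ.toFun s) ((not_le.1 h1).trans hr₁r)).2
      have h4 : ‖w‖ / 2 * |s - s₀| ≤ ‖h s - h s₀‖ := hball ⟨h2, hs⟩
      have h5 : |s - s₀| ≤ 2 / ‖w‖ * ‖h s - h s₀‖ := by
        rw [div_mul_eq_mul_div, le_div_iff₀ hw']
        linarith
      calc ENNReal.ofReal |s - s₀| ≤ ENNReal.ofReal (2 / ‖w‖ * ‖h s - h s₀‖) :=
            ENNReal.ofReal_le_ofReal h5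
        _ = (2 / ‖w‖₊ : ℝ≥0) * edist (h s₀) (h s) := by
            rw [ENNReal.ofReal_mul (by positivity), edist_comm, edist_eq_enorm_sub,
              ← ofReal_norm, ENNReal.ofReal_eq_coe_nnreal (by positivity)]
            rfl
        _ ≤ (2 / ‖w‖₊ : ℝ≥0) * (C * riemannianEDist (𝓡 2) (σ.toFun s₀) (σ.toFun s)) := by
            gcongr
            exact h3
        _ = ((2 / ‖w‖₊ * C : ℝ≥0) : ENNReal) *
            riemannianEDist (𝓡 2) (σ.toFun s₀) (σ.toFun s) := by
            rw [← mul_assoc, ENNReal.coe_mul]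
        _ ≤ _ := by
            gcongr
            exact le_max_right _ _
    · refine (hfar hr' hs hs₀ (hr'K s ⟨hs, h2⟩)).trans ?_
      gcongr
      exact (le_max_left _ _).trans (le_max_left _ _)
  · obtain ⟨r, hr, h⟩ := σ.exists_le_riemannianEDist_of_mem_compact isCompact_Icc
      subset_rfl hq
    exact ⟨r⁻¹, 0, fun s hs ↦ hfar hr hs ⟨le_rfl, zero_le_one⟩ (h s hs)⟩

theorem RegularCurve.exists_volume_le (σ : RegularCurve M) (q : M) :
    ∃ C : ℝ≥0, ∀ ε : ℝ≥0, volume {s : unitInterval |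
      riemannianEDist (𝓡 2) q (σ.toFun s) ≤ ε} ≤ C * ε := by
  obtain ⟨C, s₀, h⟩ := σ.exists_abs_sub_le_riemannianEDist q
  refine ⟨2 * C, fun ε ↦ ?_⟩
  have hsub : {s : unitInterval | riemannianEDist (𝓡 2) q (σ.toFun s) ≤ ε} ⊆
      Subtype.val ⁻¹' Metric.closedBall s₀ (C * ε) := by
    intro s hs
    have h1 := (h s s.2).trans (mul_le_mul_right hs (C : ENNReal))
    rw [← ENNReal.coe_mul, ENNReal.ofReal_le_iff_le_toReal ENNReal.coe_ne_top] at h1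
    simpa [Real.dist_eq] using h1
  refine (measure_mono hsub).trans ?_
  rw [show (volume : Measure unitInterval) = Measure.comap Subtype.val volume from rfl,
    comap_subtype_coe_apply measurableSet_Icc]
  refine (measure_mono (Set.image_preimage_subset _ _)).trans ?_
  rw [Real.volume_closedBall, ENNReal.ofReal_eq_coe_nnreal (by positivity), ← ENNReal.coe_mul,
    ENNReal.coe_le_coe]
  refine le_of_eq (NNReal.eq ?_)
  push_cast
  ring

end Curve

/-! ### Expanding linear maps of the plane -/

section Linear

theorem norm_le_two_mul_norm_complex (v : Plane) : ‖v‖ ≤ 2 * ‖fun i ↦ (v i : ℂ)‖ := by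
  have h : ∀ i, ‖v i‖ ≤ ‖fun i ↦ (v i : ℂ)‖ := fun i ↦ by
    simpa using norm_le_pi_norm (fun i ↦ (v i : ℂ)) i
  have h2 : ‖v‖ ≤ √((2 * ‖fun i ↦ (v i : ℂ)‖) ^ 2) := by
    rw [EuclideanSpace.norm_eq]
    refine Real.sqrt_le_sqrt ?_
    rw [Fin.sum_univ_two]
    nlinarith [h 0, h 1, norm_nonneg (v 0), norm_nonneg (v 1)]
  rwa [Real.sqrt_sq (by positivity)] at h2

theorem norm_complex_le_norm (v : Plane) : ‖fun i ↦ (v i : ℂ)‖ ≤ ‖v‖ :=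
  (pi_norm_le_iff_of_nonneg (norm_nonneg v)).2 fun i ↦ by
    simpa using PiLp.norm_apply_le v i

/-- The complexified matrix of a linear map of the plane. -/
def complexMatrix (T : Plane →ₗ[ℝ] Plane) : Matrix (Fin 2) (Fin 2) ℂ :=
  (LinearMap.toMatrix (EuclideanSpace.basisFun (Fin 2) ℝ).toBasis
    (EuclideanSpace.basisFun (Fin 2) ℝ).toBasis T).map Complex.ofRealHom

theorem complexMatrix_mulVec (T : Plane →ₗ[ℝ] Plane) (v : Plane) :
    (complexMatrix T).mulVec (fun i ↦ (v i : ℂ)) = fun i ↦ (T v i : ℂ) := by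
  have h := LinearMap.toMatrix_mulVec_repr (EuclideanSpace.basisFun (Fin 2) ℝ).toBasis
    (EuclideanSpace.basisFun (Fin 2) ℝ).toBasis T v
  ext i
  have hi := congrFun h i
  simp only [Matrix.mulVec, dotProduct, Fin.sum_univ_two] at hi ⊢
  simp only [complexMatrix, Matrix.map_apply]
  have := congrArg Complex.ofReal hi
  push_cast at this
  simpa using this

theorem mem_spectrum_complexMatrix_iff (T : Plane →ₗ[ℝ] Plane) (z : ℂ) :
    z ∈ spectrum ℂ (complexMatrix T) ↔ Polynomial.aeval z T.charpoly = 0 := by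
  rw [Matrix.mem_spectrum_iff_isRoot_charpoly, complexMatrix, Matrix.charpoly_map,
    LinearMap.charpoly_toMatrix, Polynomial.IsRoot, Polynomial.eval_map, Polynomial.aeval_def]
  rfl

attribute [local instance] Matrix.linftyOpNormedRing Matrix.linftyOpNormedAlgebra

/-- Gelfand's formula: the k-th root of the norm of A^k tends to the spectral radius, which is less
than one. -/
theorem exists_norm_pow_lt_of_spectrum {A : Matrix (Fin 2) (Fin 2) ℂ}
    (hA : ∀ z ∈ spectrum ℂ A, ‖z‖ < 1) {ε : ℝ} (hε : 0 < ε) : ∃ k > 0, ‖A ^ k‖ < ε := by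
  have : CompleteSpace (Matrix (Fin 2) (Fin 2) ℂ) := FiniteDimensional.complete ℂ _
  have h1 : spectralRadius ℂ A < (1 : ℝ≥0) :=
    spectrum.spectralRadius_lt_of_forall_lt A fun z hz ↦ by exact_mod_cast hA z hz
  obtain ⟨r, hr1, hr2⟩ := ENNReal.lt_iff_exists_nnreal_btwn.1 h1
  have hr2' : r < 1 := by exact_mod_cast hr2
  have h2 := (spectrum.pow_norm_pow_one_div_tendsto_nhds_spectralRadius A).eventually_lt_const hr1
  have h3 : ∀ᶠ k : ℕ in atTop, (r : ℝ) ^ k < ε :=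
    (tendsto_pow_atTop_nhds_zero_of_lt_one r.2 hr2').eventually_lt_const hε
  obtain ⟨k, hk1, hk2, hk0⟩ := (h2.and (h3.and (eventually_gt_atTop 0))).exists
  refine ⟨k, hk0, lt_of_le_of_lt ?_ hk2⟩
  rw [← ENNReal.ofReal_coe_nnreal] at hk1
  have h4 := (ENNReal.ofReal_lt_ofReal_iff_of_nonneg (by positivity)).1 hk1
  have h5 := Real.rpow_le_rpow (by positivity) h4.le (Nat.cast_nonneg k)
  rwa [← Real.rpow_mul (norm_nonneg _), one_div, inv_mul_cancel₀ (by positivity), Real.rpow_one,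
    Real.rpow_natCast] at h5

/-- The complexified inverse has its spectrum in the open unit disc, so its powers tend to zero. An
arbitrary factor K is allowed in order to absorb the comparison between the Euclidean norm and a
Riemannian one. -/
theorem exists_pow_expanding (T : Plane →L[ℝ] Plane)
    (hT : ∀ z : ℂ, Polynomial.aeval z T.toLinearMap.charpoly = 0 → 1 < ‖z‖) {K : ℝ} (hK : 0 < K) :
    ∃ k > 0, ∀ v, K * ‖v‖ ≤ ‖(T ^ k) v‖ := by
  set A := complexMatrix T.toLinearMap with hA
  have h0 : (0 : ℂ) ∉ spectrum ℂ A := fun h ↦ by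
    have := hT 0 ((mem_spectrum_complexMatrix_iff _ _).1 h)
    simp at this
    linarith
  obtain ⟨u, hu⟩ := spectrum.zero_notMem_iff ℂ |>.1 h0
  have hspec : ∀ z ∈ spectrum ℂ (↑u⁻¹ : Matrix (Fin 2) (Fin 2) ℂ), ‖z‖ < 1 := by
    intro z hz
    have hz0 : z ≠ 0 := by
      rintro rfl
      exact (spectrum.zero_notMem_iff ℂ).2 (u⁻¹).isUnit hz
    have h2 : (((Units.mk0 z hz0)⁻¹ : ℂˣ) : ℂ) ∈ spectrum ℂ A := by
      rw [← hu, spectrum.inv_mem_iff]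
      simpa using hz
    have h3 := hT _ ((mem_spectrum_complexMatrix_iff _ _).1 h2)
    rw [Units.val_inv_eq_inv_val, Units.val_mk0, norm_inv] at h3
    exact (one_lt_inv₀ (norm_pos_iff.2 hz0)).1 h3
  -- The factor 2 pays for comparing the Euclidean norm of the plane with the sup norm on ℂ².
  obtain ⟨k, hk, hlt⟩ := exists_norm_pow_lt_of_spectrum hspec (ε := (2 * K)⁻¹) (by positivity)
  refine ⟨k, hk, fun v ↦ ?_⟩
  have hpow : ∀ j : ℕ, (A ^ j).mulVec (fun i ↦ (v i : ℂ)) = fun i ↦ ((T ^ j) v i : ℂ) := by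
    intro j
    induction j with
    | zero => simp
    | succ j ih =>
      rw [pow_succ', ← Matrix.mulVec_mulVec, ih, pow_succ']
      exact complexMatrix_mulVec T.toLinearMap ((T ^ j) v)
  have hinv : ((↑u⁻¹ : Matrix (Fin 2) (Fin 2) ℂ) ^ k).mulVec (fun i ↦ ((T ^ k) v i : ℂ)) =
      fun i ↦ (v i : ℂ) := by
    rw [← hpow, Matrix.mulVec_mulVec, ← hu, ← Units.val_pow_eq_pow_val, ← Units.val_pow_eq_pow_val,
      ← Units.val_mul, inv_pow, inv_mul_cancel, Units.val_one, Matrix.one_mulVec]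
  have h1 : ‖fun i ↦ (v i : ℂ)‖ ≤ (2 * K)⁻¹ * ‖(T ^ k) v‖ := by
    rw [← hinv]
    refine (Matrix.linfty_opNorm_mulVec _ _).trans ?_
    exact mul_le_mul hlt.le (norm_complex_le_norm _) (norm_nonneg _) (by positivity)
  have h2 := norm_le_two_mul_norm_complex v
  calc K * ‖v‖ ≤ K * (2 * ((2 * K)⁻¹ * ‖(T ^ k) v‖)) := by gcongr; linarith
    _ = ‖(T ^ k) v‖ := by field_simp

/-- Write an eigenvector as a + ib. The cross terms cancel in ‖e(Ta)‖² + ‖e(Tb)‖², which equals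
|z|²(‖e a‖² + ‖e b‖²), so κ ≤ |z|. The map `e` transports the expansion hypothesis to the inner
product of a tangent space. -/
theorem one_lt_norm_of_expanding {V : Type*} [NormedAddCommGroup V] [InnerProductSpace ℝ V]
    (T : Plane →ₗ[ℝ] Plane) (e : Plane →ₗ[ℝ] V) (he : Function.Injective e) {κ : ℝ} (hκ : 1 < κ)
    (h : ∀ v, κ * ‖e v‖ ≤ ‖e (T v)‖) {z : ℂ} (hz : Polynomial.aeval z T.charpoly = 0) :
    1 < ‖z‖ := by
  rw [← mem_spectrum_complexMatrix_iff, spectrum.mem_iff, Matrix.isUnit_iff_isUnit_det,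
    isUnit_iff_ne_zero, not_not, ← Matrix.exists_mulVec_eq_zero_iff] at hz
  obtain ⟨v, hv0, hv⟩ := hz
  let a : Plane := WithLp.toLp 2 fun i ↦ (v i).re
  let b : Plane := WithLp.toLp 2 fun i ↦ (v i).im
  have hvab : v = (fun i ↦ (a i : ℂ)) + Complex.I • fun i ↦ (b i : ℂ) := by
    ext i
    simp only [Pi.add_apply, Pi.smul_apply, smul_eq_mul, a, b]
    rw [mul_comm]
    exact (Complex.re_add_im _).symm
  have hev : (complexMatrix T).mulVec v = z • v := by
    rw [Matrix.sub_mulVec, sub_eq_zero, Algebra.algebraMap_eq_smul_one, Matrix.smul_mulVec,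
      Matrix.one_mulVec] at hv
    exact hv.symm
  rw [hvab, Matrix.mulVec_add, Matrix.mulVec_smul, complexMatrix_mulVec, complexMatrix_mulVec]
    at hev
  have hTa : T a = z.re • a - z.im • b := by
    ext i
    have := congrArg Complex.re (congrFun hev i)
    simpa using this
  have hTb : T b = z.im • a + z.re • b := by
    ext i
    have := congrArg Complex.im (congrFun hev i)
    simp at this
    simp
    linarith
  have hsq : ‖e (T a)‖ ^ 2 + ‖e (T b)‖ ^ 2 = ‖z‖ ^ 2 * (‖e a‖ ^ 2 + ‖e b‖ ^ 2) := by
    rw [hTa, hTb, map_sub, map_add, map_smul, map_smul, map_smul, map_smul, norm_sub_sq_real,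
      norm_add_sq_real, norm_smul, norm_smul, norm_smul, norm_smul, real_inner_smul_left,
      real_inner_smul_right, real_inner_smul_left, real_inner_smul_right, Complex.sq_norm,
      Complex.normSq_apply]
    simp only [mul_pow, Real.norm_eq_abs, sq_abs]
    ring
  have hpos : 0 < ‖e a‖ ^ 2 + ‖e b‖ ^ 2 := by
    by_contra hcon
    have ha : ‖e a‖ = 0 := by
      nlinarith [sq_nonneg ‖e a‖, sq_nonneg ‖e b‖, norm_nonneg (e a)]
    have hb : ‖e b‖ = 0 := by
      nlinarith [sq_nonneg ‖e a‖, sq_nonneg ‖e b‖, norm_nonneg (e b)]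
    have ha' : a = 0 := he ((norm_eq_zero.1 ha).trans (map_zero e).symm)
    have hb' : b = 0 := he ((norm_eq_zero.1 hb).trans (map_zero e).symm)
    apply hv0
    rw [hvab, ha', hb']
    ext i
    simp
  have hge : κ ^ 2 * (‖e a‖ ^ 2 + ‖e b‖ ^ 2) ≤ ‖z‖ ^ 2 * (‖e a‖ ^ 2 + ‖e b‖ ^ 2) := by
    rw [← hsq, mul_add, ← mul_pow, ← mul_pow]
    gcongr
    exacts [h a, h b]
  have := le_of_mul_le_mul_right hge hpos
  exact hκ.trans_le (abs_le_of_sq_le_sq' this (norm_nonneg z)).2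

end Linear

/-! ### Repelling periodic orbits -/

section Repelling

variable {M : Type*} [TopologicalSpace M] [ChartedSpace Plane M] [IsManifold (𝓡 2) ∞ M]

theorem planeDeriv_comp {g h : M → M} (hg : MDifferentiable (𝓡 2) (𝓡 2) g)
    (hh : MDifferentiable (𝓡 2) (𝓡 2) h) (p : M) :
    planeDeriv (g ∘ h) p = (planeDeriv g (h p)).comp (planeDeriv h p) :=
  mfderiv_comp p (hg _) (hh _)

theorem planeDeriv_id (p : M) : planeDeriv (id : M → M) p = ContinuousLinearMap.id ℝ Plane :=
  mfderiv_id

theorem planeDeriv_iterate_mul (f : Diffeomorph (𝓡 2) (𝓡 2) M M ∞) {n : ℕ} {p : M}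
    (hp : f^[n] p = p) (k : ℕ) : planeDeriv f^[n * k] p = planeDeriv f^[n] p ^ k := by
  induction k with
  | zero =>
    rw [mul_zero, Function.iterate_zero, planeDeriv_id, pow_zero]
    rfl
  | succ k ih =>
    have hk : f^[n * k] p = p := by
      rw [Function.iterate_mul]
      exact Function.iterate_fixed hp k
    rw [Nat.mul_succ, add_comm, Function.iterate_add, planeDeriv_comp
      (mdifferentiable_iterate f _) (mdifferentiable_iterate f _), hk, ih, pow_succ']
    rfl

theorem iterate_symm_comp_iterate (f : Diffeomorph (𝓡 2) (𝓡 2) M M ∞) (n : ℕ) :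
    f.symm^[n] ∘ f^[n] = id := by
  ext x
  exact (Function.LeftInverse.iterate f.symm_apply_apply n) x

theorem iterate_comp_iterate_symm (f : Diffeomorph (𝓡 2) (𝓡 2) M M ∞) (n : ℕ) :
    f^[n] ∘ f.symm^[n] = id := by
  ext x
  exact (Function.LeftInverse.iterate f.apply_symm_apply n) x

theorem planeDeriv_iterate_symm_apply (f : Diffeomorph (𝓡 2) (𝓡 2) M M ∞) {n : ℕ} {p : M}
    (hp : f^[n] p = p) (v : Plane) :
    planeDeriv f^[n] p (planeDeriv f.symm^[n] p v) = v := by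
  have hp' : f.symm^[n] p = p := by
    conv_lhs => rw [← hp]
    exact congrFun (iterate_symm_comp_iterate f n) p
  have h := planeDeriv_comp (mdifferentiable_iterate f n) (mdifferentiable_iterate f.symm n) p
  rw [iterate_comp_iterate_symm, planeDeriv_id, hp'] at h
  exact congr($h v).symm

variable [RiemannianBundle (fun x : M ↦ TangentSpace (𝓡 2) x)]

/-- The Riemannian norm at `x` of a vector of the model plane. -/
def planeNorm (x : M) (v : Plane) : ℝ :=
  letI w : TangentSpace (𝓡 2) x := v
  ‖w‖

theorem planeNorm_nonneg (x : M) (v : Plane) : 0 ≤ planeNorm x v :=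
  norm_nonneg (E := TangentSpace (𝓡 2) x) v

theorem exists_planeNorm_le (x : M) : ∃ C > 0, ∀ v, planeNorm x v ≤ C * ‖v‖ := by
  let A : Plane →L[ℝ] TangentSpace (𝓡 2) x := ContinuousLinearMap.id ℝ Plane
  refine ⟨‖A‖ + 1, by positivity, fun v ↦ (A.le_opNorm v).trans ?_⟩
  gcongr
  linarith

theorem exists_le_planeNorm (x : M) : ∃ C > 0, ∀ v, ‖v‖ ≤ C * planeNorm x v := by
  let A : TangentSpace (𝓡 2) x →L[ℝ] Plane := ContinuousLinearMap.id ℝ Plane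
  refine ⟨‖A‖ + 1, by positivity, fun v ↦ (A.le_opNorm v).trans ?_⟩
  refine mul_le_mul_of_nonneg_right ?_ (planeNorm_nonneg x v)
  linarith

theorem exists_norm_mfderiv_symm_le (f : Diffeomorph (𝓡 2) (𝓡 2) M M ∞) {p : M}
    (hp : IsRepellingPeriodic f p) :
    ∃ n > 0, f^[n] p = p ∧ ‖mfderiv (𝓡 2) (𝓡 2) f.symm^[n] p‖ ≤ 1 / 2 := by
  obtain ⟨m, hm, hmp, hz⟩ := hp
  obtain ⟨C₁, hC₁, h₁⟩ := exists_planeNorm_le p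
  obtain ⟨C₂, hC₂, h₂⟩ := exists_le_planeNorm p
  -- C₁ and C₂ compare the Riemannian norm at p with the norm of the model plane; the remaining
  -- factor 2 gives the contraction by 1/2.
  obtain ⟨k, hk, hexp⟩ := exists_pow_expanding _ hz (K := 2 * C₁ * C₂) (by positivity)
  have hfix : f^[m * k] p = p := by
    rw [Function.iterate_mul]
    exact Function.iterate_fixed hmp k
  have hfix' : f.symm^[m * k] p = p := by
    conv_lhs => rw [← hfix]
    exact congrFun (iterate_symm_comp_iterate f (m * k)) p
  refine ⟨m * k, Nat.mul_pos hm hk, hfix,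
    ContinuousLinearMap.opNorm_le_bound _ (by norm_num) fun v ↦ ?_⟩
  change planeNorm (f.symm^[m * k] p) (planeDeriv f.symm^[m * k] p v) ≤ 1 / 2 * planeNorm p v
  rw [hfix']
  set w := planeDeriv f.symm^[m * k] p v with hw
  have hv : (planeDeriv f^[m] p ^ k) w = v := by
    rw [← planeDeriv_iterate_mul f hmp, hw]
    exact planeDeriv_iterate_symm_apply f hfix v
  have h3 := hexp w
  rw [hv] at h3
  have h4 := h₁ w
  have h5 : 2 * C₁ * C₂ * ‖w‖ ≤ C₂ * planeNorm p v := h3.trans (h₂ v)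
  have h6 : 2 * C₁ * ‖w‖ ≤ planeNorm p v := by
    refine le_of_mul_le_mul_left ?_ hC₂
    linarith
  linarith

variable [IsContinuousRiemannianBundle Plane (fun x : M ↦ TangentSpace (𝓡 2) x)]
  [T2Space M] [CompactSpace M]

theorem riemannianEDist_map_le {G : M → M} (hG : ContMDiff (𝓡 2) (𝓡 2) ∞ G) {y : M}
    {r : ENNReal} {c : ℝ≥0}
    (hc : ∀ z, riemannianEDist (𝓡 2) y z < r → ‖mfderiv (𝓡 2) (𝓡 2) G z‖ ≤ c) {z : M}
    (hz : riemannianEDist (𝓡 2) y z < r) :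
    riemannianEDist (𝓡 2) (G y) (G z) ≤ c * riemannianEDist (𝓡 2) y z := by
  have : IsManifold (𝓡 2) 1 M := .of_le (n := ∞) (by simp)
  refine riemannianEDist_le_of_enorm_mfderiv_le (I := 𝓡 2) (I' := 𝓡 2) (r := r)
    (fun z _ ↦ (hG z).of_le (by simp)) (fun z hz v ↦ ?_) hz
  refine ((mfderiv (𝓡 2) (𝓡 2) G z).le_opENorm v).trans ?_
  gcongr
  rw [enorm_le_coe]
  exact hc z hz

theorem exists_lipschitz_iterate_symm (f : Diffeomorph (𝓡 2) (𝓡 2) M M ∞) (j : ℕ) :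
    ∃ C : ℝ≥0, ∀ y z, riemannianEDist (𝓡 2) y z < ⊤ →
      riemannianEDist (𝓡 2) (f.symm^[j] y) (f.symm^[j] z) ≤ C * riemannianEDist (𝓡 2) y z := by
  obtain ⟨C, hC⟩ := isCompact_univ.exists_bound_of_continuousOn
    (continuous_norm_mfderiv (contMDiff_iterate f.symm j)).continuousOn
  refine ⟨C.toNNReal, fun y z h ↦ riemannianEDist_map_le (contMDiff_iterate f.symm j)
    (r := ⊤) (fun z _ ↦ ?_) h⟩
  exact (le_abs_self _).trans ((hC z trivial).trans (Real.le_coe_toNNReal C))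

/-- A point of U at time i ≥ qm is brought by the inverse, which contracts by 3/4 every m steps, to
within O((3/4)^q) of one of the finitely many points f^{-j}(p), j < m. The curve meets each of these
small balls in a proportionally small set of parameters. -/
theorem exists_nhds_volume_visit_le (f : Diffeomorph (𝓡 2) (𝓡 2) M M ∞) (σ : RegularCurve M)
    {p : M} (hp : IsRepellingPeriodic f p) :
    ∃ C : ℝ≥0, ∃ m > 0, ∃ U ∈ 𝓝 p, ∀ q : ℕ,
      volume {s : unitInterval | ∃ i ≥ q * m, f^[i] (σ.toFun s) ∈ U} ≤ C * (3 / 4 : ℝ≥0) ^ q := by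
  have : IsManifold (𝓡 2) 1 M := .of_le (n := ∞) (by simp)
  obtain ⟨m, hm, hfix, hnorm⟩ := exists_norm_mfderiv_symm_le f hp
  have hfix' : f.symm^[m] p = p := by
    conv_lhs => rw [← hfix]
    exact congrFun (iterate_symm_comp_iterate f m) p
  -- With oscillation less than 1/4, the norm 1/2 at p yields the contraction 3/4 on the ball of
  -- radius r.
  obtain ⟨r, hr, hunif⟩ := exists_forall_riemannianEDist_lt
    (continuous_norm_mfderiv (contMDiff_iterate f.symm m)) (ε := 1 / 4) (by norm_num)
  have hcontr : ∀ z, riemannianEDist (𝓡 2) p z < r →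
      riemannianEDist (𝓡 2) p (f.symm^[m] z) ≤
        (3 / 4 : ℝ≥0) * riemannianEDist (𝓡 2) p z := by
    intro z hz
    have := riemannianEDist_map_le (contMDiff_iterate f.symm m) (y := p) (r := r) (c := 3 / 4)
      (fun z hz ↦ by
        have := (abs_lt.1 (hunif p z hz)).1
        push_cast
        linarith) hz
    rwa [hfix'] at this
  have hiter : ∀ q z, riemannianEDist (𝓡 2) p z < r →
      riemannianEDist (𝓡 2) p (f.symm^[q * m] z) ≤ ((3 / 4 : ℝ≥0) : ENNReal) ^ q * r := by
    intro q
    induction q with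
    | zero =>
      intro z hz
      simpa using hz.le
    | succ q ih =>
      intro z hz
      have h34 : ((3 / 4 : ℝ≥0) : ENNReal) < 1 := by
        exact_mod_cast (by norm_num : (3 / 4 : ℝ) < 1)
      have hz' : riemannianEDist (𝓡 2) p (f.symm^[m] z) < r :=
        (hcontr z hz).trans_lt ((mul_le_of_le_one_left zero_le h34.le).trans_lt hz)
      have hb : ∀ q z, riemannianEDist (𝓡 2) p z < r →
          riemannianEDist (𝓡 2) p (f.symm^[q * m] z) < r := by
        intro q
        induction q with
        | zero => intro z hz; simpa using hz
        | succ q ih =>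
          intro z hz
          rw [Nat.succ_mul, Function.iterate_add_apply]
          exact ih _ ((hcontr z hz).trans_lt ((mul_le_of_le_one_left zero_le h34.le).trans_lt hz))
      rw [Nat.succ_mul, add_comm, Function.iterate_add_apply, pow_succ', mul_assoc]
      exact (hcontr _ (hb q z hz)).trans (mul_le_mul_right (ih z hz) _)
  choose L hL using exists_lipschitz_iterate_symm (M := M) f
  choose D hD using fun j ↦ σ.exists_volume_le (f.symm^[j] p)
  refine ⟨∑ j ∈ Finset.range m, D j * (L j * r), m, hm,
    {z | riemannianEDist (𝓡 2) p z < r},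
    eventually_riemannianEDist_lt (𝓡 2) p (by exact_mod_cast hr), fun q ↦ ?_⟩
  have hsub : {s : unitInterval | ∃ i ≥ q * m,
      f^[i] (σ.toFun s) ∈ {z | riemannianEDist (𝓡 2) p z < r}} ⊆
      ⋃ j ∈ Finset.range m, {s : unitInterval | riemannianEDist (𝓡 2) (f.symm^[j] p) (σ.toFun s) ≤
        ((L j * r * (3 / 4) ^ q : ℝ≥0) : ENNReal)} := by
    rintro s ⟨i, hi, hs⟩
    have hq : q ≤ i / m := (Nat.le_div_iff_mul_le hm).2 hi
    simp only [Set.mem_iUnion, Finset.mem_range]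
    -- The first i / m blocks of m backward steps contract; the i % m remaining steps only cost a
    -- Lipschitz constant.
    refine ⟨i % m, Nat.mod_lt _ hm, ?_⟩
    have h1 := hiter (i / m) _ hs
    have h2 : f.symm^[i / m * m] (f^[i] (σ.toFun s)) = f^[i % m] (σ.toFun s) := by
      conv_lhs => rw [← Nat.mod_add_div i m, Nat.mul_comm m, add_comm, Function.iterate_add_apply]
      rw [show (i / m * m + i % m) / m = i / m by
        rw [Nat.div_add_mod' i m]]
      exact congrFun (iterate_symm_comp_iterate f (i / m * m)) _
    rw [h2] at h1
    have h3 := hL (i % m) p (f^[i % m] (σ.toFun s)) (h1.trans_lt (by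
      rw [← ENNReal.coe_pow, ← ENNReal.coe_mul]
      exact ENNReal.coe_lt_top))
    rw [show f.symm^[i % m] (f^[i % m] (σ.toFun s)) = σ.toFun s from
      congrFun (iterate_symm_comp_iterate f (i % m)) _] at h3
    refine h3.trans ((mul_le_mul_right h1 _).trans ?_)
    rw [← ENNReal.coe_pow, ← ENNReal.coe_mul, ← ENNReal.coe_mul, ENNReal.coe_le_coe,
      mul_assoc, mul_comm r]
    have h34 : (3 / 4 : ℝ≥0) ≤ 1 := by exact_mod_cast (by norm_num : (3 / 4 : ℝ) ≤ 1)
    exact mul_le_mul_right (mul_le_mul_left (pow_le_pow_of_le_one zero_le h34 hq) _) _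
  refine (measure_mono hsub).trans ((measure_biUnion_finset_le _ _).trans ?_)
  refine (Finset.sum_le_sum fun j _ ↦ hD j _).trans (le_of_eq ?_)
  push_cast
  rw [Finset.sum_mul]
  refine Finset.sum_congr rfl fun j _ ↦ ?_
  ring

end Repelling

/-! ### Limits of empirical measures along a selection -/

section Selection

variable {M : Type*} [TopologicalSpace M] [ChartedSpace Plane M] [IsManifold (𝓡 2) ∞ M]
  [RiemannianBundle (fun x : M ↦ TangentSpace (𝓡 2) x)]
  [IsContinuousRiemannianBundle Plane (fun x : M ↦ TangentSpace (𝓡 2) x)]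
  [T2Space M] [CompactSpace M]
  {f : Diffeomorph (𝓡 2) (𝓡 2) M M ∞} {σ : RegularCurve M}
  {d : MetricSpace (FiniteMeasure (ProjTangent M))} {lmin lmax ρ : ℕ → ℝ} {n : ℕ → ℕ}
  {α : ℕ → ℝ} {L : ℕ → ℕ} {δ : ℕ → ℝ} {T' : ℕ → Set unitInterval} {κ : ℕ → ℕ}

theorem integral_convex_combination {β : ℝ≥0} (hβ : β ≤ 1)
    (μ₀ μ₁ : ProbabilityMeasure (ProjTangent M)) {g : ProjTangent M → ℝ} (hg : Continuous g) :
    ∫ z, g z ∂(((1 - β) • μ₀.toFiniteMeasure + β • μ₁.toFiniteMeasure :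
      FiniteMeasure (ProjTangent M)) : Measure (ProjTangent M)) =
      (1 - (β : ℝ)) * ∫ z, g z ∂(μ₀ : Measure (ProjTangent M)) +
        β * ∫ z, g z ∂(μ₁ : Measure (ProjTangent M)) := by
  obtain ⟨C, hC⟩ := isCompact_univ.exists_bound_of_continuousOn hg.continuousOn
  have hint : ∀ μ : Measure (ProjTangent M), IsFiniteMeasure μ → Integrable g μ := fun μ _ ↦
    integrable_of_abs_le hg.measurable (C := C) fun x ↦ hC x trivial
  rw [FiniteMeasure.toMeasure_add, integral_add_measure (hint _ inferInstance)
    (hint _ inferInstance), FiniteMeasure.toMeasure_smul, FiniteMeasure.toMeasure_smul,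
    integral_smul_nnreal_measure, integral_smul_nnreal_measure, NNReal.smul_def, NNReal.smul_def,
    NNReal.coe_sub hβ, NNReal.coe_one, smul_eq_mul, smul_eq_mul]
  rfl

theorem IsNeutralDecomposition.mul_integral_phi {lbar : ℝ} (hr : IsRateSequence lbar lmin lmax ρ)
    (hsel : IsSelection f σ d lmin lmax ρ n α L δ T') {ξ : ℕ → ProjTangent M}
    (hξ : ∀ k, ξ k ∈ σ.lift '' T' k) (hκ : StrictMono κ) {β : ℝ≥0}
    {μ₀ μ₁ : ProbabilityMeasure (ProjTangent M)}
    (hdec : IsNeutralDecomposition f (n ∘ κ) (ξ ∘ κ) β μ₀ μ₁) :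
    (β : ℝ) * ∫ z, phi f z ∂(μ₁ : Measure (ProjTangent M)) = lbar := by
  have h1 := tendsto_integral_of_continuous hdec.tendsto (continuous_phi f)
  rw [integral_convex_combination hdec.le_one _ _ (continuous_phi f), hdec.integral_eq_zero,
    zero_add] at h1
  refine tendsto_nhds_unique h1 ?_
  have h2 : ∀ k, ∫ z, phi f z ∂(empirical f ((n ∘ κ) k) ((ξ ∘ κ) k) : Measure (ProjTangent M)) =
      1 / (n (κ k) : ℝ) * birkhoffSum (lift f) (phi f) (n (κ k)) (ξ (κ k)) := fun k ↦ by
    rw [empirical, integral_smul_sum_pointMass _ _ _ (continuous_phi f)]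
    push_cast
    rw [one_div]
    rfl
  have h3 : ∀ k, lmin k ≤ 1 / (n k : ℝ) * birkhoffSum (lift f) (phi f) (n k) (ξ k) ∧
      1 / (n k : ℝ) * birkhoffSum (lift f) (phi f) (n k) (ξ k) ≤ lmax k := fun k ↦ by
    obtain ⟨s, hs, he⟩ := hξ k
    have := (mem_goodSet_iff f σ).1 (hsel.subset k hs)
    rw [← he]
    exact ⟨this.1, this.2.1⟩
  simp only [h2]
  exact tendsto_of_tendsto_of_tendsto_of_le_of_le
    (hr.tendsto_lmin.comp hκ.tendsto_atTop) (hr.tendsto_lmax.comp hκ.tendsto_atTop)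
    (fun k ↦ (h3 (κ k)).1) fun k ↦ (h3 (κ k)).2

/-- Along a selection the empirical measures of any two points of T' are δ_k-close, so a limit known
for one choice of points holds for every choice. -/
theorem IsSelection.tendsto_empirical
    (hd : d.toPseudoMetricSpace.toUniformSpace.toTopologicalSpace = weakStar M)
    (hsel : IsSelection f σ d lmin lmax ρ n α L δ T') {ξ ξ' : ℕ → ProjTangent M}
    (hξ : ∀ k, ξ k ∈ σ.lift '' T' k) (hξ' : ∀ k, ξ' k ∈ σ.lift '' T' (κ k)) (hκ : StrictMono κ)
    {Λ : FiniteMeasure (ProjTangent M)}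
    (h : Tendsto (fun k ↦ empirical f ((n ∘ κ) k) ((ξ ∘ κ) k)) atTop (𝓝 Λ)) :
    Tendsto (fun k ↦ empirical f (n (κ k)) (ξ' k)) atTop (𝓝 Λ) := by
  have h1 : Tendsto (fun k ↦ empirical f ((n ∘ κ) k) ((ξ ∘ κ) k)) atTop
      (@nhds _ d.toPseudoMetricSpace.toUniformSpace.toTopologicalSpace Λ) := by
    rw [hd]
    exact h
  have h2 : Tendsto (fun k ↦ empirical f (n (κ k)) (ξ' k)) atTop
      (@nhds _ d.toPseudoMetricSpace.toUniformSpace.toTopologicalSpace Λ) := by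
    rw [@tendsto_iff_dist_tendsto_zero _ _ d.toPseudoMetricSpace] at h1 ⊢
    have h3 := (hsel.tendsto_δ.comp hκ.tendsto_atTop).add h1
    rw [add_zero] at h3
    refine squeeze_zero (fun k ↦ @dist_nonneg _ d.toPseudoMetricSpace _ _) (fun k ↦ ?_) h3
    refine (@dist_triangle _ d.toPseudoMetricSpace _ (empirical f (n (κ k)) (ξ (κ k))) _).trans ?_
    refine add_le_add ?_ le_rfl
    exact (hsel.dist_empirical (κ k) _ (hξ' k) _ (hξ (κ k))).le
  rw [hd] at h2
  exact h2

/-- If all visits to U occurred before time a, the sum of g along the orbit would be at most a. -/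
theorem exists_visit_of_integral_empirical {n : ℕ} {x : ProjTangent M} {g : M → ℝ}
    (hg : Continuous g) {U : Set M} (hU : ∀ y ∉ U, g y = 0) (hg1 : ∀ y, g y ≤ 1) {a : ℕ}
    (h : (a : ℝ) < n * ∫ z, g z.pt ∂(empirical f n x : Measure (ProjTangent M))) :
    ∃ i ≥ a, f^[i] x.pt ∈ U := by
  by_contra! hcon
  rw [empirical, integral_smul_sum_pointMass _ _ _ (g := fun z ↦ g z.pt)
    (hg.comp ProjTangent.continuous_pt)] at h
  have hn : (n : ℝ) ≠ 0 := by
    intro h0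
    rw [h0] at h
    simp only [zero_mul] at h
    exact absurd h (not_lt.2 (Nat.cast_nonneg a))
  push_cast at h
  rw [← mul_assoc, mul_inv_cancel₀ hn, one_mul] at h
  have hle : ∑ i ∈ Finset.range n, g ((lift f)^[i] x).pt ≤
      ∑ i ∈ Finset.range n, if i < a then (1 : ℝ) else 0 := by
    refine Finset.sum_le_sum fun i _ ↦ ?_
    rw [iterate_lift_pt]
    split_ifs with hi
    · exact hg1 _
    · exact (hU _ (hcon i (not_lt.1 hi))).le
  rw [Finset.sum_boole] at hle
  have hcard : (Finset.filter (fun i ↦ i < a) (Finset.range n)).card ≤ a := by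
    refine (Finset.card_le_card (t := Finset.range a) fun i hi ↦ ?_).trans_eq
      (Finset.card_range a)
    simpa using (Finset.mem_filter.1 hi).2
  have : ((Finset.filter (fun i ↦ i < a) (Finset.range n)).card : ℝ) ≤ a := by exact_mod_cast hcard
  linarith

theorem eventually_mul_rpow_lt_pow {C η : ℝ} (hη : 0 < η) {m : ℝ} (hm : 0 < m) {ρ : ℕ → ℝ}
    (hρ : Tendsto ρ atTop (𝓝 1)) {n : ℕ → ℕ} (hn : Tendsto n atTop atTop) :
    ∀ᶠ k in atTop, C * (3 / 4 : ℝ) ^ (η * n k / m - 2) < ρ k ^ (2 * n k) := by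
  -- With this τ, (3/4)^(ηn/m) = τ^(2n) τ^(2n): one factor absorbs the constant, the other is below
  -- ρ_k^(2n) as soon as ρ_k > τ.
  set τ : ℝ := (3 / 4 : ℝ) ^ (η / (4 * m)) with hτ
  have hτ0 : 0 < τ := by positivity
  have hτ1 : τ < 1 := Real.rpow_lt_one (by norm_num) (by norm_num) (by positivity)
  have h1 : ∀ᶠ k in atTop, τ < ρ k := hρ.eventually_const_lt hτ1
  have h2 : Tendsto (fun k ↦ C * (3 / 4 : ℝ) ^ (-2 : ℝ) * (τ ^ 2) ^ n k) atTop (𝓝 0) := by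
    have := ((tendsto_pow_atTop_nhds_zero_of_lt_one (by positivity)
      (pow_lt_one₀ hτ0.le hτ1 two_ne_zero)).comp hn).const_mul (C * (3 / 4 : ℝ) ^ (-2 : ℝ))
    rwa [mul_zero] at this
  filter_upwards [h1, h2.eventually_lt_const one_pos] with k hk1 hk2
  have e : (3 / 4 : ℝ) ^ (η * n k / m - 2) = (3 / 4 : ℝ) ^ (-2 : ℝ) * (τ ^ 2) ^ n k *
      (τ ^ 2) ^ n k := by
    rw [← pow_mul, mul_assoc, ← pow_add, hτ, ← Real.rpow_natCast, ← Real.rpow_mul (by norm_num),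
      ← Real.rpow_add (by norm_num)]
    congr 1
    push_cast
    field_simp
    ring
  rw [e, ← mul_assoc, ← mul_assoc]
  calc C * (3 / 4 : ℝ) ^ (-2 : ℝ) * (τ ^ 2) ^ n k * (τ ^ 2) ^ n k
      < 1 * (τ ^ 2) ^ n k := by gcongr
    _ = τ ^ (2 * n k) := by rw [one_mul, pow_mul]
    _ ≤ ρ k ^ (2 * n k) := by gcongr

variable [MeasurableSpace M] [BorelSpace M]

theorem measurePreserving_map_pt {f : Diffeomorph (𝓡 2) (𝓡 2) M M ∞}
    {μ : Measure (ProjTangent M)} (hμ : MeasurePreserving (lift f) μ μ) :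
    MeasurePreserving f (μ.map ProjTangent.pt) (μ.map ProjTangent.pt) := by
  refine ⟨f.continuous.measurable, ?_⟩
  rw [Measure.map_map f.continuous.measurable ProjTangent.measurable_pt]
  conv_rhs => rw [← hμ.map_eq]
  rw [Measure.map_map ProjTangent.measurable_pt (continuous_lift f).measurable]
  rfl

theorem measure_singleton_iterate {ν : Measure M} (hν : MeasurePreserving f ν ν) (i : ℕ) (p : M) :
    ν {f^[i] p} = ν {p} := by
  have h := (hν.iterate i).measure_preimage (measurableSet_singleton (f^[i] p)).nullMeasurableSet
  rw [← h]
  congr 1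
  ext x
  simp only [Set.mem_preimage, Set.mem_singleton_iff]
  exact (f.injective.iterate i).eq_iff

/-- If p had positive mass, every point of T' would have empirical mass at least η near p, hence a
visit near p at a time at least ⌊ηn⌋. The measure of such parameters decays exponentially in n,
whereas |T'| > ρ_k^(2n) with ρ_k → 1. -/
theorem IsNeutralDecomposition.measure_orbit_eq_zero {lbar : ℝ}
    (hd : d.toPseudoMetricSpace.toUniformSpace.toTopologicalSpace = weakStar M)
    (hr : IsRateSequence lbar lmin lmax ρ)
    (hsel : IsSelection f σ d lmin lmax ρ n α L δ T') {ξ : ℕ → ProjTangent M}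
    (hξ : ∀ k, ξ k ∈ σ.lift '' T' k) (hκ : StrictMono κ) {β : ℝ≥0}
    {μ₀ μ₁ : ProbabilityMeasure (ProjTangent M)}
    (hdec : IsNeutralDecomposition f (n ∘ κ) (ξ ∘ κ) β μ₀ μ₁) (hβ : β ≠ 0) {p : M}
    (hp : IsRepellingPeriodic f p) :
    (μ₁ : Measure (ProjTangent M)).map ProjTangent.pt (Set.range fun i : ℕ ↦ f^[i] p) = 0 := by
  set ν := (μ₁ : Measure (ProjTangent M)).map ProjTangent.pt with hν
  have : IsProbabilityMeasure ν := Measure.isProbabilityMeasure_map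
    ProjTangent.measurable_pt.aemeasurable
  suffices h0 : ν {p} = 0 by
    rw [← Set.iUnion_singleton_eq_range, measure_iUnion_null_iff]
    exact fun i ↦ (measure_singleton_iterate (measurePreserving_map_pt hdec.invariant₁) i p).trans h0
  by_contra hne
  obtain ⟨C, m, hm, U, hU, hvol⟩ := exists_nhds_volume_visit_le f σ hp
  obtain ⟨V, hVU, hVo, hpV⟩ := mem_nhds_iff.1 hU
  obtain ⟨g, hg0, hg1, hg01⟩ := exists_continuous_zero_one_of_isClosed
    (s := Vᶜ) (t := {p}) hVo.isClosed_compl isClosed_singleton (by simpa using hpV)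
  have hgc : Continuous fun z : ProjTangent M ↦ g z.pt := g.continuous.comp ProjTangent.continuous_pt
  have hint : ν.real {p} ≤ ∫ z, g z.pt ∂(μ₁ : Measure (ProjTangent M)) := by
    rw [← integral_map (φ := ProjTangent.pt) (f := fun x ↦ g x)
      ProjTangent.measurable_pt.aemeasurable g.continuous.aestronglyMeasurable, ← hν,
      ← integral_indicator_one (measurableSet_singleton p)]
    refine integral_mono ((integrable_const 1).indicator (measurableSet_singleton p))
      (integrable_of_abs_le g.continuous.measurable (C := 1) fun x ↦ ?_) fun x ↦ ?_
    · rw [abs_of_nonneg (hg01 x).1]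
      exact (hg01 x).2
    · by_cases hx : x = p
      · subst hx
        simp [hg1 rfl]
      · simpa [hx] using (hg01 x).1
  have hνp : 0 < ν.real {p} := ENNReal.toReal_pos hne (measure_ne_top _ _)
  set η : ℝ := β * ν.real {p} / 2 with hη
  have hη0 : 0 < η := by
    have : 0 < (β : ℝ) := by exact_mod_cast pos_iff_ne_zero.2 hβ
    positivity
  have hlim : 2 * η ≤ ∫ z, g z.pt ∂(((1 - β) • μ₀.toFiniteMeasure + β • μ₁.toFiniteMeasure :
      FiniteMeasure (ProjTangent M)) : Measure (ProjTangent M)) := by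
    rw [integral_convex_combination hdec.le_one _ _ hgc]
    have h1 : 0 ≤ ∫ z, g z.pt ∂(μ₀ : Measure (ProjTangent M)) :=
      integral_nonneg fun z ↦ (hg01 z.pt).1
    have h2 : (β : ℝ) ≤ 1 := by exact_mod_cast hdec.le_one
    have h3 := mul_le_mul_of_nonneg_left hint β.coe_nonneg
    nlinarith
  -- Uniformity over T' is obtained by choosing a bad point whenever there is one: the resulting
  -- sequence still has the same limit measure.
  have hev : ∀ᶠ k in atTop, ∀ x ∈ σ.lift '' T' (κ k),
      η < ∫ z, g z.pt ∂(empirical f (n (κ k)) x : Measure (ProjTangent M)) := by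
    by_contra hcon
    classical
    let ξ' : ℕ → ProjTangent M := fun k ↦ if h : ∃ x ∈ σ.lift '' T' (κ k),
      ∫ z, g z.pt ∂(empirical f (n (κ k)) x : Measure (ProjTangent M)) ≤ η then h.choose
      else ξ (κ k)
    have hξ' : ∀ k, ξ' k ∈ σ.lift '' T' (κ k) := fun k ↦ by
      by_cases h : ∃ x ∈ σ.lift '' T' (κ k),
        ∫ z, g z.pt ∂(empirical f (n (κ k)) x : Measure (ProjTangent M)) ≤ η
      · simp only [ξ', dif_pos h]
        exact h.choose_spec.1
      · simp only [ξ', dif_neg h]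
        exact hξ _
    have h1 := tendsto_integral_of_continuous
      (hsel.tendsto_empirical hd hξ hξ' hκ hdec.tendsto) hgc
    apply hcon
    filter_upwards [h1.eventually_const_lt (by linarith : η < _)] with k hk x hx
    by_contra hx'
    have h : ∃ x ∈ σ.lift '' T' (κ k),
      ∫ z, g z.pt ∂(empirical f (n (κ k)) x : Measure (ProjTangent M)) ≤ η :=
      ⟨x, hx, not_lt.1 hx'⟩
    simp only [ξ', dif_pos h] at hk
    exact absurd h.choose_spec.2 (not_le.2 hk)
  have hasym := eventually_mul_rpow_lt_pow (C := C) hη0 (m := m) (by exact_mod_cast hm)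
    hr.tendsto_ρ hsel.tendsto_n
  obtain ⟨k, hk1, hk2, hk3⟩ := (hev.and ((hκ.tendsto_atTop.eventually hasym).and
    ((hsel.tendsto_n.comp hκ.tendsto_atTop).eventually_gt_atTop 0))).exists
  have hk3 : 0 < n (κ k) := hk3
  set a := ⌊η * n (κ k)⌋₊ with ha
  have hsub : T' (κ k) ⊆ {s : unitInterval | ∃ i ≥ (a / m) * m, f^[i] (σ.toFun s) ∈ U} := by
    intro s hs
    obtain ⟨i, hi, hiV⟩ := exists_visit_of_integral_empirical (f := f) (n := n (κ k))
      (x := σ.lift s) (g := g) g.continuous (U := V) (fun y hy ↦ hg0 hy) (fun y ↦ (hg01 y).2)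
      (a := a) (by
        have h1 := hk1 _ ⟨s, hs, rfl⟩
        have h2 : (a : ℝ) ≤ η * n (κ k) := Nat.floor_le (by positivity)
        have h3 : (0 : ℝ) < n (κ k) := by exact_mod_cast hk3
        nlinarith)
    exact ⟨i, (Nat.div_mul_le_self a m).trans hi, hVU hiV⟩
  have h1 : (volume : Measure unitInterval).real (T' (κ k)) ≤ C * (3 / 4 : ℝ) ^ (a / m) := by
    have h2 := (measure_mono hsub).trans (hvol (a / m))
    rw [← ENNReal.coe_pow, ← ENNReal.coe_mul] at h2
    have h3 := ENNReal.toReal_mono ENNReal.coe_ne_top h2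
    simpa [Measure.real] using h3
  have h2 : (3 / 4 : ℝ) ^ (a / m) ≤ (3 / 4 : ℝ) ^ (η * n (κ k) / m - 2) := by
    rw [← Real.rpow_natCast]
    refine Real.rpow_le_rpow_of_exponent_ge (by norm_num) (by norm_num) ?_
    have hm' : (1 : ℝ) ≤ m := by exact_mod_cast hm
    have e1 : η * n (κ k) < a + 1 := Nat.lt_floor_add_one _
    have e2 : (a : ℝ) < m * ((a / m : ℕ) + 1) := by
      exact_mod_cast Nat.lt_mul_div_succ a hm
    rw [sub_le_iff_le_add, div_le_iff₀ (by linarith)]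
    nlinarith
  have h3 := hsel.large' (κ k)
  have h4 : (C : ℝ) * (3 / 4 : ℝ) ^ (a / m) ≤ C * (3 / 4 : ℝ) ^ (η * n (κ k) / m - 2) := by gcongr
  linarith

end Selection

/-! ### Invariant measures that are expanding in all directions -/

section Expanding

variable {M : Type*} [TopologicalSpace M] [ChartedSpace Plane M] [IsManifold (𝓡 2) ∞ M]
  [RiemannianBundle (fun x : M ↦ TangentSpace (𝓡 2) x)]

/-- The logarithm of the smallest expansion of the tangent vectors at `x` under `f^[n]`. -/
def logConorm (f : Diffeomorph (𝓡 2) (𝓡 2) M M ∞) (n : ℕ) (x : M) : ℝ :=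
  -Real.log ‖mfderiv (𝓡 2) (𝓡 2) f.symm^[n] (f^[n] x)‖

theorem norm_mfderiv_iterate_pos (f : Diffeomorph (𝓡 2) (𝓡 2) M M ∞) (n : ℕ) (x : M) :
    0 < ‖mfderiv (𝓡 2) (𝓡 2) f^[n] x‖ := by
  obtain ⟨ξ, rfl⟩ := ProjTangent.exists_pt_eq x
  exact (lineNorm_iterate_pos f n ξ).trans_le (lineNorm_le_norm_mfderiv _ ξ)

theorem exp_neg_logConorm (f : Diffeomorph (𝓡 2) (𝓡 2) M M ∞) {n : ℕ} {x y : M}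
    (hy : f^[n] x = y) :
    Real.exp (-logConorm f n x) = ‖mfderiv (𝓡 2) (𝓡 2) f.symm^[n] y‖ := by
  subst hy
  rw [logConorm, neg_neg, Real.exp_log (norm_mfderiv_iterate_pos f.symm n _)]

theorem norm_mfderiv_comp_le {g h : M → M} (hg : MDifferentiable (𝓡 2) (𝓡 2) g)
    (hh : MDifferentiable (𝓡 2) (𝓡 2) h) {x y : M} (hy : h x = y) :
    ‖mfderiv (𝓡 2) (𝓡 2) (g ∘ h) x‖ ≤
      ‖mfderiv (𝓡 2) (𝓡 2) g y‖ * ‖mfderiv (𝓡 2) (𝓡 2) h x‖ := by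
  subst hy
  rw [mfderiv_comp x (hg _) (hh _)]
  exact ContinuousLinearMap.opNorm_comp_le _ _

/-- Superadditivity of the conorm, dual to the submultiplicativity of the norms of the inverse
derivatives. -/
theorem birkhoffSum_logConorm_le (f : Diffeomorph (𝓡 2) (𝓡 2) M M ∞) (m n : ℕ) (x : M) :
    birkhoffSum f^[m] (logConorm f m) n x ≤ logConorm f (m * n) x := by
  induction n with
  | zero =>
    rw [birkhoffSum_zero, logConorm, mul_zero, Left.nonneg_neg_iff]
    refine Real.log_nonpos (ContinuousLinearMap.opNorm_nonneg _)
      (ContinuousLinearMap.opNorm_le_bound _ zero_le_one fun v ↦ ?_)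
    rw [one_mul]
    have : mfderiv (𝓡 2) (𝓡 2) f.symm^[0] (f^[0] x) v = v :=
      congrArg (fun A : TangentSpace (𝓡 2) x →L[ℝ] TangentSpace (𝓡 2) x ↦ A v) mfderiv_id
    exact (congrArg norm this).le
  | succ n ih =>
    rw [birkhoffSum_succ]
    have e : f.symm^[m] (f^[m * (n + 1)] x) = f^[m * n] x := by
      rw [Nat.mul_succ, add_comm, Function.iterate_add_apply]
      exact congrFun (iterate_symm_comp_iterate f m) _
    have h := norm_mfderiv_comp_le (mdifferentiable_iterate f.symm (m * n))
      (mdifferentiable_iterate f.symm m) e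
    rw [← Function.iterate_add, ← Nat.mul_succ] at h
    have e2 : f^[m * (n + 1)] x = f^[m] ((f^[m])^[n] x) := by
      rw [← Function.iterate_mul, ← Function.iterate_add_apply, Nat.mul_succ, add_comm]
    have h2 := Real.log_le_log (norm_mfderiv_iterate_pos f.symm _ _) h
    rw [Real.log_mul (norm_mfderiv_iterate_pos f.symm _ _).ne'
      (norm_mfderiv_iterate_pos f.symm _ _).ne'] at h2
    rw [logConorm] at ih
    have h3 : logConorm f m ((f^[m])^[n] x) =
        -Real.log ‖mfderiv (𝓡 2) (𝓡 2) f.symm^[m] (f^[m * (n + 1)] x)‖ := by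
      rw [logConorm, ← e2]
    rw [h3, logConorm]
    linarith

theorem planeDeriv_symm_iterate_apply (f : Diffeomorph (𝓡 2) (𝓡 2) M M ∞) {n : ℕ} {p : M}
    (hp : f^[n] p = p) (v : Plane) :
    planeDeriv f.symm^[n] p (planeDeriv f^[n] p v) = v := by
  have h := planeDeriv_comp (mdifferentiable_iterate f.symm n) (mdifferentiable_iterate f n) p
  rw [iterate_symm_comp_iterate, planeDeriv_id, hp] at h
  exact congr($h v).symm

theorem isRepellingPeriodic_of_logConorm_pos (f : Diffeomorph (𝓡 2) (𝓡 2) M M ∞) {n : ℕ}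
    (hn : 0 < n) {p : M} (hp : f^[n] p = p) (h : 0 < logConorm f n p) :
    IsRepellingPeriodic f p := by
  refine ⟨n, hn, hp, fun z hz ↦ ?_⟩
  let e : Plane →ₗ[ℝ] TangentSpace (𝓡 2) p := LinearMap.id (R := ℝ) (M := Plane)
  have hp' : f.symm^[n] p = p := by
    conv_lhs => rw [← hp]
    exact congrFun (iterate_symm_comp_iterate f n) p
  refine one_lt_norm_of_expanding _ e (fun v w h ↦ h) (Real.one_lt_exp_iff.2 h) (fun v ↦ ?_) hz
  change Real.exp (logConorm f n p) * planeNorm p v ≤ planeNorm p (planeDeriv f^[n] p v)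
  have h1 : planeNorm (f.symm^[n] p) (planeDeriv f.symm^[n] p (planeDeriv f^[n] p v)) ≤
      Real.exp (-logConorm f n p) * planeNorm p (planeDeriv f^[n] p v) := by
    rw [exp_neg_logConorm f hp]
    exact (mfderiv (𝓡 2) (𝓡 2) f.symm^[n] p).le_opNorm _
  rw [hp', planeDeriv_symm_iterate_apply f hp, Real.exp_neg, inv_mul_eq_div,
    le_div_iff₀ (Real.exp_pos _), mul_comm] at h1
  exact h1

variable [IsContinuousRiemannianBundle Plane (fun x : M ↦ TangentSpace (𝓡 2) x)]
  [T2Space M] [CompactSpace M]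

theorem continuous_log_norm_mfderiv_iterate (f : Diffeomorph (𝓡 2) (𝓡 2) M M ∞) (n : ℕ) :
    Continuous fun x : M ↦ Real.log ‖mfderiv (𝓡 2) (𝓡 2) f^[n] x‖ :=
  (continuous_norm_mfderiv (contMDiff_iterate f n)).log
    fun x ↦ (norm_mfderiv_iterate_pos f n x).ne'

theorem continuous_logConorm (f : Diffeomorph (𝓡 2) (𝓡 2) M M ∞) (n : ℕ) :
    Continuous (logConorm f n) :=
  ((continuous_log_norm_mfderiv_iterate f.symm n).comp (f.continuous.iterate n)).neg

/-- At a record time n of the sums of `logConorm - δ`, going j blocks back contracts infinitesimally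
by at least exp(-jδ). Half of δ is spent on the variation of the derivative within distance r, so a
true contraction exp(-jδ/2) remains. In particular the backward orbit never leaves the r-balls where
this variation is controlled, and the induction closes. -/
theorem riemannianEDist_backward_le (f : Diffeomorph (𝓡 2) (𝓡 2) M M ∞) {m : ℕ} {δ : ℝ}
    (hδ : 0 < δ) {r : ℝ≥0} (hr : ∀ y z : M, riemannianEDist (𝓡 2) y z < r →
      |Real.log ‖mfderiv (𝓡 2) (𝓡 2) f.symm^[m] y‖ -
        Real.log ‖mfderiv (𝓡 2) (𝓡 2) f.symm^[m] z‖| < δ / 2) {x : M} {n : ℕ}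
    (hn : ∀ j ≤ n, birkhoffSum f^[m] (fun y ↦ logConorm f m y - δ) j x ≤
      birkhoffSum f^[m] (fun y ↦ logConorm f m y - δ) n x) {z : M}
    (hz : riemannianEDist (𝓡 2) ((f^[m])^[n] x) z < r) :
    riemannianEDist (𝓡 2) x ((f.symm^[m])^[n] z) ≤ ENNReal.ofReal (Real.exp (-(n * (δ / 2)))) * r := by
  set S := fun j ↦ birkhoffSum f^[m] (fun y ↦ logConorm f m y - δ) j x with hS
  have key : ∀ j ≤ n, riemannianEDist (𝓡 2) ((f^[m])^[n - j] x) ((f.symm^[m])^[j] z) ≤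
      ENNReal.ofReal (Real.exp (-(j * (δ / 2)) - (S n - S (n - j)))) *
        riemannianEDist (𝓡 2) ((f^[m])^[n] x) z := by
    intro j
    induction j with
    | zero => simp
    | succ j ih =>
      intro hj
      have ih := ih (Nat.le_of_succ_le hj)
      have hle : Real.exp (-(j * (δ / 2)) - (S n - S (n - j))) ≤ 1 := by
        rw [Real.exp_le_one_iff]
        have h1 : S (n - j) ≤ S n := hn _ (Nat.sub_le _ _)
        have h2 : 0 ≤ j * (δ / 2) := by positivity
        linarith
      have hlt : riemannianEDist (𝓡 2) ((f^[m])^[n - j] x) ((f.symm^[m])^[j] z) < r :=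
        (ih.trans (mul_le_of_le_one_left zero_le (ENNReal.ofReal_le_one.2 hle))).trans_lt hz
      obtain ⟨i, hi⟩ : ∃ i, n - j = i + 1 := ⟨n - (j + 1), by omega⟩
      have hi' : n - (j + 1) = i := by omega
      rw [hi']
      rw [hi] at ih hlt
      set y := (f^[m])^[i + 1] x with hy
      have hGy : f.symm^[m] y = (f^[m])^[i] x := by
        rw [hy, Function.iterate_succ_apply']
        exact congrFun (iterate_symm_comp_iterate f m) _
      have hSi : S (i + 1) = S i + (logConorm f m ((f^[m])^[i] x) - δ) := birkhoffSum_succ ..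
      have hlog : Real.log ‖mfderiv (𝓡 2) (𝓡 2) f.symm^[m] y‖ =
          -logConorm f m ((f^[m])^[i] x) := by
        rw [logConorm, neg_neg, hy, Function.iterate_succ_apply']
      have hstep := riemannianEDist_map_le (contMDiff_iterate f.symm m) (y := y) (r := r)
        (c := (Real.exp (-logConorm f m ((f^[m])^[i] x) + δ / 2)).toNNReal) (fun w hw ↦ by
          rw [Real.coe_toNNReal _ (Real.exp_pos _).le,
            ← Real.log_le_iff_le_exp (norm_mfderiv_iterate_pos f.symm m w), ← hlog]
          linarith [(abs_lt.1 (hr y w hw)).1]) hlt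
      rw [hGy] at hstep
      rw [Function.iterate_succ_apply']
      refine hstep.trans ((mul_le_mul_right ih _).trans (le_of_eq ?_))
      rw [← mul_assoc]
      congr 1
      change ENNReal.ofReal _ * ENNReal.ofReal _ = _
      rw [← ENNReal.ofReal_mul (Real.exp_pos _).le, ← Real.exp_add]
      congr 2
      rw [hSi]
      push_cast
      ring
  have h := key n le_rfl
  rw [Nat.sub_self, Function.iterate_zero, id] at h
  refine h.trans (mul_le_mul' (ENNReal.ofReal_le_ofReal (Real.exp_le_exp.2 ?_)) hz.le)
  have h0 : S 0 ≤ S n := hn 0 (Nat.zero_le _)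
  linarith

variable [MeasurableSpace M] [BorelSpace M]

theorem le_measure_singleton_of_frequently {ν : Measure M} [IsFiniteMeasure ν] {x : M}
    {ε : ℕ → ENNReal} (hε : Tendsto ε atTop (𝓝 0)) {c : ENNReal}
    (h : ∃ᶠ n in atTop, c ≤ ν {y | riemannianEDist (𝓡 2) x y ≤ ε n}) : c ≤ ν {x} := by
  have : IsManifold (𝓡 2) 1 M := .of_le (n := ∞) (by simp)
  let : PseudoEMetricSpace M := .ofRiemannianMetric (𝓡 2) M
  have ht := tendsto_measure_cthickening_of_isClosed (μ := ν) (s := {x})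
    ⟨1, one_pos, measure_ne_top _ _⟩ isClosed_singleton
  refine ge_of_tendsto (ht.mono_left (nhdsWithin_le_nhds (s := Set.Ioi 0))) ?_
  filter_upwards [self_mem_nhdsWithin] with t ht0
  obtain ⟨n, hn1, hn2⟩ := (h.and_eventually
    (hε.eventually_lt_const (ENNReal.ofReal_pos.2 ht0))).exists
  refine hn1.trans (measure_mono fun y hy ↦ ?_)
  rw [Metric.mem_cthickening_iff, Metric.infEDist_singleton, edist_comm]
  exact (le_trans hy hn2.le : riemannianEDist (𝓡 2) x y ≤ _)

/-- Cover M by finitely many balls of radius r/2 and discard those of measure zero. A remaining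
point lies in a ball of positive measure, contained in the r-ball around that point. -/
theorem exists_null_forall_le_measure_ball {ν : Measure M} {r : ℝ≥0} (hr : 0 < r) :
    ∃ c > 0, ∃ Z : Set M, MeasurableSet Z ∧ ν Z = 0 ∧
      ∀ y ∉ Z, c ≤ ν {z | riemannianEDist (𝓡 2) y z < r} := by
  have : IsManifold (𝓡 2) 1 M := .of_le (n := ∞) (by simp)
  let : PseudoEMetricSpace M := .ofRiemannianMetric (𝓡 2) M
  have hr2 : (0 : ENNReal) < (r / 2 : ℝ≥0) := by exact_mod_cast half_pos hr
  obtain ⟨F, -, hF⟩ := isCompact_univ.elim_nhds_subcover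
    (fun y : M ↦ Metric.eball y ((r / 2 : ℝ≥0) : ENNReal)) fun y _ ↦ Metric.eball_mem_nhds y hr2
  classical
  let P := F.filter fun y ↦ ν (Metric.eball y ((r / 2 : ℝ≥0) : ENNReal)) ≠ 0
  let Q := F.filter fun y ↦ ν (Metric.eball y ((r / 2 : ℝ≥0) : ENNReal)) = 0
  obtain ⟨c, hc, hcP⟩ : ∃ c > 0, ∀ y ∈ P,
      c ≤ ν (Metric.eball y ((r / 2 : ℝ≥0) : ENNReal)) := by
    refine ⟨P.inf fun y ↦ ν (Metric.eball y ((r / 2 : ℝ≥0) : ENNReal)), ?_,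
      fun y hy ↦ Finset.inf_le hy⟩
    rw [gt_iff_lt, Finset.lt_inf_iff (by simp)]
    exact fun y hy ↦ pos_iff_ne_zero.2 (Finset.mem_filter.1 hy).2
  refine ⟨c, hc, ⋃ y ∈ Q, Metric.eball y ((r / 2 : ℝ≥0) : ENNReal),
    Q.measurableSet_biUnion fun y _ ↦ Metric.isOpen_eball.measurableSet,
    (measure_biUnion_null_iff Q.countable_toSet).2 fun y hy ↦ (Finset.mem_filter.1 hy).2,
    fun y hy ↦ ?_⟩
  obtain ⟨w, hw, hyw⟩ := Set.mem_iUnion₂.1 (hF (Set.mem_univ y))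
  have hwP : w ∈ P := by
    refine Finset.mem_filter.2 ⟨hw, fun h0 ↦ hy ?_⟩
    exact Set.mem_iUnion₂.2 ⟨w, Finset.mem_filter.2 ⟨hw, h0⟩, hyw⟩
  refine (hcP w hwP).trans (measure_mono fun z hz ↦ ?_)
  have h1 : edist y z ≤ edist y w + edist w z := edist_triangle _ _ _
  have h2 : edist y w < (r / 2 : ℝ≥0) := hyw
  have h3 : edist w z < (r / 2 : ℝ≥0) := by rw [edist_comm]; exact hz
  have h4 : edist y z < r := by
    refine h1.trans_lt ((ENNReal.add_lt_add h2 h3).trans_eq ?_)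
    rw [← ENNReal.coe_add, add_halves]
  exact h4

/-- At infinitely many record times, an r-ball around f^(mn)(x), of measure at least c, is pulled
back into an exponentially small ball around x. Invariance then gives ν{x} ≥ c. Poincaré recurrence
makes the atom x periodic, and positive averages of the conorm make its orbit repelling. -/
theorem exists_isRepellingPeriodic_of_integral_logConorm_pos
    {f : Diffeomorph (𝓡 2) (𝓡 2) M M ∞} {ν : Measure M} [IsFiniteMeasure ν]
    (hν : MeasurePreserving f ν ν) {m : ℕ} (hm : 0 < m) (h : 0 < ∫ x, logConorm f m x ∂ν) :
    ∃ p, IsRepellingPeriodic f p ∧ ν {p} ≠ 0 := by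
  have hg := hν.iterate m
  have hmeas := (continuous_logConorm f m).measurable
  obtain ⟨C, hC⟩ := isCompact_univ.exists_bound_of_continuousOn
    (continuous_logConorm f m).continuousOn
  have hC : ∀ x, |logConorm f m x| ≤ C := fun x ↦ hC x trivial
  obtain ⟨δ, hδ, hδν⟩ : ∃ δ > 0, δ * ν.real Set.univ < ∫ x, logConorm f m x ∂ν := by
    refine ⟨(∫ x, logConorm f m x ∂ν) / (ν.real Set.univ + 1), by positivity, ?_⟩
    rw [div_mul_eq_mul_div, div_lt_iff₀ (by positivity)]
    have : 0 ≤ ν.real Set.univ := measureReal_nonneg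
    nlinarith
  have hlim := ae_exists_tendsto_average hg hmeas hC
  have hfreq : ∃ᵐ x ∂ν, ∃ l > δ,
      Tendsto (fun n : ℕ ↦ 1 / (n : ℝ) * birkhoffSum f^[m] (logConorm f m) n x) atTop (𝓝 l) := by
    intro hcon
    let l : M → ℝ := fun x ↦
      limsup (fun n : ℕ ↦ 1 / (n : ℝ) * birkhoffSum f^[m] (logConorm f m) n x) atTop
    have hl : ∀ᵐ x ∂ν, Tendsto (fun n : ℕ ↦ 1 / (n : ℝ) *
        birkhoffSum f^[m] (logConorm f m) n x) atTop (𝓝 (l x)) := by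
      filter_upwards [hlim] with x hx
      obtain ⟨a, ha⟩ := hx
      rwa [show l x = a from ha.limsup_eq]
    have hle : ∀ᵐ x ∂ν, l x ≤ δ := by
      filter_upwards [hl, hcon] with x hx1 hx2
      by_contra hlt
      exact hx2 ⟨l x, not_le.1 hlt, hx1⟩
    rw [integral_eq_of_ae_tendsto_average hg hmeas hC hl] at hδν
    have hint : Integrable l ν := integrable_of_abs_le
      (measurable_limsup_average hg.measurable hmeas) (C := C) fun x ↦ by
        rw [abs_le]
        refine ⟨le_limsup_of_frequently_le (Eventually.of_forall fun n ↦
          (abs_le.1 (abs_average_le hC n x)).1).frequently (isBoundedUnder_le_average hC x),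
          limsup_le_of_le (isBoundedUnder_ge_average hC x).isCoboundedUnder_flip
          (Eventually.of_forall fun n ↦ (abs_le.1 (abs_average_le hC n x)).2)⟩
    have := integral_mono_ae hint (integrable_const δ) hle
    rw [integral_const, smul_eq_mul] at this
    linarith
  obtain ⟨r, hr, hunif⟩ := exists_forall_riemannianEDist_lt
    (continuous_log_norm_mfderiv_iterate f.symm m) (ε := δ / 2 / 2) (by positivity)
  obtain ⟨c, hc, Z, hZm, hZ0, hZ⟩ := exists_null_forall_le_measure_ball (ν := ν) hr
  have hZ' : ∀ᵐ x ∂ν, ∀ n : ℕ, (f^[m])^[n] x ∉ Z := by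
    rw [ae_all_iff]
    intro n
    have := (hg.iterate n).measure_preimage hZm.nullMeasurableSet
    rw [hZ0] at this
    exact measure_eq_zero_iff_ae_notMem.1 this
  obtain ⟨x, ⟨l, hl, hx⟩, hxZ⟩ := (hfreq.and_eventually hZ').exists
  -- The averages of `logConorm` tend to l > δ, so after subtracting δ/2 they still exceed δ/2, as
  -- the existence of records requires.
  have hrec : ∃ᶠ n : ℕ in atTop,
      ∀ j ≤ n, birkhoffSum f^[m] (fun y ↦ logConorm f m y - δ / 2) j x ≤
        birkhoffSum f^[m] (fun y ↦ logConorm f m y - δ / 2) n x := by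
    refine (frequently_record (l := δ / 2) (by positivity) ?_).mono fun n hn ↦ hn.2
    refine Eventually.frequently ?_
    filter_upwards [hx.eventually_const_lt hl, eventually_gt_atTop 0] with n hn hn0
    have hn' : (n : ℝ) ≠ 0 := by exact_mod_cast hn0.ne'
    have e : birkhoffSum f^[m] (fun y ↦ logConorm f m y - δ / 2) n x =
        birkhoffSum f^[m] (logConorm f m) n x - n * (δ / 2) := by
      simp [birkhoffSum, Finset.sum_sub_distrib]
    rw [e, mul_sub, ← mul_assoc, one_div_mul_cancel hn', one_mul]
    linarith
  have hε : Tendsto (fun n : ℕ ↦ ENNReal.ofReal (Real.exp (-(n * (δ / 2 / 2)))) * r) atTop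
      (𝓝 0) := by
    have h1 : Tendsto (fun n : ℕ ↦ Real.exp (-(n * (δ / 2 / 2)))) atTop (𝓝 0) :=
      Real.tendsto_exp_neg_atTop_nhds_zero.comp
        (tendsto_natCast_atTop_atTop.atTop_mul_const (by positivity))
    have h2 := ENNReal.Tendsto.mul_const (ENNReal.tendsto_ofReal h1)
      (Or.inr (ENNReal.coe_ne_top (r := r)))
    simpa using h2
  have hatom : c ≤ ν {x} := by
    refine le_measure_singleton_of_frequently hε (hrec.mono fun n hn ↦ ?_)
    have : IsManifold (𝓡 2) 1 M := .of_le (n := ∞) (by simp)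
    let : PseudoEMetricSpace M := .ofRiemannianMetric (𝓡 2) M
    have hopen : IsOpen {z | riemannianEDist (𝓡 2) ((f^[m])^[n] x) z < r} := by
      have : {z | riemannianEDist (𝓡 2) ((f^[m])^[n] x) z < r} =
          Metric.eball ((f^[m])^[n] x) r := by
        ext z
        rw [Metric.mem_eball, edist_comm]
        rfl
      rw [this]
      exact Metric.isOpen_eball
    refine (hZ _ (hxZ n)).trans ?_
    rw [← (hg.iterate n).measure_preimage hopen.measurableSet.nullMeasurableSet]
    refine measure_mono fun w hw ↦ ?_
    have := riemannianEDist_backward_le f (half_pos hδ) hunif hn hw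
    have e : (f.symm^[m])^[n] ((f^[m])^[n] w) = w := by
      rw [← Function.iterate_mul, ← Function.iterate_mul]
      exact congrFun (iterate_symm_comp_iterate f _) w
    rwa [e] at this
  have hne : ν {x} ≠ 0 := (hc.trans_le hatom).ne'
  refine ⟨x, ?_, hne⟩
  obtain ⟨y, hy, k, hk0, hk⟩ := hν.exists_mem_iterate_mem
    (measurableSet_singleton x).nullMeasurableSet hne
  rw [Set.mem_singleton_iff] at hy hk
  subst hy
  -- Positivity of the Birkhoff sum is only known for large times, so a large multiple of the period
  -- is taken.
  have htend : Tendsto (fun i : ℕ ↦ k * (i + 1)) atTop atTop :=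
    (tendsto_add_atTop_nat 1).const_mul_atTop' (Nat.pos_of_ne_zero hk0)
  obtain ⟨i, hi⟩ := ((hx.comp htend).eventually_const_lt (hδ.trans hl)).exists
  have hpos : 0 < k * (i + 1) := Nat.mul_pos (Nat.pos_of_ne_zero hk0) (Nat.succ_pos i)
  have hS : 0 < birkhoffSum f^[m] (logConorm f m) (k * (i + 1)) y :=
    pos_of_mul_pos_right hi (by positivity)
  refine isRepellingPeriodic_of_logConorm_pos f (n := m * (k * (i + 1))) (Nat.mul_pos hm hpos) ?_
    (hS.trans_le (birkhoffSum_logConorm_le f m _ y))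
  have : Function.IsPeriodicPt f k y := hk
  exact (this.mul_const (i + 1)).const_mul m

end Expanding

/-! ### Areas in inner product spaces of dimension two -/

section Gram

variable {V W : Type*} [NormedAddCommGroup V] [InnerProductSpace ℝ V]
  [NormedAddCommGroup W] [InnerProductSpace ℝ W]

/-- The Gram determinant of two vectors. -/
def gram (v w : V) : ℝ := ‖v‖ ^ 2 * ‖w‖ ^ 2 - inner ℝ v w ^ 2

theorem gram_le (v w : V) : gram v w ≤ ‖v‖ ^ 2 * ‖w‖ ^ 2 := by
  rw [gram]
  linarith [sq_nonneg (inner ℝ v w : ℝ)]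

theorem gram_combination (e₁ e₂ : V) (a b c d : ℝ) :
    gram (a • e₁ + b • e₂) (c • e₁ + d • e₂) = (a * d - b * c) ^ 2 * gram e₁ e₂ := by
  simp only [gram, ← real_inner_self_eq_norm_sq, inner_add_left, inner_add_right,
    real_inner_smul_left, real_inner_smul_right, real_inner_comm e₁ e₂]
  ring

theorem norm_sub_smul_sq_mul (u w : V) (hu : u ≠ 0) :
    ‖w - (inner ℝ w u / ‖u‖ ^ 2) • u‖ ^ 2 * ‖u‖ ^ 2 = gram u w := by
  have hu' : ‖u‖ ≠ 0 := norm_ne_zero_iff.2 hu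
  rw [norm_sub_sq_real, real_inner_smul_right, norm_smul, mul_pow, Real.norm_eq_abs, sq_abs, gram,
    real_inner_comm w u]
  field_simp
  ring

theorem exists_orthogonal_unit (hV : Module.finrank ℝ V = 2) {v₀ : V} (hv₀ : ‖v₀‖ = 1) :
    ∃ w₀ : V, ‖w₀‖ = 1 ∧ inner ℝ v₀ w₀ = (0 : ℝ) ∧ ∀ v, ∃ a b : ℝ, v = a • v₀ + b • w₀ := by
  have hfd : FiniteDimensional ℝ V := Module.finite_of_finrank_pos (by omega)
  have hv : v₀ ≠ 0 := norm_ne_zero_iff.1 (by rw [hv₀]; exact one_ne_zero)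
  obtain ⟨w, hw⟩ : ∃ w, w ∉ Submodule.span ℝ {v₀} := by
    by_contra! hcon
    have h1 : Submodule.span ℝ {v₀} = ⊤ := Submodule.eq_top_iff'.2 hcon
    have h2 := finrank_span_singleton (K := ℝ) hv
    rw [h1, finrank_top, hV] at h2
    norm_num at h2
  set w₁ := w - (inner ℝ v₀ w : ℝ) • v₀ with hw₁
  have hw₁0 : w₁ ≠ 0 := by
    intro h0
    exact hw (Submodule.mem_span_singleton.2 ⟨inner ℝ v₀ w, (sub_eq_zero.1 h0).symm⟩)
  have horth : inner ℝ v₀ w₁ = (0 : ℝ) := by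
    rw [hw₁, inner_sub_right, real_inner_smul_right, real_inner_self_eq_norm_sq, hv₀]
    ring
  have horth' : inner ℝ v₀ (‖w₁‖⁻¹ • w₁) = (0 : ℝ) := by
    rw [real_inner_smul_right, horth, mul_zero]
  have hnorm : ‖‖w₁‖⁻¹ • w₁‖ = 1 := by
    rw [norm_smul, norm_inv, norm_norm, inv_mul_cancel₀ (norm_ne_zero_iff.2 hw₁0)]
  refine ⟨‖w₁‖⁻¹ • w₁, hnorm, horth', fun v ↦ ?_⟩
  have hon : Orthonormal ℝ ![v₀, ‖w₁‖⁻¹ • w₁] := by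
    rw [orthonormal_iff_ite]
    intro i j
    fin_cases i <;> fin_cases j <;>
      simp [horth', hv₀, hnorm, real_inner_comm v₀]
  have hspan := hon.linearIndependent.span_eq_top_of_card_eq_finrank (by simp [hV])
  have hmem : v ∈ Submodule.span ℝ (Set.range ![v₀, ‖w₁‖⁻¹ • w₁]) := by
    rw [hspan]
    trivial
  rw [Matrix.range_cons, Matrix.range_cons, Matrix.range_empty, Set.union_empty,
    Set.singleton_union, Submodule.mem_span_pair] at hmem
  obtain ⟨a, b, hab⟩ := hmem
  exact ⟨a, b, hab.symm⟩

/-- First variation: the norm of A is attained at v₀, so the derivative of ‖A(v₀ + t w₀)‖² at t = 0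
vanishes. -/
theorem inner_map_eq_zero_of_norm_eq (A : V →L[ℝ] W) {v₀ w₀ : V} (hv₀ : ‖v₀‖ = 1)
    (hw₀ : ‖w₀‖ = 1) (hvw : inner ℝ v₀ w₀ = (0 : ℝ)) (hmax : ‖A v₀‖ = ‖A‖) :
    inner ℝ (A v₀) (A w₀) = (0 : ℝ) := by
  have key : ∀ t : ℝ, 2 * t * inner ℝ (A v₀) (A w₀) ≤ t ^ 2 * ‖A‖ ^ 2 := by
    intro t
    have h1 : ‖A (v₀ + t • w₀)‖ ^ 2 ≤ ‖A‖ ^ 2 * ‖v₀ + t • w₀‖ ^ 2 := by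
      rw [← mul_pow]
      gcongr
      exact A.le_opNorm _
    have h2 : ‖v₀ + t • w₀‖ ^ 2 = 1 + t ^ 2 := by
      rw [norm_add_sq_real, real_inner_smul_right, hvw, norm_smul, hv₀, hw₀, Real.norm_eq_abs,
        mul_pow, sq_abs]
      ring
    have h3 : ‖A (v₀ + t • w₀)‖ ^ 2 = ‖A‖ ^ 2 + 2 * t * inner ℝ (A v₀) (A w₀) +
        t ^ 2 * ‖A w₀‖ ^ 2 := by
      rw [map_add, map_smul, norm_add_sq_real, real_inner_smul_right, hmax, norm_smul,
        Real.norm_eq_abs, mul_pow, sq_abs]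
      ring
    rw [h2, h3] at h1
    nlinarith [sq_nonneg (t * ‖A w₀‖)]
  set s : ℝ := inner ℝ (A v₀) (A w₀) with hs
  have h := key (s / (‖A‖ ^ 2 + 1))
  have hpos : 0 < ‖A‖ ^ 2 + 1 := by positivity
  by_contra hne
  have hs2 : 0 < s ^ 2 := by positivity
  rw [div_pow, show 2 * (s / (‖A‖ ^ 2 + 1)) * s = 2 * s ^ 2 * (‖A‖ ^ 2 + 1) / (‖A‖ ^ 2 + 1) ^ 2 by
    field_simp, div_mul_eq_mul_div, div_le_div_iff_of_pos_right (by positivity)] at h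
  nlinarith [sq_nonneg ‖A‖, mul_nonneg hs2.le (sq_nonneg ‖A‖)]

/-- The singular values of A are ‖A‖ and 1/‖B‖, and the area is multiplied by their product. The
maximizing vector and its orthogonal complement form a singular basis. -/
theorem gram_map (hV : Module.finrank ℝ V = 2) (A : V →L[ℝ] W) (B : W →L[ℝ] V)
    (hBA : ∀ v, B (A v) = v) (hAB : ∀ w, A (B w) = w) {v₁ : V} (hv₁ : v₁ ≠ 0)
    (hmax : ‖A v₁‖ = ‖A‖ * ‖v₁‖) (v w : V) :
    gram (A v) (A w) = (‖A‖ / ‖B‖) ^ 2 * gram v w := by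
  have hv₁' : ‖v₁‖ ≠ 0 := norm_ne_zero_iff.2 hv₁
  set v₀ := ‖v₁‖⁻¹ • v₁ with hv₀def
  have hv₀ : ‖v₀‖ = 1 := by
    rw [hv₀def, norm_smul, norm_inv, norm_norm, inv_mul_cancel₀ hv₁']
  have hmax₀ : ‖A v₀‖ = ‖A‖ := by
    rw [hv₀def, map_smul, norm_smul, norm_inv, norm_norm, hmax]
    field_simp
  clear_value v₀
  obtain ⟨w₀, hw₀, hvw, hspan⟩ := exists_orthogonal_unit hV hv₀
  have horth := inner_map_eq_zero_of_norm_eq A hv₀ hw₀ hvw hmax₀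
  have hAw : A w₀ ≠ 0 := by
    intro h0
    have := hBA w₀
    rw [h0, map_zero] at this
    rw [← this, norm_zero] at hw₀
    exact zero_ne_one hw₀
  have hAw' : 0 < ‖A w₀‖ := norm_pos_iff.2 hAw
  have hle : ‖A w₀‖ ≤ ‖A‖ := by
    have := A.le_opNorm w₀
    rwa [hw₀, mul_one] at this
  have hmin : ∀ v, ‖A w₀‖ * ‖v‖ ≤ ‖A v‖ := by
    intro v
    obtain ⟨a, b, rfl⟩ := hspan v
    have h1 : ‖a • v₀ + b • w₀‖ ^ 2 = a ^ 2 + b ^ 2 := by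
      rw [norm_add_sq_real, real_inner_smul_left, real_inner_smul_right, hvw, norm_smul, norm_smul,
        hv₀, hw₀, mul_one, mul_one, Real.norm_eq_abs, Real.norm_eq_abs, sq_abs, sq_abs]
      ring
    have h2 : ‖A (a • v₀ + b • w₀)‖ ^ 2 = a ^ 2 * ‖A‖ ^ 2 + b ^ 2 * ‖A w₀‖ ^ 2 := by
      rw [map_add, map_smul, map_smul, norm_add_sq_real, real_inner_smul_left,
        real_inner_smul_right, horth, norm_smul, norm_smul, hmax₀, mul_pow, mul_pow,
        Real.norm_eq_abs, Real.norm_eq_abs, sq_abs, sq_abs]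
      ring
    refine abs_le_of_sq_le_sq' ?_ (norm_nonneg _) |>.2
    rw [mul_pow, h1, h2]
    have : ‖A w₀‖ ^ 2 ≤ ‖A‖ ^ 2 := by gcongr
    nlinarith [sq_nonneg a]
  have hB : ‖B‖ = ‖A w₀‖⁻¹ := by
    refine le_antisymm (B.opNorm_le_bound (by positivity) fun u ↦ ?_) ?_
    · have := hmin (B u)
      rw [hAB] at this
      rw [inv_mul_eq_div, le_div_iff₀ hAw', mul_comm]
      exact this
    · have := B.le_opNorm (A w₀)
      rw [hBA, hw₀] at this
      rwa [inv_le_iff_one_le_mul₀ hAw']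
  obtain ⟨a, b, rfl⟩ := hspan v
  obtain ⟨c, d, rfl⟩ := hspan w
  simp only [map_add, map_smul]
  rw [gram_combination, gram_combination, gram, gram, horth, hvw, hmax₀, hv₀, hw₀, hB]
  field_simp
  ring

end Gram

/-! ### The Jacobian -/

section Jacobian

variable {M : Type*} [TopologicalSpace M] [ChartedSpace Plane M] [IsManifold (𝓡 2) ∞ M]
  [RiemannianBundle (fun x : M ↦ TangentSpace (𝓡 2) x)]

/-- The Gram determinant at `x` of two vectors of the model plane. -/
def planeGram (x : M) (v w : Plane) : ℝ := gram (V := TangentSpace (𝓡 2) x) v w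

/-- The logarithm of the Jacobian of `f^[n]` at `x`. -/
def logJacobian (f : Diffeomorph (𝓡 2) (𝓡 2) M M ∞) (n : ℕ) (x : M) : ℝ :=
  Real.log ‖mfderiv (𝓡 2) (𝓡 2) f^[n] x‖ + logConorm f n x

theorem finrank_tangentSpace (x : M) : Module.finrank ℝ (TangentSpace (𝓡 2) x) = 2 := by
  change Module.finrank ℝ Plane = 2
  simp

theorem exists_planeGram_pos (x : M) : ∃ v w : Plane, 0 < planeGram x v w := by
  obtain ⟨ξ, rfl⟩ := ProjTangent.exists_pt_eq x
  set v₁ : TangentSpace (𝓡 2) ξ.pt := ξ.line.rep with hv₁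
  have hv₁' : ‖v₁‖ ≠ 0 := norm_ne_zero_iff.2 ξ.line.rep_nonzero
  have hv₀ : ‖‖v₁‖⁻¹ • v₁‖ = 1 := by
    rw [norm_smul, norm_inv, norm_norm, inv_mul_cancel₀ hv₁']
  obtain ⟨w₀, hw₀, hvw, -⟩ := exists_orthogonal_unit (finrank_tangentSpace ξ.pt) hv₀
  refine ⟨‖v₁‖⁻¹ • v₁, w₀, ?_⟩
  change 0 < gram (‖v₁‖⁻¹ • v₁) w₀
  rw [gram, hv₀, hw₀, hvw]
  norm_num

variable [IsContinuousRiemannianBundle Plane (fun x : M ↦ TangentSpace (𝓡 2) x)]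
  [T2Space M] [CompactSpace M]

theorem planeGram_planeDeriv (f : Diffeomorph (𝓡 2) (𝓡 2) M M ∞) (n : ℕ) (x : M) (v w : Plane) :
    planeGram (f^[n] x) (planeDeriv f^[n] x v) (planeDeriv f^[n] x w) =
      Real.exp (2 * logJacobian f n x) * planeGram x v w := by
  have hx : f.symm^[n] (f^[n] x) = x := congrFun (iterate_symm_comp_iterate f n) x
  -- The inverse derivative lands in the tangent space at f^{-n}(f^n x), equal to x only
  -- propositionally; this transports it without changing its values or its norm.
  obtain ⟨B, hB⟩ : ∃ B : TangentSpace (𝓡 2) (f^[n] x) →L[ℝ] TangentSpace (𝓡 2) x,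
      (∀ v, B v = planeDeriv f.symm^[n] (f^[n] x) v) ∧
        ‖B‖ = ‖mfderiv (𝓡 2) (𝓡 2) f.symm^[n] (f^[n] x)‖ := by
    have aux : ∀ y, f.symm^[n] (f^[n] x) = y →
        ∃ B : TangentSpace (𝓡 2) (f^[n] x) →L[ℝ] TangentSpace (𝓡 2) y,
        (∀ v, B v = planeDeriv f.symm^[n] (f^[n] x) v) ∧
          ‖B‖ = ‖mfderiv (𝓡 2) (𝓡 2) f.symm^[n] (f^[n] x)‖ := by
      rintro y rfl
      exact ⟨_, fun _ ↦ rfl, rfl⟩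
    exact aux x hx
  obtain ⟨ξ, hξ, hmax⟩ := exists_lineNorm_eq_norm_mfderiv (contMDiff_iterate f n) x
  subst hξ
  have h1 := planeDeriv_comp (mdifferentiable_iterate f.symm n) (mdifferentiable_iterate f n) ξ.pt
  have h2 := planeDeriv_comp (mdifferentiable_iterate f n) (mdifferentiable_iterate f.symm n)
    (f^[n] ξ.pt)
  rw [iterate_symm_comp_iterate, planeDeriv_id] at h1
  rw [iterate_comp_iterate_symm, planeDeriv_id, hx] at h2
  have hg := gram_map (finrank_tangentSpace ξ.pt) (mfderiv (𝓡 2) (𝓡 2) f^[n] ξ.pt) B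
    (fun v ↦ (hB.1 _).trans congr($h1 v).symm)
    (fun w ↦ (congrArg (planeDeriv f^[n] ξ.pt) (hB.1 w)).trans congr($h2 w).symm)
    ξ.line.rep_nonzero
    (by
      rw [← hmax, lineNorm, div_mul_cancel₀ _ (norm_ne_zero_iff.2 ξ.line.rep_nonzero)]) v w
  refine hg.trans ?_
  congr 1
  rw [hB.2, logJacobian, mul_comm 2, Real.exp_mul, Real.exp_add,
    Real.exp_log (norm_mfderiv_iterate_pos f n _), ← exp_neg_logConorm f rfl, Real.exp_neg,
    div_inv_eq_mul]
  norm_cast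

/-- The norm and the conorm are only sub- and supermultiplicative, but their product is the factor
of areas, which is multiplicative; Birkhoff's theorem therefore applies to it. -/
theorem logJacobian_eq_birkhoffSum (f : Diffeomorph (𝓡 2) (𝓡 2) M M ∞) (n : ℕ) (x : M) :
    logJacobian f n x = birkhoffSum f (logJacobian f 1) n x := by
  have key : ∀ v w, planeGram (f^[n] x) (planeDeriv f^[n] x v) (planeDeriv f^[n] x w) =
      Real.exp (2 * birkhoffSum f (logJacobian f 1) n x) * planeGram x v w := by
    intro v w
    induction n with
    | zero =>
      rw [Function.iterate_zero, planeDeriv_id, birkhoffSum_zero, mul_zero, Real.exp_zero, one_mul]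
      rfl
    | succ n ih =>
      rw [Function.iterate_succ', planeDeriv_comp (f.contMDiff.mdifferentiable (by simp))
        (mdifferentiable_iterate f n), birkhoffSum_succ, mul_add, Real.exp_add,
        mul_comm (Real.exp _), mul_assoc, ← ih]
      exact planeGram_planeDeriv f 1 (f^[n] x) _ _
  obtain ⟨v, w, hvw⟩ := exists_planeGram_pos x
  have h := (planeGram_planeDeriv f n x v w).symm.trans (key v w)
  have := Real.exp_injective (mul_right_cancel₀ hvw.ne' h)
  linarith

theorem continuous_logJacobian (f : Diffeomorph (𝓡 2) (𝓡 2) M M ∞) (n : ℕ) :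
    Continuous (logJacobian f n) :=
  (continuous_log_norm_mfderiv_iterate f n).add (continuous_logConorm f n)

end Jacobian

/-! ### The norm of the derivative in a frame adapted to an invariant line field -/

section Shear

theorem abs_inner_div_sub_le {V : Type*} [NormedAddCommGroup V] [InnerProductSpace ℝ V] {a : V}
    (ha : a ≠ 0) (q : V) (t : ℝ) :
    |inner ℝ (t • a + q) a / ‖a‖ ^ 2 - t| ≤ ‖q‖ / ‖a‖ := by
  have ha' : 0 < ‖a‖ := norm_pos_iff.2 ha
  have e : inner ℝ (t • a + q) a / ‖a‖ ^ 2 - t = inner ℝ q a / ‖a‖ ^ 2 := by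
    rw [inner_add_left, real_inner_smul_left, real_inner_self_eq_norm_sq]
    field_simp
    ring
  rw [e, abs_div, abs_of_pos (by positivity : 0 < ‖a‖ ^ 2), div_le_div_iff₀ (by positivity) ha']
  have := abs_real_inner_le_norm q a
  nlinarith

theorem exists_abs_sub_le_of_tendsto {S : ℕ → ℝ} {l : ℝ}
    (h : Tendsto (fun n : ℕ ↦ 1 / (n : ℝ) * S n) atTop (𝓝 l)) {ε : ℝ} (hε : 0 < ε) :
    ∃ K ≥ 0, ∀ n : ℕ, |S n - n * l| ≤ n * ε + K := by
  obtain ⟨N, hN⟩ := Metric.tendsto_atTop.1 h ε hε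
  refine ⟨∑ i ∈ Finset.range (N + 1), |S i - i * l|, Finset.sum_nonneg fun i _ ↦ abs_nonneg _,
    fun n ↦ ?_⟩
  by_cases hn : n < N + 1
  · have := Finset.single_le_sum (f := fun i : ℕ ↦ |S i - i * l|) (fun i _ ↦ abs_nonneg _)
      (Finset.mem_range.2 hn)
    have h2 : 0 ≤ n * ε := by positivity
    linarith
  · have h0 : 0 ≤ ∑ i ∈ Finset.range (N + 1), |S i - i * l| :=
      Finset.sum_nonneg fun i _ ↦ abs_nonneg _
    have h1 := hN n (by omega)
    have hn0 : (0 : ℝ) < n := by exact_mod_cast (by omega : 0 < n)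
    rw [Real.dist_eq] at h1
    have e : S n - n * l = n * (1 / (n : ℝ) * S n - l) := by field_simp
    rw [e, abs_mul, abs_of_pos hn0]
    nlinarith

/-- The terms S_n + θ_i - S_{i+1} are close to (n - i - 1) l + i t, which is at most n max(l, t) up
to a constant, and there are only n of them. -/
theorem eventually_le_max_of_exp_le {a S θ : ℕ → ℝ} {C l t : ℝ} (hC : 0 ≤ C)
    (h : ∀ n, Real.exp (a n) ≤ Real.exp (S n) *
      (1 + C * ∑ i ∈ Finset.range n, Real.exp (θ i - S (i + 1))) + Real.exp (θ n))
    (hS : Tendsto (fun n : ℕ ↦ 1 / (n : ℝ) * S n) atTop (𝓝 l))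
    (hθ : Tendsto (fun n : ℕ ↦ 1 / (n : ℝ) * θ n) atTop (𝓝 t)) {ε : ℝ} (hε : 0 < ε) :
    ∀ᶠ n : ℕ in atTop, 1 / (n : ℝ) * a n < max l t + ε := by
  set χ := max l t with hχ
  have hlχ : l ≤ χ := le_max_left _ _
  have htχ : t ≤ χ := le_max_right _ _
  obtain ⟨K, hK0, hK⟩ := exists_abs_sub_le_of_tendsto hS (ε := ε / 8) (by positivity)
  obtain ⟨K', hK'0, hK'⟩ := exists_abs_sub_le_of_tendsto hθ (ε := ε / 8) (by positivity)
  set B := 2 * K + K' + |l| + ε with hB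
  have hB0 : 0 ≤ B := by positivity
  have hχε : ∀ n : ℕ, Real.exp (S n) ≤ Real.exp (n * (χ + ε / 2) + B) := by
    intro n
    rw [Real.exp_le_exp]
    have h1 := (abs_le.1 (hK n)).2
    have hn : (0 : ℝ) ≤ n := Nat.cast_nonneg n
    have h2 : n * l ≤ n * χ := by gcongr
    have h3 : (0 : ℝ) ≤ n * ε := by positivity
    linarith [abs_nonneg l]
  have hθε : ∀ n : ℕ, Real.exp (θ n) ≤ Real.exp (n * (χ + ε / 2) + B) := by
    intro n
    rw [Real.exp_le_exp]
    have h1 := (abs_le.1 (hK' n)).2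
    have hn : (0 : ℝ) ≤ n := Nat.cast_nonneg n
    have h2 : n * t ≤ n * χ := by gcongr
    have h3 : (0 : ℝ) ≤ n * ε := by positivity
    linarith [abs_nonneg l]
  have hmix : ∀ n : ℕ, ∀ i ∈ Finset.range n,
      Real.exp (S n) * Real.exp (θ i - S (i + 1)) ≤ Real.exp (n * (χ + ε / 2) + B) := by
    intro n i hi
    rw [← Real.exp_add, Real.exp_le_exp]
    have hin : (i : ℝ) + 1 ≤ n := by exact_mod_cast Finset.mem_range.1 hi
    have hi0 : (0 : ℝ) ≤ i := Nat.cast_nonneg i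
    have h1 := (abs_le.1 (hK n)).2
    have h2 := (abs_le.1 (hK' i)).2
    have h3 := (abs_le.1 (hK (i + 1))).1
    push_cast at h3
    have h4 : i * t ≤ i * χ := by gcongr
    have h5 : (n - i) * l ≤ (n - i) * χ := mul_le_mul_of_nonneg_left hlχ (by linarith)
    have h6 : i * (ε / 8) ≤ n * (ε / 8) := mul_le_mul_of_nonneg_right (by linarith) (by positivity)
    have h7 : 0 ≤ n * (ε / 8) := by
      have : (0 : ℝ) ≤ n := Nat.cast_nonneg n
      positivity
    linarith [neg_abs_le l, abs_nonneg l]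
  have hbound : ∀ n : ℕ, Real.exp (a n) ≤
      (2 + C * n) * Real.exp (n * (χ + ε / 2) + B) := by
    intro n
    refine (h n).trans ?_
    have h1 : Real.exp (S n) * ∑ i ∈ Finset.range n, Real.exp (θ i - S (i + 1)) ≤
        n * Real.exp (n * (χ + ε / 2) + B) := by
      rw [Finset.mul_sum]
      refine (Finset.sum_le_sum (hmix n)).trans_eq ?_
      simp
    have h2 := mul_le_mul_of_nonneg_left h1 hC
    have h3 := hχε n
    have h4 := hθε n
    linarith
  have hlim : Tendsto (fun n : ℕ ↦ (2 + C * n) * Real.exp B * Real.exp (-(ε / 2)) ^ n) atTop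
      (𝓝 0) := by
    have hlt : Real.exp (-(ε / 2)) < 1 := by
      rw [← Real.exp_zero, Real.exp_lt_exp]
      linarith
    have h1 := (tendsto_pow_atTop_nhds_zero_of_lt_one (Real.exp_pos (-(ε / 2))).le hlt).const_mul
      (2 * Real.exp B)
    have h2 := (tendsto_self_mul_const_pow_of_lt_one (Real.exp_pos (-(ε / 2))).le hlt).const_mul
      (C * Real.exp B)
    have h3 := h1.add h2
    rw [mul_zero, mul_zero, add_zero] at h3
    refine h3.congr fun n ↦ ?_
    ring
  filter_upwards [hlim.eventually_lt_const one_pos, eventually_gt_atTop 0] with n hn hn0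
  have hn' : (0 : ℝ) < n := by exact_mod_cast hn0
  rw [one_div, inv_mul_lt_iff₀ hn', ← Real.exp_lt_exp]
  refine (hbound n).trans_lt ?_
  have e : Real.exp (n * (χ + ε / 2) + B) =
      Real.exp B * Real.exp (-(ε / 2)) ^ n * Real.exp (n * (χ + ε)) := by
    rw [← Real.exp_nat_mul, ← Real.exp_add, ← Real.exp_add]
    congr 1
    ring
  rw [e, ← mul_assoc, ← mul_assoc]
  exact (mul_lt_mul_of_pos_right hn (Real.exp_pos _)).trans_eq (one_mul _)

variable {M : Type*} [TopologicalSpace M] [ChartedSpace Plane M] [IsManifold (𝓡 2) ∞ M]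
  [RiemannianBundle (fun x : M ↦ TangentSpace (𝓡 2) x)]

/-- The coefficient along `u` of the orthogonal projection of `w`, for the metric at `x`. -/
def planeCoeff (x : M) (u w : Plane) : ℝ :=
  inner ℝ (show TangentSpace (𝓡 2) x from w) (show TangentSpace (𝓡 2) x from u) /
    planeNorm x u ^ 2

theorem planeNorm_pos {x : M} {u : Plane} (hu : u ≠ 0) : 0 < planeNorm x u :=
  norm_pos_iff (E := TangentSpace (𝓡 2) x) |>.2 hu

theorem planeNorm_add_le (x : M) (u w : Plane) :
    planeNorm x (u + w) ≤ planeNorm x u + planeNorm x w :=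
  norm_add_le (E := TangentSpace (𝓡 2) x) u w

theorem planeNorm_smul (x : M) (t : ℝ) (u : Plane) : planeNorm x (t • u) = |t| * planeNorm x u :=
  norm_smul (β := TangentSpace (𝓡 2) x) t u

theorem planeNorm_sub_smul_sq_mul (x : M) {u : Plane} (hu : u ≠ 0) (w : Plane) :
    planeNorm x (w - planeCoeff x u w • u) ^ 2 * planeNorm x u ^ 2 = planeGram x u w :=
  norm_sub_smul_sq_mul (V := TangentSpace (𝓡 2) x) u w hu

theorem abs_planeCoeff_sub_le (x : M) {u : Plane} (hu : u ≠ 0) (q : Plane) (t : ℝ) :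
    |planeCoeff x u (t • u + q) - t| ≤ planeNorm x q / planeNorm x u :=
  abs_inner_div_sub_le (V := TangentSpace (𝓡 2) x) hu q t

theorem planeGram_le (x : M) (u w : Plane) :
    planeGram x u w ≤ planeNorm x u ^ 2 * planeNorm x w ^ 2 :=
  gram_le (V := TangentSpace (𝓡 2) x) u w

theorem planeNorm_planeDeriv_le (g : M → M) (x : M) (v : Plane) :
    planeNorm (g x) (planeDeriv g x v) ≤ ‖mfderiv (𝓡 2) (𝓡 2) g x‖ * planeNorm x v :=
  (mfderiv (𝓡 2) (𝓡 2) g x).le_opNorm v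

theorem planeDeriv_iterate_succ (f : Diffeomorph (𝓡 2) (𝓡 2) M M ∞) (n : ℕ) (x : M) (v : Plane) :
    planeDeriv f^[n + 1] x v = planeDeriv f (f^[n] x) (planeDeriv f^[n] x v) := by
  rw [Function.iterate_succ', planeDeriv_comp (f.contMDiff.mdifferentiable (by simp))
    (mdifferentiable_iterate f n)]
  rfl

variable [IsContinuousRiemannianBundle Plane (fun x : M ↦ TangentSpace (𝓡 2) x)]
  [T2Space M] [CompactSpace M]

/-- Let U_n be the image of a vector u of the line and split Df^n w = τ_n U_n + p_n with p_n
orthogonal to U_n. The area spanned with U_n bounds p_n by exp(J_n - S_n)‖w‖, where J_n is the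
log-Jacobian. One more iterate feeds at most K‖p_n‖ back into the direction of the line, which
changes τ_n by at most K‖p_n‖/‖U_{n+1}‖; summing these changes gives the bound. -/
theorem norm_mfderiv_iterate_le (f : Diffeomorph (𝓡 2) (𝓡 2) M M ∞) {K : ℝ}
    (hK : ∀ y : M, ‖mfderiv (𝓡 2) (𝓡 2) f y‖ ≤ K) (ξ : ProjTangent M) (n : ℕ) :
    ‖mfderiv (𝓡 2) (𝓡 2) f^[n] ξ.pt‖ ≤ Real.exp (birkhoffSum (lift f) (phi f) n ξ) *
      (1 + K * ∑ i ∈ Finset.range n, Real.exp (logJacobian f i ξ.pt -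
        birkhoffSum (lift f) (phi f) i ξ - birkhoffSum (lift f) (phi f) (i + 1) ξ)) +
      Real.exp (logJacobian f n ξ.pt - birkhoffSum (lift f) (phi f) n ξ) := by
  set x := ξ.pt with hx
  set S := fun n ↦ birkhoffSum (lift f) (phi f) n ξ with hS
  have hK0 : 0 ≤ K := le_trans (ContinuousLinearMap.opNorm_nonneg _) (hK x)
  let u : Plane := ξ.line.rep
  have hu : u ≠ 0 := ξ.line.rep_nonzero
  let U : ℕ → Plane := fun n ↦ planeDeriv f^[n] x u
  have hU0 : ∀ n, U n ≠ 0 := fun n ↦ mfderiv_iterate_ne_zero f n hu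
  have hU : ∀ n, planeNorm (f^[n] x) (U n) = Real.exp (S n) * planeNorm x u := by
    intro n
    have h1 : lineNorm f^[n] ξ = planeNorm (f^[n] x) (U n) / planeNorm x u := rfl
    rw [hS, ← lineNorm_iterate, h1, div_mul_cancel₀ _ (planeNorm_pos hu).ne']
  have hupos : 0 < planeNorm x u := planeNorm_pos hu
  refine ContinuousLinearMap.opNorm_le_bound _ ?_ fun w ↦ ?_
  · have : 0 ≤ ∑ i ∈ Finset.range n, Real.exp (logJacobian f i x - S i - S (i + 1)) :=
      Finset.sum_nonneg fun i _ ↦ (Real.exp_pos _).le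
    positivity
  let w' : Plane := w
  let Q : ℕ → Plane := fun n ↦ planeDeriv f^[n] x w'
  let τ : ℕ → ℝ := fun n ↦ planeCoeff (f^[n] x) (U n) (Q n)
  have hw0 : 0 ≤ planeNorm x w' := planeNorm_nonneg _ _
  have hp : ∀ n, planeNorm (f^[n] x) (Q n - τ n • U n) ≤
      Real.exp (logJacobian f n x - S n) * planeNorm x w' := by
    intro n
    have h1 := planeNorm_sub_smul_sq_mul (f^[n] x) (hU0 n) (Q n)
    rw [planeGram_planeDeriv, hU] at h1
    have h2 := mul_le_mul_of_nonneg_left (planeGram_le x u w') (Real.exp_pos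
      (2 * logJacobian f n x)).le
    have e : Real.exp (2 * logJacobian f n x) =
        Real.exp (logJacobian f n x - S n) ^ 2 * Real.exp (S n) ^ 2 := by
      rw [← Real.exp_nat_mul, ← Real.exp_nat_mul, ← Real.exp_add]
      congr 1
      push_cast
      ring
    have hpos : 0 < (Real.exp (S n) * planeNorm x u) ^ 2 := by positivity
    have h3 : planeNorm (f^[n] x) (Q n - τ n • U n) ^ 2 ≤
        (Real.exp (logJacobian f n x - S n) * planeNorm x w') ^ 2 := by
      refine le_of_mul_le_mul_right ?_ hpos
      calc planeNorm (f^[n] x) (Q n - τ n • U n) ^ 2 * (Real.exp (S n) * planeNorm x u) ^ 2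
          = Real.exp (2 * logJacobian f n x) * planeGram x u w' := h1
        _ ≤ _ := h2
        _ = _ := by rw [e]; ring
    exact (abs_le_of_sq_le_sq' h3 (by positivity)).2
  have hτstep : ∀ n, |τ (n + 1) - τ n| ≤ K * Real.exp (logJacobian f n x - S n - S (n + 1)) *
      (planeNorm x w' / planeNorm x u) := by
    intro n
    have hQ : Q (n + 1) = τ n • U (n + 1) + planeDeriv f (f^[n] x) (Q n - τ n • U n) := by
      simp only [Q, U, planeDeriv_iterate_succ]
      rw [map_sub, map_smul, add_sub_cancel]
    have h1 := abs_planeCoeff_sub_le (f^[n + 1] x) (hU0 (n + 1))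
      (planeDeriv f (f^[n] x) (Q n - τ n • U n)) (τ n)
    rw [← hQ, hU, Function.iterate_succ_apply'] at h1
    have h2 := (planeNorm_planeDeriv_le f (f^[n] x) (Q n - τ n • U n)).trans
      (mul_le_mul (hK _) (hp n) (planeNorm_nonneg _ _) hK0)
    have h1' : |τ (n + 1) - τ n| ≤ planeNorm (f (f^[n] x)) (planeDeriv f (f^[n] x)
        (Q n - τ n • U n)) / (Real.exp (S (n + 1)) * planeNorm x u) := by
      simp only [τ]
      rw [Function.iterate_succ_apply']
      exact h1
    refine h1'.trans ((div_le_div_of_nonneg_right h2 (by positivity)).trans_eq ?_)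
    rw [Real.exp_sub (logJacobian f n x - S n)]
    field_simp
  have hτ0 : |τ 0| ≤ planeNorm x w' / planeNorm x u := by
    have h1 := abs_planeCoeff_sub_le x hu w' 0
    rw [zero_smul, zero_add, sub_zero] at h1
    have e1 : U 0 = u := by
      simp only [U, Function.iterate_zero, planeDeriv_id]
      rfl
    have e2 : Q 0 = w' := by
      simp only [Q, Function.iterate_zero, planeDeriv_id]
      rfl
    simp only [τ]
    rw [e1, e2]
    exact h1
  have hτ : ∀ n, |τ n| ≤ (1 + K * ∑ i ∈ Finset.range n,
      Real.exp (logJacobian f i x - S i - S (i + 1))) * (planeNorm x w' / planeNorm x u) := by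
    intro n
    induction n with
    | zero => simpa using hτ0
    | succ n ih =>
      have h1 : |τ (n + 1)| ≤ |τ n| + |τ (n + 1) - τ n| := by
        have := abs_add_le (τ n) (τ (n + 1) - τ n)
        rwa [add_sub_cancel] at this
      rw [Finset.sum_range_succ]
      have h2 := hτstep n
      linarith
  change planeNorm (f^[n] x) (Q n) ≤ (Real.exp (S n) *
    (1 + K * ∑ i ∈ Finset.range n, Real.exp (logJacobian f i x - S i - S (i + 1))) +
      Real.exp (logJacobian f n x - S n)) * planeNorm x w'
  calc planeNorm (f^[n] x) (Q n)
      = planeNorm (f^[n] x) (τ n • U n + (Q n - τ n • U n)) := by rw [add_sub_cancel]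
    _ ≤ |τ n| * (Real.exp (S n) * planeNorm x u) +
        Real.exp (logJacobian f n x - S n) * planeNorm x w' := by
      refine (planeNorm_add_le _ _ _).trans (add_le_add ?_ (hp n))
      rw [planeNorm_smul, hU]
    _ ≤ ((1 + K * ∑ i ∈ Finset.range n, Real.exp (logJacobian f i x - S i - S (i + 1))) *
        (planeNorm x w' / planeNorm x u)) * (Real.exp (S n) * planeNorm x u) +
        Real.exp (logJacobian f n x - S n) * planeNorm x w' := by
      gcongr
      exact hτ n
    _ = _ := by
      have hc : planeNorm x w' / planeNorm x u * planeNorm x u = planeNorm x w' :=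
        div_mul_cancel₀ _ hupos.ne'
      generalize ∑ i ∈ Finset.range n, Real.exp (logJacobian f i x - S i - S (i + 1)) = s
      linear_combination (1 + K * s) * Real.exp (S n) * hc

end Shear

/-! ### The upper exponent of the projection of an invariant measure -/

section Exponent

variable {M : Type*} [TopologicalSpace M] [ChartedSpace Plane M] [IsManifold (𝓡 2) ∞ M]
  [RiemannianBundle (fun x : M ↦ TangentSpace (𝓡 2) x)]
  [IsContinuousRiemannianBundle Plane (fun x : M ↦ TangentSpace (𝓡 2) x)]
  [T2Space M] [CompactSpace M]

theorem birkhoffSum_phi_le_log_norm (f : Diffeomorph (𝓡 2) (𝓡 2) M M ∞) (n : ℕ)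
    (ξ : ProjTangent M) : birkhoffSum (lift f) (phi f) n ξ ≤
      Real.log ‖mfderiv (𝓡 2) (𝓡 2) f^[n] ξ.pt‖ := by
  rw [← log_lineNorm_iterate]
  exact Real.log_le_log (lineNorm_iterate_pos f n ξ) (lineNorm_le_norm_mfderiv _ ξ)

theorem exists_birkhoffSum_phi_eq_log_norm (f : Diffeomorph (𝓡 2) (𝓡 2) M M ∞) (n : ℕ) (x : M) :
    ∃ ξ : ProjTangent M, Real.log ‖mfderiv (𝓡 2) (𝓡 2) f^[n] x‖ =
      birkhoffSum (lift f) (phi f) n ξ := by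
  obtain ⟨ξ, -, h⟩ := exists_lineNorm_eq_norm_mfderiv (contMDiff_iterate f n) x
  exact ⟨ξ, by rw [← h, log_lineNorm_iterate]⟩

theorem abs_average_log_norm_le {f : Diffeomorph (𝓡 2) (𝓡 2) M M ∞} {C : ℝ}
    (hC : ∀ ξ : ProjTangent M, |phi f ξ| ≤ C) (n : ℕ) (x : M) :
    |1 / (n : ℝ) * Real.log ‖mfderiv (𝓡 2) (𝓡 2) f^[n] x‖| ≤ C := by
  obtain ⟨ξ, h⟩ := exists_birkhoffSum_phi_eq_log_norm f n x
  rw [h]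
  exact abs_average_le hC n ξ

theorem le_upperExponent (f : Diffeomorph (𝓡 2) (𝓡 2) M M ∞) {ξ : ProjTangent M} {l : ℝ}
    (hl : Tendsto (fun n : ℕ ↦ 1 / (n : ℝ) * birkhoffSum (lift f) (phi f) n ξ) atTop (𝓝 l)) :
    l ≤ upperExponent f ξ.pt := by
  obtain ⟨C, -, hC⟩ := exists_abs_phi_le (M := M) f
  rw [← hl.limsup_eq]
  refine limsup_le_limsup (Eventually.of_forall fun n ↦ ?_)
    (isBoundedUnder_ge_average hC ξ).isCoboundedUnder_flip
    (isBoundedUnder_of ⟨C, fun n ↦ (abs_le.1 (abs_average_log_norm_le hC n ξ.pt)).2⟩)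
  exact mul_le_mul_of_nonneg_left (birkhoffSum_phi_le_log_norm f n ξ) (by positivity)

theorem eventually_average_log_norm_lt (f : Diffeomorph (𝓡 2) (𝓡 2) M M ∞) {ξ : ProjTangent M}
    {l D : ℝ}
    (hl : Tendsto (fun n : ℕ ↦ 1 / (n : ℝ) * birkhoffSum (lift f) (phi f) n ξ) atTop (𝓝 l))
    (hD : Tendsto (fun n : ℕ ↦ 1 / (n : ℝ) * logJacobian f n ξ.pt) atTop (𝓝 D)) {ε : ℝ}
    (hε : 0 < ε) : ∀ᶠ n : ℕ in atTop,
      1 / (n : ℝ) * Real.log ‖mfderiv (𝓡 2) (𝓡 2) f^[n] ξ.pt‖ < max l (D - l) + ε := by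
  obtain ⟨K, hK⟩ := isCompact_univ.exists_bound_of_continuousOn
    (continuous_norm_mfderiv (M := M) f.contMDiff).continuousOn
  have hK : ∀ y : M, ‖mfderiv (𝓡 2) (𝓡 2) f y‖ ≤ K := fun y ↦
    (le_abs_self _).trans (hK y trivial)
  have hK0 : 0 ≤ K := le_trans (ContinuousLinearMap.opNorm_nonneg _) (hK ξ.pt)
  refine eventually_le_max_of_exp_le (C := K)
    (θ := fun n ↦ logJacobian f n ξ.pt - birkhoffSum (lift f) (phi f) n ξ) hK0 (fun n ↦ ?_)
    hl ?_ hε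
  · rw [Real.exp_log (norm_mfderiv_iterate_pos f n _)]
    exact norm_mfderiv_iterate_le f hK ξ n
  · refine (hD.sub hl).congr fun n ↦ ?_
    ring

theorem upperExponent_le (f : Diffeomorph (𝓡 2) (𝓡 2) M M ∞) {ξ : ProjTangent M} {l D : ℝ}
    (hl : Tendsto (fun n : ℕ ↦ 1 / (n : ℝ) * birkhoffSum (lift f) (phi f) n ξ) atTop (𝓝 l))
    (hD : Tendsto (fun n : ℕ ↦ 1 / (n : ℝ) * logJacobian f n ξ.pt) atTop (𝓝 D)) :
    upperExponent f ξ.pt ≤ max l (D - l) := by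
  obtain ⟨C, -, hC⟩ := exists_abs_phi_le (M := M) f
  refine le_of_forall_pos_le_add fun ε hε ↦ ?_
  refine limsup_le_of_le (IsBoundedUnder.isCoboundedUnder_flip (isBoundedUnder_of
    ⟨-C, fun n ↦ (abs_le.1 (abs_average_log_norm_le hC n ξ.pt)).1⟩)) ?_
  exact (eventually_average_log_norm_lt f hl hD hε).mono fun n hn ↦ hn.le

theorem abs_average_logConorm_le {f : Diffeomorph (𝓡 2) (𝓡 2) M M ∞} {C : ℝ}
    (hC : ∀ ξ : ProjTangent M, |phi f.symm ξ| ≤ C) (n : ℕ) (x : M) :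
    |1 / (n : ℝ) * logConorm f n x| ≤ C := by
  rw [logConorm, mul_neg, abs_neg]
  exact abs_average_log_norm_le hC n _

variable [MeasurableSpace M] [BorelSpace M]

theorem measurable_upperExponent (f : Diffeomorph (𝓡 2) (𝓡 2) M M ∞) :
    Measurable (upperExponent f : M → ℝ) :=
  Measurable.limsup fun n ↦ ((continuous_log_norm_mfderiv_iterate f n).measurable).const_mul _

/-- Truncating the averages at δ makes them converge almost everywhere to δ, so their integrals
become positive without knowing that the untruncated averages converge. -/
theorem exists_integral_logConorm_pos {f : Diffeomorph (𝓡 2) (𝓡 2) M M ∞}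
    {μ : Measure (ProjTangent M)} [IsFiniteMeasure μ] (hμ0 : μ ≠ 0) {δ : ℝ} (hδ : 0 < δ)
    (h : ∀ᵐ ξ ∂μ, ∀ᶠ n : ℕ in atTop, δ < 1 / (n : ℝ) * logConorm f n ξ.pt) :
    ∃ n > 0, 0 < ∫ x, logConorm f n x ∂(μ.map ProjTangent.pt) := by
  obtain ⟨C, hC0, hC⟩ := exists_abs_phi_le (M := M) f.symm
  have hcont : ∀ n : ℕ, Continuous fun ξ : ProjTangent M ↦ 1 / (n : ℝ) * logConorm f n ξ.pt :=
    fun n ↦ ((continuous_logConorm f n).comp ProjTangent.continuous_pt).const_mul _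
  have hlim : Tendsto (fun n : ℕ ↦ ∫ ξ, min (1 / (n : ℝ) * logConorm f n ξ.pt) δ ∂μ) atTop
      (𝓝 (∫ _, δ ∂μ)) := by
    refine tendsto_integral_of_dominated_convergence (fun _ ↦ max C δ)
      (fun n ↦ ((hcont n).min continuous_const).aestronglyMeasurable) (integrable_const _)
      (fun n ↦ Eventually.of_forall fun ξ ↦ ?_) ?_
    · have h1 := abs_le.1 (abs_average_logConorm_le hC n ξ.pt)
      rw [Real.norm_eq_abs, abs_le]
      refine ⟨le_min ?_ ?_, (min_le_right _ _).trans (le_max_right _ _)⟩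
      · linarith [le_max_left C δ]
      · linarith [le_max_left C δ]
    · filter_upwards [h] with ξ hξ
      refine tendsto_const_nhds.congr' ?_
      filter_upwards [hξ] with n hn
      exact (min_eq_right hn.le).symm
  have hpos : 0 < ∫ _ : ProjTangent M, δ ∂μ := by
    rw [integral_const, smul_eq_mul]
    have : 0 < μ.real Set.univ := by
      refine ENNReal.toReal_pos ?_ (measure_ne_top _ _)
      rwa [Measure.measure_univ_ne_zero]
    positivity
  obtain ⟨n, hn, hn0⟩ := ((hlim.eventually_const_lt hpos).and (eventually_gt_atTop 0)).exists
  refine ⟨n, hn0, ?_⟩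
  rw [integral_map ProjTangent.measurable_pt.aemeasurable
    (continuous_logConorm f n).aestronglyMeasurable]
  have hint : Integrable (fun ξ : ProjTangent M ↦ 1 / (n : ℝ) * logConorm f n ξ.pt) μ :=
    integrable_of_abs_le (hcont n).measurable fun ξ ↦ abs_average_logConorm_le hC n ξ.pt
  have h1 : ∫ ξ, min (1 / (n : ℝ) * logConorm f n ξ.pt) δ ∂μ ≤
      ∫ ξ, 1 / (n : ℝ) * logConorm f n ξ.pt ∂μ :=
    integral_mono (hint.inf (integrable_const δ)) hint fun ξ ↦ min_le_left _ _
  rw [integral_const_mul] at h1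
  exact pos_of_mul_pos_right (hn.trans_le h1) (by positivity)

/-- The upper exponent lies between λ and max(λ, D - λ). Where D - λ > λ > 0 all directions expand;
this set is invariant, and if it had positive measure its projection would charge a repelling
periodic point, against `hrep`. -/
theorem ae_upperExponent_eq {f : Diffeomorph (𝓡 2) (𝓡 2) M M ∞} {μ : Measure (ProjTangent M)}
    [IsFiniteMeasure μ] (hμ : MeasurePreserving (lift f) μ μ)
    (hpos : ∀ᵐ ξ ∂μ, ∃ l > (0 : ℝ),
      Tendsto (fun n : ℕ ↦ 1 / (n : ℝ) * birkhoffSum (lift f) (phi f) n ξ) atTop (𝓝 l))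
    (hrep : ∀ p, IsRepellingPeriodic f p → μ.map ProjTangent.pt {p} = 0) :
    ∀ᵐ ξ ∂μ, Tendsto (fun n : ℕ ↦ 1 / (n : ℝ) * birkhoffSum (lift f) (phi f) n ξ) atTop
      (𝓝 (upperExponent f ξ.pt)) := by
  obtain ⟨C, -, hC⟩ := exists_abs_phi_le (M := M) f
  obtain ⟨C', hC'⟩ := isCompact_univ.exists_bound_of_continuousOn
    (continuous_logJacobian f 1).continuousOn
  let ψ : ProjTangent M → ℝ := fun ξ ↦ logJacobian f 1 ξ.pt
  have hψ : Continuous ψ := (continuous_logJacobian f 1).comp ProjTangent.continuous_pt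
  have hψC : ∀ ξ, |ψ ξ| ≤ C' := fun ξ ↦ hC' _ trivial
  have hψS : ∀ n ξ, birkhoffSum (lift f) ψ n ξ = logJacobian f n ξ.pt := by
    intro n ξ
    rw [logJacobian_eq_birkhoffSum, birkhoffSum, birkhoffSum]
    refine Finset.sum_congr rfl fun i _ ↦ ?_
    simp only [ψ, iterate_lift_pt]
  let lam : ProjTangent M → ℝ := fun ξ ↦
    limsup (fun n : ℕ ↦ 1 / (n : ℝ) * birkhoffSum (lift f) (phi f) n ξ) atTop
  let jac : ProjTangent M → ℝ := fun ξ ↦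
    limsup (fun n : ℕ ↦ 1 / (n : ℝ) * birkhoffSum (lift f) ψ n ξ) atTop
  have hmlam : Measurable lam :=
    measurable_limsup_average hμ.measurable (continuous_phi f).measurable
  have hmjac : Measurable jac := measurable_limsup_average hμ.measurable hψ.measurable
  have hlam : ∀ᵐ ξ ∂μ, 0 < lam ξ ∧
      Tendsto (fun n : ℕ ↦ 1 / (n : ℝ) * birkhoffSum (lift f) (phi f) n ξ) atTop
        (𝓝 (lam ξ)) := by
    filter_upwards [hpos] with ξ hξ
    obtain ⟨l, hl, ht⟩ := hξ
    rw [show lam ξ = l from ht.limsup_eq]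
    exact ⟨hl, ht⟩
  have hjac : ∀ᵐ ξ ∂μ, Tendsto (fun n : ℕ ↦ 1 / (n : ℝ) * logJacobian f n ξ.pt) atTop
      (𝓝 (jac ξ)) := by
    filter_upwards [ae_exists_tendsto_average hμ hψ.measurable hψC] with ξ hξ
    obtain ⟨l, ht⟩ := hξ
    rw [show jac ξ = l from ht.limsup_eq]
    simpa only [hψS] using ht
  -- The exponents are positive but not uniformly so; the countable exhaustion supplies the uniform
  -- lower bound needed for the conorm.
  have hnull : ∀ j : ℕ, μ {ξ | lam ξ < jac ξ - lam ξ ∧ 1 / ((j : ℝ) + 1) < lam ξ} = 0 := by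
    intro j
    by_contra hne
    set δ : ℝ := 1 / ((j : ℝ) + 1) with hδ
    have hδ0 : 0 < δ := Nat.one_div_pos_of_nat
    set Y := {ξ | lam ξ < jac ξ - lam ξ ∧ δ < lam ξ} with hY
    have hYm : MeasurableSet Y := (measurableSet_lt hmlam (hmjac.sub hmlam)).inter
      (measurableSet_lt measurable_const hmlam)
    have hYinv : lift f ⁻¹' Y = Y := by
      ext ξ
      have e1 : lam (lift f ξ) = lam ξ := limsup_average_comp hC ξ
      have e2 : jac (lift f ξ) = jac ξ := limsup_average_comp hψC ξ
      simp only [hY, Set.mem_preimage, Set.mem_ofPred_eq, e1, e2]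
    have hinv : MeasurePreserving (lift f) (μ.restrict Y) (μ.restrict Y) := by
      have := hμ.restrict_preimage hYm
      rwa [hYinv] at this
    have hne' : μ.restrict Y ≠ 0 := by
      rwa [Ne, Measure.restrict_eq_zero]
    obtain ⟨n, hn, hint⟩ := exists_integral_logConorm_pos (f := f) hne' hδ0 (by
      filter_upwards [ae_restrict_of_ae hlam, ae_restrict_of_ae hjac, ae_restrict_mem hYm]
        with ξ h1 h2 h3
      -- The conorm average is the Jacobian average minus the norm average, eventually more than (D
      -- - ε) - (D - λ + ε) = λ - 2ε = δ.
      have hε : 0 < (lam ξ - δ) / 2 := half_pos (sub_pos.2 h3.2)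
      have h4 := eventually_average_log_norm_lt f h1.2 h2 hε
      rw [max_eq_right h3.1.le] at h4
      filter_upwards [h4, h2.eventually_const_lt (sub_lt_self (jac ξ) hε)] with n h5 h6
      have e : 1 / (n : ℝ) * logConorm f n ξ.pt = 1 / (n : ℝ) * logJacobian f n ξ.pt -
          1 / (n : ℝ) * Real.log ‖mfderiv (𝓡 2) (𝓡 2) f^[n] ξ.pt‖ := by
        rw [logJacobian]
        ring
      rw [e]
      linarith)
    obtain ⟨p, hp, hpne⟩ := exists_isRepellingPeriodic_of_integral_logConorm_pos
      (measurePreserving_map_pt hinv) hn hint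
    refine hpne (le_antisymm ?_ zero_le)
    rw [← hrep p hp]
    exact Measure.map_mono Measure.restrict_le_self ProjTangent.measurable_pt _
  have hle : ∀ᵐ ξ ∂μ, jac ξ - lam ξ ≤ lam ξ := by
    have hall : ∀ᵐ ξ ∂μ, ∀ j : ℕ, ¬ (lam ξ < jac ξ - lam ξ ∧ 1 / ((j : ℝ) + 1) < lam ξ) := by
      rw [ae_all_iff]
      exact fun j ↦ measure_eq_zero_iff_ae_notMem.1 (hnull j)
    filter_upwards [hall, hlam] with ξ h1 h2
    obtain ⟨j, hj⟩ := exists_nat_one_div_lt h2.1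
    by_contra hcon
    exact h1 j ⟨not_le.1 hcon, hj⟩
  filter_upwards [hlam, hjac, hle] with ξ h1 h2 h3
  have h4 := upperExponent_le f h1.2 h2
  rw [max_eq_left h3] at h4
  rw [le_antisymm h4 (le_upperExponent f h1.2)]
  exact h1.2

theorem measureExponent_map_pt {f : Diffeomorph (𝓡 2) (𝓡 2) M M ∞} {μ : Measure (ProjTangent M)}
    [IsFiniteMeasure μ] (hμ : MeasurePreserving (lift f) μ μ)
    (hpos : ∀ᵐ ξ ∂μ, ∃ l > (0 : ℝ),
      Tendsto (fun n : ℕ ↦ 1 / (n : ℝ) * birkhoffSum (lift f) (phi f) n ξ) atTop (𝓝 l))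
    (hrep : ∀ p, IsRepellingPeriodic f p → μ.map ProjTangent.pt {p} = 0) :
    measureExponent f (μ.map ProjTangent.pt) = ∫ ξ, phi f ξ ∂μ := by
  obtain ⟨C, -, hC⟩ := exists_abs_phi_le (M := M) f
  rw [measureExponent, integral_map ProjTangent.measurable_pt.aemeasurable
    (measurable_upperExponent f).aestronglyMeasurable]
  exact (integral_eq_of_ae_tendsto_average hμ (continuous_phi f).measurable hC
    (ae_upperExponent_eq hμ hpos hrep)).symm

end Exponent

end SurfaceDynamics

end

/-! ### Assembly of the theorem -/

open SurfaceDynamics in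
theorem mainTheorem3 {M : Type*} [TopologicalSpace M] [T2Space M] [CompactSpace M]
    [ChartedSpace Plane M] [IsManifold (𝓡 2) ∞ M]
    [RiemannianBundle (fun x : M ↦ TangentSpace (𝓡 2) x)]
    [IsContMDiffRiemannianBundle (𝓡 2) ∞ Plane (fun x : M ↦ TangentSpace (𝓡 2) x)]
    [MeasurableSpace M] [BorelSpace M]
    (f : Diffeomorph (𝓡 2) (𝓡 2) M M ∞) (σ : RegularCurve M)
    (hσ : 0 < volume {s : unitInterval | 0 < curveExponent f σ s})
    (d : MetricSpace (FiniteMeasure (ProjTangent M)))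
    (hd : d.toPseudoMetricSpace.toUniformSpace.toTopologicalSpace = weakStar M) :
    0 < lambdaBar f σ ∧
    ∀ lmin lmax ρ : ℕ → ℝ, IsRateSequence (lambdaBar f σ) lmin lmax ρ →
      (∃ n α L δ T', IsSelection f σ d lmin lmax ρ n α L δ T') ∧
      ∀ n α L δ T', IsSelection f σ d lmin lmax ρ n α L δ T' →
        ∃ ξ : ℕ → ProjTangent M, (∀ k, ξ k ∈ σ.lift '' T' k) ∧
          (∃ κ : ℕ → ℕ, StrictMono κ ∧ ∃ β μ₀ μ₁,
            IsNeutralDecomposition f (n ∘ κ) (ξ ∘ κ) β μ₀ μ₁) ∧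
          ∀ κ : ℕ → ℕ, StrictMono κ → ∀ β μ₀ μ₁,
            IsNeutralDecomposition f (n ∘ κ) (ξ ∘ κ) β μ₀ μ₁ →
            (∀ p, IsRepellingPeriodic f p →
              (μ₁ : Measure (ProjTangent M)).map ProjTangent.pt
                (Set.range fun i : ℕ ↦ f^[i] p) = 0) ∧
            (β : ℝ) * measureExponent f ((μ₁ : Measure (ProjTangent M)).map ProjTangent.pt) =
              lambdaBar f σ ∧
            β ≠ 0 := by
  have : IsContinuousRiemannianBundle Plane (fun x : M ↦ TangentSpace (𝓡 2) x) := by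
    obtain ⟨g, hg, h⟩ := IsContMDiffRiemannianBundle.exists_contMDiff (IB := 𝓡 2) (n := ∞)
      (F := Plane) (E := fun x : M ↦ TangentSpace (𝓡 2) x)
    exact ⟨g, hg.continuous, h⟩
  have hmet : TopologicalSpace.MetrizableSpace (ProjTangent M) := ProjTangent.metrizableSpace d hd
  have hfc : FirstCountableTopology (FiniteMeasure (ProjTangent M)) := by
    have h := @EMetricSpace.metrizableSpace _ d.toEMetricSpace
    rw [hd] at h
    infer_instance
  have hpos := lambdaBar_pos f σ hσ
  refine ⟨hpos, fun lmin lmax ρ hr ↦ ⟨exists_isSelection f σ d hd hr,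
    fun n α L δ T' hsel ↦ ?_⟩⟩
  -- The points ξ_k may be chosen arbitrarily in the lifts of T'; only nonemptiness, forced by
  -- positive measure, is needed.
  have hne : ∀ k, (T' k).Nonempty := by
    intro k
    by_contra hempty
    have h := hsel.large' k
    rw [Set.not_nonempty_iff_eq_empty.1 hempty, measureReal_empty] at h
    exact absurd h (not_lt.2 (pow_pos (hr.ρ_pos k) _).le)
  choose s hs using hne
  have hξ : ∀ k, σ.lift (s k) ∈ σ.lift '' T' k := fun k ↦ ⟨s k, hs k, rfl⟩
  have hgood := fun k ↦ (mem_goodSet_iff f σ).1 (hsel.subset k (hs k))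
  refine ⟨fun k ↦ σ.lift (s k), hξ, exists_isNeutralDecomposition f hsel.tendsto_n
    (fun k ↦ (hgood k).2.2.1) (fun k ↦ (hgood k).2.2.2), fun κ hκ β μ₀ μ₁ hdec ↦ ?_⟩
  have hint := hdec.mul_integral_phi hr hsel hξ hκ
  have hβ : β ≠ 0 := by
    rintro rfl
    rw [NNReal.coe_zero, zero_mul] at hint
    exact hpos.ne hint
  have hrep := fun p hp ↦ hdec.measure_orbit_eq_zero hd hr hsel hξ hκ hβ (p := p) hp
  -- Positivity of the exponent is given for β μ̂₁; since β ≠ 0, it holds for μ̂₁ itself.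
  have hexp := ae_iff.1 hdec.pos
  rw [Measure.smul_apply, ENNReal.smul_def, smul_eq_mul, mul_eq_zero, ENNReal.coe_eq_zero] at hexp
  refine ⟨hrep, ?_, hβ⟩
  rw [measureExponent_map_pt hdec.invariant₁ (ae_iff.2 (hexp.resolve_left hβ)) fun p hp ↦
    measure_mono_null (Set.singleton_subset_iff.2 (Set.mem_range.2 ⟨0, rfl⟩)) (hrep p hp), hint]
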